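/- There are a single randomized algorithm and an absolute constant $C>0$ such that the following holds for every $n\ge 1$ and every $\varepsilon>0$. Let $A\in\mathbb R^{n\times n}$ be a stochastic matrix (non-negative entries, every column sums to $1$) with an eigendecomposition $A=Q\Lambda Q^{-1}$, where $Q\in\mathbb R^{n\times n}$ is invertible and $\Lambda=\mathrm{diag}(\lambda_1,\dots,\lambda_n)$ with $\lambda_i\in[-1,1]$, and let $\mu_\lambda=\frac1n\sum_{i=1}^n\delta_{\lambda_i}$ be its spectral distribution. The algorithm receives the accuracy $\varepsilon$ in the form of the integer $\lceil 1/\varepsilon\rceil$, and has access to $A$ only through unit-cost oracle calls that return either a uniformly random index $j\in\{1,\dots,n\}$, or, for an index $j$ obtained before, a random index distributed according to the $j$-th column of $A$ (all calls being independent); indices can be stored and tested for equality at unit cost (plus, as for every memory access, the bit length of a computed memory address), and integer arithmetic is charged by the bit lengths of the operands. The algorithm always halts, with running time and number of oracle calls at most $C e^{C/\varepsilon}$ (that is, $e^{O(1/\varepsilon)}$, independently of $n$), and with probability at least $2/3$ it outputs a finitely supported probability distribution $\hat p$ on $\mathbb R$, given by its atoms and their masses as rational numbers, such that $$W_1(\hat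 p,\mu_\lambda)\le\varepsilon ,$$ where $W_1(p,q)=\inf_\pi\int|x-y|\,d\pi(x,y)$, the infimum over all couplings $\pi$ of $p$ and $q$, is the earth mover (Wasserstein-1) distance. -/

import Mathlib

namespace SpectralSampling

open MeasureTheory
open scoped ENNReal

noncomputable section

/-! ### Column distributions, spectral distribution, earth mover distance -/

theorem sum_ofReal_column {n : ℕ} {A : Matrix (Fin n) (Fin n) ℝ}
    (hA : A ∈ Matrix.colStochastic ℝ (Fin n)) (j : Fin n) :
    ∑ i, ENNReal.ofReal (A i j) = 1 := by
  rw [← ENNReal.ofReal_sum_of_nonneg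
    (fun i _ => Matrix.nonneg_of_mem_colStochastic hA),
    Matrix.sum_col_of_mem_colStochastic hA j, ENNReal.ofReal_one]

/-- The `j`-th column of a column-stochastic matrix, as a distribution on the indices. -/
def column {n : ℕ} (A : Matrix (Fin n) (Fin n) ℝ)
    (hA : A ∈ Matrix.colStochastic ℝ (Fin n)) (j : Fin n) : PMF (Fin n) :=
  PMF.ofFintype (fun i => ENNReal.ofReal (A i j)) (sum_ofReal_column hA j)

/-- `n` equally weighted point masses at `lam 0, …, lam (n - 1)`. -/
def spectralDistribution {n : ℕ} (lam : Fin n → ℝ) : Measure ℝ :=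
  ∑ i, (n : ℝ≥0∞)⁻¹ • Measure.dirac (lam i)

/-- Earth mover (Wasserstein-1) distance: the infimum of the transport cost over all couplings.
It is `⊤` if there is no coupling. -/
def W1 (μ ν : Measure ℝ) : ℝ≥0∞ :=
  ⨅ (π : Measure (ℝ × ℝ)) (_ : π.map Prod.fst = μ ∧ π.map Prod.snd = ν),
    ∫⁻ z, edist z.1 z.2 ∂π

/-! ### Randomized programs with oracle access

A program works on a random access memory of integer cells and on a random access memory of
vertex cells. Integers are charged by bit length. Vertices (indices of rows and columns of the
matrix) are opaque unit-cost words, which can only be drawn uniformly at random, drawn from the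
column distribution of a stored vertex, and compared for equality. The dimension of the matrix
is not an input of a program. -/

/-- Addressing modes: cell number `i`, or the cell whose number is the content of integer
cell `i`. -/
inductive Loc where
  | dir (i : ℕ)
  | ind (i : ℕ)

inductive Op where
  | add
  | sub
  | mul
  | div

inductive Prog where
  /-- integer cell `d` := the constant `z` -/
  | const (d : Loc) (z : ℤ)
  /-- integer cell `d` := content of integer cell `a` -/
  | copy (d a : Loc)
  /-- integer cell `d` := `a o b` -/
  | arith (o : Op) (d a b : Loc)
  /-- vertex cell `d` := a uniformly random vertex -/
  | unif (d : Loc)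
  /-- vertex cell `d` := a sample from the column named by vertex cell `v` -/
  | sample (d v : Loc)
  /-- integer cell `d` := `1` if vertex cells `v` and `w` agree, else `0` -/
  | test (d v w : Loc)
  | seq (p q : Prog)
  /-- run `p` if integer cell `a` is positive, else `q` -/
  | cond (a : Loc) (p q : Prog)
  /-- repeat `p` as long as integer cell `a` is positive -/
  | loop (a : Loc) (p : Prog)

/-- The two memories, with the running time and the number of oracle calls so far. -/
structure State (n : ℕ) where
  mem : ℕ → ℤ
  vtx : ℕ → Option (Fin n)
  time : ℕ
  queries : ℕ

/-- Bit length of the absolute value. -/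
def bits (z : ℤ) : ℕ := z.natAbs.size

def Op.eval : Op → ℤ → ℤ → ℤ
  | .add, x, y => x + y
  | .sub, x, y => x - y
  | .mul, x, y => x * y
  | .div, x, y => x / y

namespace State

variable {n : ℕ}

/-- The cell number that a location refers to. -/
def addr (s : State n) : Loc → ℕ
  | .dir i => i
  | .ind i => (s.mem i).toNat

/-- The cost of resolving an address. -/
def addrCost (s : State n) : Loc → ℕ
  | .dir _ => 1
  | .ind i => 1 + bits (s.mem i)

def val (s : State n) (a : Loc) : ℤ := s.mem (s.addr a)

def vert (s : State n) (v : Loc) : Option (Fin n) := s.vtx (s.addr v)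

def setMem (s : State n) (d : Loc) (z : ℤ) : State n :=
  { s with mem := Function.update s.mem (s.addr d) z }

def setVtx (s : State n) (d : Loc) (v : Option (Fin n)) : State n :=
  { s with vtx := Function.update s.vtx (s.addr d) v }

def charge (s : State n) (t : ℕ) : State n := { s with time := s.time + t }

/-- Count one oracle call. -/
def query (s : State n) : State n := { s with queries := s.queries + 1 }

/-- The input is written to integer cell `0`; all other integer cells hold `0` and all vertex
cells are empty. -/
def init (n : ℕ) (k : ℕ) : State n where
  mem := Function.update (fun _ => 0) 0 (k : ℤ)
  vtx := fun _ => none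
  time := 0
  queries := 0

/-! The output is a finitely supported distribution: integer cell `0` holds a common denominator
`D`, integer cell `1` the number `m` of atoms, and for `i < m` the integer cells `2 + 2 i` and
`3 + 2 i` hold `x i` and `w i`; the `i`-th atom has location `x i / D` and mass
`w i / ∑ j < m, w j`. -/

def atoms (s : State n) : ℕ := (s.mem 1).toNat

def location (s : State n) (i : ℕ) : ℝ := (s.mem (2 + 2 * i) : ℝ) / (s.mem 0 : ℝ)

def weight (s : State n) (i : ℕ) : ℤ := s.mem (3 + 2 * i)

def totalWeight (s : State n) : ℤ := ∑ i ∈ Finset.range s.atoms, s.weight i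

/-- The memory contents encode a distribution. -/
def WellFormed (s : State n) : Prop :=
  0 < s.mem 0 ∧ (∀ i < s.atoms, 0 ≤ s.weight i) ∧ 0 < s.totalWeight

/-- The encoded distribution. -/
def output (s : State n) : Measure ℝ :=
  ∑ i ∈ Finset.range s.atoms,
    ENNReal.ofReal ((s.weight i : ℝ) / (s.totalWeight : ℝ)) • Measure.dirac (s.location i)

end State

/-- The distribution of the final state of a program that has access to the column
distributions `col`. The result is `none` on those runs whose recursion depth exceeds `fuel`, and
does not depend on `fuel` on the other runs. -/
def exec {n : ℕ} [NeZero n] (col : Fin n → PMF (Fin n)) :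
    (fuel : ℕ) → Prog → State n → PMF (Option (State n))
  | 0, _, _ => PMF.pure none
  | fuel + 1, p, s =>
    match p with
    | .const d z =>
        PMF.pure (some ((s.setMem d z).charge (1 + s.addrCost d + bits z)))
    | .copy d a =>
        PMF.pure (some ((s.setMem d (s.val a)).charge
          (1 + s.addrCost d + s.addrCost a + bits (s.val a))))
    | .arith o d a b =>
        PMF.pure (some ((s.setMem d (o.eval (s.val a) (s.val b))).charge
          (s.addrCost d + s.addrCost a + s.addrCost b
            + (1 + bits (s.val a)) * (1 + bits (s.val b)))))
    | .unif d =>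
        (PMF.uniformOfFintype (Fin n)).map fun j =>
          some (((s.setVtx d (some j)).charge (1 + s.addrCost d)).query)
    | .sample d v =>
        (match s.vert v with
          | none => PMF.pure none
          | some j => (col j).map some).map fun x =>
            some (((s.setVtx d x).charge (1 + s.addrCost d + s.addrCost v)).query)
    | .test d v w =>
        PMF.pure (some ((s.setMem d (if s.vert v = s.vert w then 1 else 0)).charge
          (1 + s.addrCost d + s.addrCost v + s.addrCost w)))
    | .seq p q =>
        (exec col fuel p s).bind fun r => r.elim (PMF.pure none) (exec col fuel q)
    | .cond a p q =>
        let s' := s.charge (1 + s.addrCost a + bits (s.val a))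
        if 0 < s.val a then exec col fuel p s' else exec col fuel q s'
    | .loop a p =>
        let s' := s.charge (1 + s.addrCost a + bits (s.val a))
        if 0 < s.val a then
          (exec col fuel p s').bind fun r => r.elim (PMF.pure none) (exec col fuel (.loop a p))
        else PMF.pure (some s')

end

end SpectralSampling

/-!
Since `A = Q Λ Q⁻¹`, the `j`-th moment of the spectral distribution is `tr (A ^ j) / n`, the
probability that a random walk from a uniformly random vertex is back at its start after `j` steps.
By Chebyshev's inequality, the return frequencies of `G ^ 3` walks of length `8 * m` are with
probability at least `2 / 3` all within `1 / G` of the moments.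

Smear the spectral distribution out over the grid `G⁻¹ ℤ ∩ [-2, 2]`, with the weights
`K ((x - y) / 4)`, where `K` is the fourth power of the Dirichlet kernel of degree `2 * m` in the
variable `sin φ`. This moves it only by `O(1 / m)`. As `K` is a polynomial of degree `8 * m`, the
weight of `y` is a combination of the first `8 * m` moments. The coefficients are exponentially
large in `m`, and so is `G`, chosen such that the errors of the moments do not matter. With
`m = O(1 / ε)` everything takes time `exp (O(1 / ε))`.

The algorithm never handles the coefficients or the moments one by one. It maintains the generating
function `H` of the return counts, evaluated at a huge integer `B`, and obtains the required
combination as a digit in base `B` of the product of `H` with the value of the kernel polynomial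
at `B` (Kronecker substitution).
-/

namespace SpectralSampling

open MeasureTheory Filter Polynomial
open scoped ENNReal

noncomputable section

/-! ### The kernel -/

/-- Scaled Dirichlet kernels: for `V = 2 * cos (2 * φ)` and `E = 1` the value at `j` is
`sin ((2 * j + 1) * φ) / sin φ`. -/
def dirichletSeq {R : Type*} [CommRing R] (V E : R) : ℕ → R
  | 0 => 1
  | 1 => V + E
  | j + 2 => V * dirichletSeq V E (j + 1) - E ^ 2 * dirichletSeq V E j

theorem map_dirichletSeq {R S : Type*} [CommRing R] [CommRing S] (f : R →+* S) (V E : R) (j : ℕ) :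
    f (dirichletSeq V E j) = dirichletSeq (f V) (f E) j := by
  induction j using Nat.twoStepInduction with
  | zero => simp [dirichletSeq]
  | one => simp [dirichletSeq]
  | more j h₁ h₂ => simp [dirichletSeq, h₁, h₂]

theorem dirichletSeq_mul_left {R : Type*} [CommRing R] (v E : R) (j : ℕ) :
    dirichletSeq (E * v) E j = E ^ j * dirichletSeq v 1 j := by
  induction j using Nat.twoStepInduction with
  | zero => simp [dirichletSeq]
  | one => simp only [dirichletSeq]; ring
  | more j h₁ h₂ => simp only [dirichletSeq, h₁, h₂]; ring

/-- The Dirichlet kernel of degree `2 * m` as a polynomial function of `u = sin φ`. -/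
def dirichletKernel (m : ℕ) (u : ℝ) : ℝ := dirichletSeq (2 - 4 * u ^ 2) 1 m

theorem dirichletKernel_neg (m : ℕ) (u : ℝ) : dirichletKernel m (-u) = dirichletKernel m u := by
  simp [dirichletKernel]

theorem dirichletKernel_sin_mul_sin (m : ℕ) (φ : ℝ) :
    dirichletKernel m (Real.sin φ) * Real.sin φ = Real.sin ((2 * m + 1) * φ) := by
  have hv : 2 - 4 * Real.sin φ ^ 2 = 2 * Real.cos (2 * φ) := by
    rw [Real.cos_two_mul, Real.cos_sq']; ring
  unfold dirichletKernel
  induction m using Nat.twoStepInduction with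
  | zero => simp [dirichletSeq]
  | one =>
    rw [dirichletSeq, Nat.cast_one, show (2 * 1 + 1 : ℝ) * φ = 3 * φ by ring, Real.sin_three_mul]
    ring
  | more j h₁ h₂ =>
    have next : (2 * ((j + 2 : ℕ) : ℝ) + 1) * φ = (2 * ((j + 1 : ℕ) : ℝ) + 1) * φ + 2 * φ := by
      push_cast; ring
    have prev : (2 * (j : ℝ) + 1) * φ = (2 * ((j + 1 : ℕ) : ℝ) + 1) * φ - 2 * φ := by
      push_cast; ring
    rw [dirichletSeq, sub_mul, mul_assoc, h₂, one_pow, one_mul, h₁, hv, next, prev, Real.sin_add,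
      Real.sin_sub]
    ring

theorem abs_dirichletKernel_mul_abs_le_one (m : ℕ) {u : ℝ} (hu : |u| ≤ 1) :
    |dirichletKernel m u| * |u| ≤ 1 := by
  rw [abs_le] at hu
  rw [← Real.sin_arcsin hu.1 hu.2, ← abs_mul, dirichletKernel_sin_mul_sin]
  exact Real.abs_sin_le_one _

theorem dirichletKernel_zero (m : ℕ) : dirichletKernel m 0 = 2 * m + 1 := by
  unfold dirichletKernel
  induction m using Nat.twoStepInduction with
  | zero => simp [dirichletSeq]
  | one => norm_num [dirichletSeq]
  | more j h₁ h₂ => rw [dirichletSeq, h₁, h₂]; push_cast; ring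

theorem half_le_dirichletKernel_of_pos (m : ℕ) {u : ℝ} (hu : 0 < u) (h : (2 * m + 1) * u ≤ 1) :
    (2 * m + 1) / 2 ≤ dirichletKernel m u := by
  have := m.cast_nonneg (α := ℝ)
  have hpi := Real.pi_pos
  have sin_arcsin : Real.sin (Real.arcsin u) = u := Real.sin_arcsin (by linarith) (by nlinarith)
  set φ := Real.arcsin u
  have hφ₀ : 0 < φ := Real.arcsin_pos.mpr hu
  have hφu : φ ≤ Real.pi / 2 * u := by
    have := Real.mul_le_sin hφ₀.le (Real.arcsin_le_pi_div_two u)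
    rw [sin_arcsin, div_mul_eq_mul_div, div_le_iff₀ hpi] at this
    linarith
  have huφ : u ≤ φ := sin_arcsin ▸ Real.sin_le hφ₀.le
  have angle_le : (2 * m + 1) * φ ≤ Real.pi / 2 := by nlinarith
  have two_div_pi : (1 : ℝ) / 2 ≤ 2 / Real.pi := by
    rw [div_le_div_iff₀ two_pos hpi]
    linarith [Real.pi_le_four]
  refine le_of_mul_le_mul_right ?_ hu
  calc (2 * (m : ℝ) + 1) / 2 * u = 1 / 2 * ((2 * m + 1) * u) := by ring
    _ ≤ 2 / Real.pi * ((2 * m + 1) * φ) := by gcongr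
    _ ≤ Real.sin ((2 * m + 1) * φ) := Real.mul_le_sin (by positivity) angle_le
    _ = dirichletKernel m u * u := by rw [← dirichletKernel_sin_mul_sin, sin_arcsin]

theorem half_le_dirichletKernel (m : ℕ) {u : ℝ} (h : (2 * m + 1) * |u| ≤ 1) :
    (2 * m + 1) / 2 ≤ dirichletKernel m u := by
  rcases lt_trichotomy u 0 with hu | rfl | hu
  · rw [← dirichletKernel_neg]
    exact half_le_dirichletKernel_of_pos m (neg_pos.mpr hu) (abs_of_neg hu ▸ h)
  · rw [dirichletKernel_zero]
    have := m.cast_nonneg (α := ℝ)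
    linarith
  · exact half_le_dirichletKernel_of_pos m hu (abs_of_pos hu ▸ h)

/-- The integers of absolute value at most `R`. -/
def window (R : ℕ) : Finset ℤ := Finset.Icc (-(R : ℤ)) R

theorem mem_window {R : ℕ} {d : ℤ} : d ∈ window R ↔ |d| ≤ R := by
  rw [window, Finset.mem_Icc, abs_le]

theorem card_window (R : ℕ) : (window R).card = 2 * R + 1 := by
  rw [window, Int.card_Icc]; omega

theorem window_mono {R S : ℕ} (h : R ≤ S) : window R ⊆ window S := fun _ hd =>
  mem_window.mpr ((mem_window.mp hd).trans (by exact_mod_cast h))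

theorem sum_window_translate_le {f : ℤ → ℝ} (hf : ∀ d, 0 ≤ f d) {R S : ℕ} {x : ℤ} (hx : |x| ≤ S) :
    ∑ y ∈ window R, f (x - y) ≤ ∑ d ∈ window (R + S), f d := by
  rw [← Finset.sum_image (g := fun y => x - y) (fun _ _ _ _ h => by simpa using h)]
  refine Finset.sum_le_sum_of_subset_of_nonneg (Finset.image_subset_iff.mpr fun y hy => ?_)
    fun d _ _ => hf d
  rw [mem_window] at *
  push_cast
  linarith [abs_sub x y]

theorem sum_window_le_translate {f : ℤ → ℝ} (hf : ∀ d, 0 ≤ f d) {R S : ℕ} {x : ℤ} (hx : |x| ≤ S) :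
    ∑ d ∈ window R, f d ≤ ∑ y ∈ window (R + S), f (x - y) := by
  simpa only [sub_sub_cancel] using sum_window_translate_le (f := fun d => f (x - d))
    (fun d => hf _) (R := R) hx

theorem sum_window_inv_sq_le {K : ℕ} (hK : 0 < K) (R : ℕ) :
    ∑ d ∈ window R with (K : ℤ) < |d|, ((d : ℝ) ^ 2)⁻¹ ≤ 2 / K := by
  have even : Function.Even fun d : ℤ => if (K : ℤ) < |d| then ((d : ℝ) ^ 2)⁻¹ else 0 :=
    fun d => by simp only [abs_neg, Int.cast_neg, neg_sq]
  have half : ∑ d ∈ Finset.range (R + 1),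
      (if (K : ℤ) < |(d : ℤ)| then (((d : ℤ) : ℝ) ^ 2)⁻¹ else 0) =
        ∑ d ∈ Finset.Ioc K R, ((d : ℝ) ^ 2)⁻¹ := by
    rw [← Finset.sum_filter]
    refine Finset.sum_congr (Finset.ext fun d => ?_) fun d _ => by rw [Int.cast_natCast]
    simp only [Finset.mem_filter, Finset.mem_range, Finset.mem_Ioc, Nat.abs_cast, Nat.cast_lt]
    omega
  rw [Finset.sum_filter, window, Finset.sum_Icc_of_even_eq_range even, half,
    if_neg (by simp), sub_zero, nsmul_eq_mul, div_eq_mul_inv]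
  push_cast
  gcongr
  rcases le_or_gt K R with h | h
  · exact (sum_Ioc_inv_sq_le_sub hK.ne' h).trans (sub_le_self _ (by positivity))
  · rw [Finset.Ioc_eq_empty (by omega), Finset.sum_empty]
    positivity

/-- The fourth power of the Dirichlet kernel at the point `d / (4 * G)` of the grid. -/
def gridKernel (m G : ℕ) (d : ℤ) : ℝ := dirichletKernel m ((d : ℝ) / (4 * G)) ^ 4

theorem gridKernel_nonneg (m G : ℕ) (d : ℤ) : 0 ≤ gridKernel m G d :=
  Even.pow_nonneg (by decide) _

section

variable {m G : ℕ}

theorem gridKernel_mul_pow_le (hG : 0 < G) {d : ℤ} (hd : |d| ≤ 4 * G) :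
    gridKernel m G d * |(d : ℝ)| ^ 4 ≤ 256 * (G : ℝ) ^ 4 := by
  have hG' : (0 : ℝ) < 4 * G := by positivity
  have hd' : |(d : ℝ)| ≤ 4 * G := by exact_mod_cast hd
  have h := abs_dirichletKernel_mul_abs_le_one m (u := (d : ℝ) / (4 * G)) (by
    rwa [abs_div, abs_of_pos hG', div_le_one hG'])
  rw [abs_div, abs_of_pos hG', ← mul_div_assoc, div_le_one hG'] at h
  have := pow_le_pow_left₀ (by positivity) h 4
  rw [mul_pow, Even.pow_abs (by decide)] at this
  exact this.trans_eq (by ring)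

theorem gridKernel_mul_abs_le_of_far (hG : 0 < G) {d : ℤ} (hd : |d| ≤ 4 * G)
    (hfar : 4 * G < (2 * m + 1) * |(d : ℝ)|) :
    gridKernel m G d * (|(d : ℝ)| / (4 * G)) ≤
      16 * (2 * m + 1) * (G : ℝ) ^ 2 * ((d : ℝ) ^ 2)⁻¹ := by
  rw [← sq_abs (d : ℝ)]
  have decay := gridKernel_mul_pow_le (m := m) hG hd
  have hG' : (0 : ℝ) < G := by exact_mod_cast hG
  have hx : 0 < |(d : ℝ)| := by
    by_contra! hx
    nlinarith
  set x := |(d : ℝ)|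
  rw [← div_eq_mul_inv, ← mul_div_assoc, div_le_div_iff₀ (by positivity) (pow_pos hx 2)]
  refine le_of_mul_le_mul_right ?_ hx
  calc gridKernel m G d * x * x ^ 2 * x = gridKernel m G d * x ^ 4 := by ring
    _ ≤ 256 * (G : ℝ) ^ 4 := decay
    _ = 64 * (G : ℝ) ^ 3 * (4 * G) := by ring
    _ ≤ 64 * (G : ℝ) ^ 3 * ((2 * m + 1) * x) := by gcongr
    _ = 16 * (2 * m + 1) * (G : ℝ) ^ 2 * (4 * G) * x := by ring

theorem gridKernel_mul_abs_le_of_near {d : ℤ} (hnear : (2 * m + 1) * |(d : ℝ)| ≤ 4 * G) :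
    gridKernel m G d * (|(d : ℝ)| / (4 * G)) ≤ gridKernel m G d / (2 * m + 1) := by
  rw [div_eq_mul_one_div (gridKernel m G d)]
  refine mul_le_mul_of_nonneg_left (div_le_of_le_mul₀ (by positivity) (by positivity) ?_)
    (gridKernel_nonneg _ _ _)
  rw [one_div_mul_eq_div, le_div_iff₀ (by positivity)]
  linarith

/-- The mass of the kernel on a window. -/
def gridMass (m G R : ℕ) : ℝ := ∑ d ∈ window R, gridKernel m G d

theorem le_gridMass (hG : 0 < G) (hm : 4 ≤ 2 * m + 1) :
    (G : ℝ) * (2 * m + 1) ^ 3 / 4 ≤ gridMass m G G := by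
  have hG' : (0 : ℝ) < 4 * G := by positivity
  set K := 4 * G / (2 * m + 1)
  have hKG : K ≤ G := Nat.div_le_of_le_mul (Nat.mul_le_mul_right _ hm)
  have hK : (K : ℝ) * (2 * m + 1) ≤ 4 * G := by exact_mod_cast Nat.div_mul_le_self (4 * G) _
  have hK' : (4 * G : ℝ) < (2 * m + 1) * (K + 1) := by
    exact_mod_cast Nat.lt_mul_div_succ (4 * G) (by omega : 0 < 2 * m + 1)
  have kernel_large : ∀ d ∈ window K, (2 * m + 1 : ℝ) ^ 4 / 16 ≤ gridKernel m G d := by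
    intro d hd
    have hd' : |(d : ℝ)| ≤ K := by exact_mod_cast mem_window.mp hd
    have half_le := half_le_dirichletKernel m (u := (d : ℝ) / (4 * G)) (by
      rw [abs_div, abs_of_pos hG', ← mul_div_assoc, div_le_one hG']
      nlinarith)
    calc (2 * m + 1 : ℝ) ^ 4 / 16 = ((2 * m + 1) / 2) ^ 4 := by ring
      _ ≤ gridKernel m G d := pow_le_pow_left₀ (by positivity) half_le 4
  have card_large : (4 * G : ℝ) / (2 * m + 1) ≤ (window K).card := by
    rw [card_window, div_le_iff₀ (by positivity)]
    push_cast
    nlinarith [K.cast_nonneg (α := ℝ)]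
  calc (G : ℝ) * (2 * m + 1) ^ 3 / 4 = (4 * G / (2 * m + 1)) * ((2 * m + 1) ^ 4 / 16) := by
        field_simp; ring
    _ ≤ ((window K).card : ℝ) * ((2 * m + 1) ^ 4 / 16) := by gcongr
    _ = (window K).card • ((2 * m + 1 : ℝ) ^ 4 / 16) := (nsmul_eq_mul _ _).symm
    _ ≤ ∑ d ∈ window K, gridKernel m G d := Finset.card_nsmul_le_sum _ _ _ kernel_large
    _ ≤ gridMass m G G := Finset.sum_le_sum_of_subset_of_nonneg (window_mono hKG)
        fun d _ _ => gridKernel_nonneg _ _ d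

theorem gridMass_three_mul_le (hG : 0 < G) :
    gridMass m G (3 * G) ≤ gridMass m G G + 1024 * G := by
  have hsub : window G ⊆ window (3 * G) := window_mono (by omega)
  have kernel_small : ∀ d ∈ window (3 * G) \ window G, gridKernel m G d ≤ 256 := by
    intro d hd
    rw [Finset.mem_sdiff, mem_window, mem_window, not_le] at hd
    push_cast at hd
    have hd' : (G : ℝ) ≤ |(d : ℝ)| := by exact_mod_cast hd.2.le
    refine le_of_mul_le_mul_right (a := (G : ℝ) ^ 4) ?_ (by positivity)
    calc gridKernel m G d * (G : ℝ) ^ 4 ≤ gridKernel m G d * |(d : ℝ)| ^ 4 := by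
          have := gridKernel_nonneg m G d
          gcongr
      _ ≤ 256 * (G : ℝ) ^ 4 := gridKernel_mul_pow_le hG (by omega)
  rw [gridMass, gridMass, ← Finset.sum_sdiff hsub, add_comm]
  gcongr
  refine (Finset.sum_le_card_nsmul _ _ _ kernel_small).trans_eq ?_
  rw [Finset.card_sdiff_of_subset hsub, card_window, card_window,
    (by omega : 2 * (3 * G) + 1 - (2 * G + 1) = 4 * G), nsmul_eq_mul]
  push_cast
  ring

theorem sum_gridKernel_mul_abs_le (hG : 2 * m + 1 ≤ G) :
    ∑ d ∈ window (3 * G), gridKernel m G d * (|(d : ℝ)| / (4 * G)) ≤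
      gridMass m G (3 * G) / (2 * m + 1) + 16 * G * (2 * m + 1) ^ 2 := by
  set K := 4 * G / (2 * m + 1)
  have hG₀ : 0 < G := by omega
  have hG' : (2 * m + 1 : ℝ) ≤ G := by exact_mod_cast hG
  have hK₀ : 0 < K := Nat.div_pos (by omega) (by omega)
  have hK : (2 * G : ℝ) ≤ K * (2 * m + 1) := by
    have : (4 * G : ℝ) < (2 * m + 1) * (K + 1) := by
      exact_mod_cast Nat.lt_mul_div_succ (4 * G) (by omega : 0 < 2 * m + 1)
    linarith
  have far_iff (d : ℤ) : (K : ℤ) < |d| ↔ 4 * G < (2 * m + 1) * |(d : ℝ)| := by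
    rw [Int.abs_eq_natAbs, Nat.cast_lt, Nat.div_lt_iff_lt_mul (by omega),
      ← Int.cast_abs, Int.abs_eq_natAbs, mul_comm d.natAbs]
    exact_mod_cast Iff.rfl
  have pointwise : ∀ d ∈ window (3 * G), gridKernel m G d * (|(d : ℝ)| / (4 * G)) ≤
      gridKernel m G d / (2 * m + 1) +
        if (K : ℤ) < |d| then 16 * (2 * m + 1) * (G : ℝ) ^ 2 * ((d : ℝ) ^ 2)⁻¹ else 0 := by
    intro d hd
    have := div_nonneg (gridKernel_nonneg m G d) (by positivity : (0 : ℝ) ≤ 2 * m + 1)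
    rw [mem_window] at hd
    push_cast at hd
    split_ifs with h <;> rw [far_iff] at h
    · linarith [gridKernel_mul_abs_le_of_far hG₀ (by omega) h]
    · linarith [gridKernel_mul_abs_le_of_near (not_lt.mp h)]
  refine (Finset.sum_le_sum pointwise).trans ?_
  rw [Finset.sum_add_distrib, ← Finset.sum_div, ← Finset.sum_filter, ← Finset.mul_sum]
  refine add_le_add_right ?_ _
  calc 16 * (2 * m + 1) * (G : ℝ) ^ 2 * ∑ d ∈ window (3 * G) with (K : ℤ) < |d|, ((d : ℝ) ^ 2)⁻¹
      ≤ 16 * (2 * m + 1) * (G : ℝ) ^ 2 * (2 / K) := by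
        gcongr
        exact sum_window_inv_sq_le hK₀ _
    _ = 16 * (2 * m + 1) * (G : ℝ) * (2 * G) / K := by ring
    _ ≤ 16 * (2 * m + 1) * (G : ℝ) * (K * (2 * m + 1)) / K := by gcongr
    _ = 16 * (G : ℝ) * (2 * m + 1) ^ 2 := by field_simp

end

/-! ### Coefficient norms -/

/-- The sum of the norms of the coefficients, as a seminorm on the additive group of polynomials. -/
def coeffSeminorm (R : Type*) [SeminormedRing R] : AddGroupSeminorm R[X] where
  toFun p := p.sum fun _ a => ‖a‖
  map_zero' := sum_zero_index _
  add_le' p q := by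
    rw [sum_eq_of_subset _ (fun _ => norm_zero) support_add,
      sum_eq_of_subset _ (fun _ => norm_zero) (Finset.subset_union_left (s₂ := q.support)),
      sum_eq_of_subset (p := q) _ (fun _ => norm_zero) Finset.subset_union_right,
      ← Finset.sum_add_distrib]
    exact Finset.sum_le_sum fun i _ => by rw [coeff_add]; exact norm_add_le _ _
  neg' p := by simp only [sum_def, support_neg, coeff_neg, norm_neg]

theorem coeffSeminorm_eq_sum {R : Type*} [SeminormedRing R] {p : R[X]} {s : Finset ℕ}
    (h : p.support ⊆ s) : coeffSeminorm R p = ∑ i ∈ s, ‖p.coeff i‖ :=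
  sum_eq_of_subset _ (fun _ => norm_zero) h

theorem coeffSeminorm_monomial {R : Type*} [SeminormedRing R] (i : ℕ) (a : R) :
    coeffSeminorm R (monomial i a) = ‖a‖ :=
  sum_monomial_index a _ norm_zero

theorem coeffSeminorm_mul_le {R : Type*} [SeminormedRing R] (p q : R[X]) :
    coeffSeminorm R (p * q) ≤ coeffSeminorm R p * coeffSeminorm R q := by
  have subadditive (s : Finset ℕ) (f : ℕ → R[X]) :
      coeffSeminorm R (∑ i ∈ s, f i) ≤ ∑ i ∈ s, coeffSeminorm R (f i) :=
    Finset.le_sum_of_subadditive _ (map_zero _).le (map_add_le_add _) s f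
  rw [mul_eq_sum_sum, coeffSeminorm_eq_sum (Finset.Subset.refl p.support),
    coeffSeminorm_eq_sum (Finset.Subset.refl q.support), Finset.sum_mul_sum]
  refine (subadditive _ _).trans (Finset.sum_le_sum fun i _ => ?_)
  refine (subadditive _ _).trans (Finset.sum_le_sum fun j _ => ?_)
  rw [coeffSeminorm_monomial]
  exact norm_mul_le _ _

/-- The sum of the norms of the coefficients, as a seminorm on the ring of polynomials. -/
def coeffNorm (R : Type*) [SeminormedRing R] : RingSeminorm R[X] where
  toAddGroupSeminorm := coeffSeminorm R
  mul_le' := coeffSeminorm_mul_le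

theorem coeffNorm_eq_sum {R : Type*} [SeminormedRing R] {p : R[X]} {s : Finset ℕ}
    (h : p.support ⊆ s) : coeffNorm R p = ∑ i ∈ s, ‖p.coeff i‖ :=
  coeffSeminorm_eq_sum h

theorem coeffNorm_monomial {R : Type*} [SeminormedRing R] (i : ℕ) (a : R) :
    coeffNorm R (monomial i a) = ‖a‖ :=
  coeffSeminorm_monomial i a

theorem coeffNorm_C {R : Type*} [SeminormedRing R] (a : R) : coeffNorm R (C a) = ‖a‖ :=
  coeffNorm_monomial 0 a

theorem coeffNorm_X {R : Type*} [SeminormedRing R] : coeffNorm R X = ‖(1 : R)‖ :=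
  coeffNorm_monomial 1 1

theorem abs_aeval_sub_aeval_le (p : ℤ[X]) {L : ℕ} (hp : p.natDegree ≤ L) {x y : ℝ} (hx : |x| ≤ 1)
    (hy : |y| ≤ 1) : |aeval x p - aeval y p| ≤ L * coeffNorm ℤ p * |x - y| := by
  rw [aeval_eq_sum_range, aeval_eq_sum_range, ← Finset.sum_sub_distrib,
    coeffNorm_eq_sum supp_subset_range_natDegree_succ, Finset.mul_sum, Finset.sum_mul]
  refine (Finset.abs_sum_le_sum_abs _ _).trans (Finset.sum_le_sum fun i hi => ?_)
  have hi : (i : ℝ) ≤ L := Nat.cast_le.mpr (by grind)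
  have power : |x ^ i - y ^ i| ≤ L * |x - y| :=
    calc |x ^ i - y ^ i| ≤ |x - y| * i * max |x| |y| ^ (i - 1) := abs_pow_sub_pow_le ..
      _ ≤ |x - y| * L * 1 := by
        gcongr
        exact pow_le_one₀ (le_max_of_le_left (abs_nonneg x)) (max_le hx hy)
      _ = L * |x - y| := by ring
  calc |p.coeff i • x ^ i - p.coeff i • y ^ i| = ‖p.coeff i‖ * |x ^ i - y ^ i| := by
        rw [← smul_sub, zsmul_eq_mul, abs_mul, ← Int.norm_cast_real, Real.norm_eq_abs]
    _ ≤ ‖p.coeff i‖ * (L * |x - y|) := by gcongr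
    _ = L * ‖p.coeff i‖ * |x - y| := by ring

/-! ### The weight polynomials -/

theorem dirichletSeq_le_pow {R : Type*} [CommRing R] (N : RingSeminorm R) (hone : N 1 ≤ 1)
    {V E : R} {r : ℝ} (hr : N V + N E ≤ r) (j : ℕ) : N (dirichletSeq V E j) ≤ r ^ j := by
  have hV := apply_nonneg N V
  have hE := apply_nonneg N E
  induction j using Nat.twoStepInduction with
  | zero => simpa [dirichletSeq] using hone
  | one => simpa [dirichletSeq] using (map_add_le_add N V E).trans hr
  | more j ih₁ ih₂ =>
    have hr₀ : 0 ≤ r := (add_nonneg hV hE).trans hr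
    calc N (V * dirichletSeq V E (j + 1) - E ^ 2 * dirichletSeq V E j)
        ≤ N (V * dirichletSeq V E (j + 1)) + N (E ^ 2 * dirichletSeq V E j) := map_sub_le_add N _ _
      _ ≤ N V * N (dirichletSeq V E (j + 1)) + N E * N E * N (dirichletSeq V E j) := by
        rw [sq]
        exact add_le_add (map_mul_le_mul N _ _) ((map_mul_le_mul N _ _).trans
          (mul_le_mul_of_nonneg_right (map_mul_le_mul N _ _) (apply_nonneg N _)))
      _ ≤ N V * r ^ (j + 1) + N E * r * r ^ j := by
        gcongr
        linarith
      _ = (N V + N E) * r ^ (j + 1) := by ring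
      _ ≤ r * r ^ (j + 1) := by gcongr
      _ = r ^ (j + 2) := by ring

theorem natDegree_dirichletSeq_le {R : Type*} [CommRing R] {V E : R[X]} (hV : V.natDegree ≤ 2)
    (hE : E.natDegree = 0) (j : ℕ) : (dirichletSeq V E j).natDegree ≤ 2 * j := by
  induction j using Nat.twoStepInduction with
  | zero => simp [dirichletSeq]
  | one =>
    rw [dirichletSeq]
    exact (natDegree_add_le _ _).trans (by simp [hE, hV])
  | more j ih₁ ih₂ =>
    have hE₂ : (E ^ 2).natDegree ≤ 0 := natDegree_pow_le.trans (by rw [hE])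
    rw [dirichletSeq]
    refine (natDegree_sub_le _ _).trans (max_le ?_ ?_)
    · exact natDegree_mul_le.trans (by omega)
    · exact natDegree_mul_le.trans (by omega)

/-- The fourth power of the Dirichlet kernel of degree `2 * m` at `u = (G * x - y) / (4 * G)`,
cleared of denominators. -/
def scaledKernel {R : Type*} [CommRing R] (m : ℕ) (G y x : R) : R :=
  dirichletSeq (2 * (4 * G ^ 2) - (G * x - y) ^ 2) (4 * G ^ 2) m ^ 4

theorem map_scaledKernel {R S : Type*} [CommRing R] [CommRing S] (f : R →+* S) (m : ℕ) (G y x : R) :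
    f (scaledKernel m G y x) = scaledKernel m (f G) (f y) (f x) := by
  simp [scaledKernel, map_dirichletSeq, map_ofNat]

theorem scaledKernel_eq (m : ℕ) {G : ℝ} (hG : G ≠ 0) (y x : ℝ) :
    scaledKernel m G y x =
      (4 * G ^ 2) ^ (4 * m) * dirichletKernel m ((G * x - y) / (4 * G)) ^ 4 := by
  have hV : 2 * (4 * G ^ 2) - (G * x - y) ^ 2 =
      4 * G ^ 2 * (2 - 4 * ((G * x - y) / (4 * G)) ^ 2) := by field_simp
  rw [scaledKernel, hV, dirichletSeq_mul_left, mul_pow, ← pow_mul, mul_comm m, dirichletKernel]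

/-- The integer polynomial whose coefficients turn return counts into the weight of the atom
`y / G`. -/
def weightPoly (m : ℕ) (G y : ℤ) : ℤ[X] := scaledKernel m (C G) (C y) X

theorem eval_weightPoly (m : ℕ) (G y B : ℤ) :
    (weightPoly m G y).eval B = scaledKernel m G y B := by
  simpa [weightPoly] using map_scaledKernel (evalRingHom B) m (C G) (C y) X

theorem aeval_weightPoly (m : ℕ) (G y : ℤ) (x : ℝ) :
    aeval x (weightPoly m G y) = scaledKernel m (G : ℝ) y x := by
  simpa [weightPoly] using map_scaledKernel (aeval (R := ℤ) x).toRingHom m (C G) (C y) X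

theorem natDegree_weightPoly_le (m : ℕ) (G y : ℤ) : (weightPoly m G y).natDegree ≤ 8 * m := by
  have hV : (2 * (4 * C G ^ 2) - (C G * X - C y) ^ 2).natDegree ≤ 2 := by compute_degree
  have hE : (4 * C G ^ 2).natDegree = 0 := by rw [← natDegree_C (4 * G ^ 2)]; congr; simp
  have := natDegree_dirichletSeq_le hV hE m
  exact natDegree_pow_le.trans (by omega)

theorem coeffNorm_weightPoly_le (m : ℕ) {G y : ℤ} (hy : |y| ≤ 2 * |G|) :
    coeffNorm ℤ (weightPoly m G y) ≤ (21 * (G : ℝ) ^ 2) ^ (4 * m) := by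
  have normC (a : ℤ) : coeffNorm ℤ (C a) = |(a : ℝ)| := by rw [coeffNorm_C, Int.norm_eq_abs]
  have hscale : coeffNorm ℤ (4 * C G ^ 2) = 4 * (G : ℝ) ^ 2 := by
    rw [show 4 * C G ^ 2 = C (4 * G ^ 2) by simp, normC, abs_of_nonneg (by positivity)]
    push_cast; ring
  have hoffset : coeffNorm ℤ (C G * X - C y) ≤ 3 * |(G : ℝ)| := by
    have hy : |(y : ℝ)| ≤ 2 * |(G : ℝ)| := by exact_mod_cast hy
    have hX : coeffNorm ℤ (C G * X) ≤ |(G : ℝ)| := by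
      have := map_mul_le_mul (coeffNorm ℤ) (C G) X
      rwa [normC, coeffNorm_X, norm_one, mul_one] at this
    linarith [map_sub_le_add (coeffNorm ℤ) (C G * X) (C y), normC y]
  have hstep : coeffNorm ℤ (2 * (4 * C G ^ 2) - (C G * X - C y) ^ 2) ≤ 17 * (G : ℝ) ^ 2 := by
    have hsq : coeffNorm ℤ ((C G * X - C y) ^ 2) ≤ (3 * |(G : ℝ)|) ^ 2 := by
      rw [sq, sq]
      exact (map_mul_le_mul _ _ _).trans (mul_self_le_mul_self (apply_nonneg _ _) hoffset)
    rw [mul_pow, sq_abs] at hsq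
    rw [two_mul]
    linarith [map_sub_le_add (coeffNorm ℤ) (4 * C G ^ 2 + 4 * C G ^ 2) ((C G * X - C y) ^ 2),
      map_add_le_add (coeffNorm ℤ) (4 * C G ^ 2) (4 * C G ^ 2)]
  have hseq := dirichletSeq_le_pow (coeffNorm ℤ) (by rw [← C_1, normC]; simp)
    ((add_le_add hstep hscale.le).trans_eq (by ring : _ = 21 * (G : ℝ) ^ 2)) m
  have hsq (p : ℤ[X]) : coeffNorm ℤ (p ^ 2) ≤ coeffNorm ℤ p ^ 2 := by
    rw [sq, sq]; exact map_mul_le_mul _ _ _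
  calc coeffNorm ℤ (weightPoly m G y)
      ≤ (coeffNorm ℤ (dirichletSeq (2 * (4 * C G ^ 2) - (C G * X - C y) ^ 2) (4 * C G ^ 2) m) ^ 2)
        ^ 2 := by
        rw [weightPoly, scaledKernel, show 4 = 2 * 2 from rfl, pow_mul]
        exact (hsq _).trans (pow_le_pow_left₀ (apply_nonneg _ _) (hsq _) 2)
    _ ≤ (((21 * (G : ℝ) ^ 2) ^ m) ^ 2) ^ 2 := by gcongr
    _ = (21 * (G : ℝ) ^ 2) ^ (4 * m) := by ring

/-! ### Reading off a coefficient from a value -/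

theorem abs_sum_mul_pow_lt {c : ℕ → ℤ} {B : ℤ} (hB : 0 < B) (hc : ∀ i, |c i| ≤ B - 1) (L : ℕ) :
    |∑ i ∈ Finset.range L, c i * B ^ i| < B ^ L := by
  induction L with
  | zero => simp
  | succ L ih =>
    calc |∑ i ∈ Finset.range (L + 1), c i * B ^ i|
        ≤ |∑ i ∈ Finset.range L, c i * B ^ i| + |c L| * B ^ L := by
          rw [Finset.sum_range_succ]
          refine (abs_add_le _ _).trans_eq ?_
          rw [abs_mul, abs_of_pos (pow_pos hB L)]
      _ < B ^ L + (B - 1) * B ^ L := add_lt_add_of_lt_of_le ih (by gcongr; exact hc L)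
      _ = B ^ (L + 1) := by ring

theorem exists_eval_eq (p : ℤ[X]) {B : ℤ} (hB : 0 < B) (hc : ∀ i, |p.coeff i| ≤ B - 1) (L : ℕ) :
    ∃ lo hi : ℤ, |lo| < B ^ L ∧ p.eval B = lo + B ^ L * (p.coeff L + B * hi) := by
  refine ⟨∑ i ∈ Finset.range L, p.coeff i * B ^ i,
    ∑ i ∈ Finset.range p.natDegree, p.coeff (L + 1 + i) * B ^ i, abs_sum_mul_pow_lt hB hc L, ?_⟩
  rw [eval_eq_sum_range' (n := L + 1 + p.natDegree) (by omega), Finset.sum_range_add,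
    Finset.sum_range_succ, mul_add, Finset.mul_sum, Finset.mul_sum, mul_comm (B ^ L), add_assoc]
  congr 2
  exact Finset.sum_congr rfl fun i _ => by ring

theorem neg_one_le_ediv_of_abs_lt {a b : ℤ} (h : |a| < b) : -1 ≤ a / b ∧ a / b ≤ 0 := by
  have hb : 0 < b := (abs_nonneg a).trans_lt h
  rw [abs_lt] at h
  refine ⟨(Int.le_ediv_iff_mul_le hb).mpr (by linarith), ?_⟩
  exact Int.lt_add_one_iff.mp ((Int.ediv_lt_iff_lt_mul hb).mpr (by linarith))

/-- The rounding error is the carry out of the lower digits, whose sum may be negative. -/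
theorem exists_ediv_add_emod_eq (p : ℤ[X]) {B σ : ℤ} (L : ℕ) (hB : 0 < B)
    (hc : ∀ i, |p.coeff i| ≤ B - 1) (h₀ : 1 ≤ p.coeff L + σ) (h₁ : p.coeff L + σ < B) :
    ∃ e : ℤ, 0 ≤ e ∧ e ≤ 1 ∧ (p.eval B / B ^ L + σ) % B = p.coeff L + σ - e := by
  obtain ⟨lo, hi, hlo, heval⟩ := exists_eval_eq p hB hc L
  obtain ⟨hcarry₀, hcarry₁⟩ := neg_one_le_ediv_of_abs_lt hlo
  refine ⟨-(lo / B ^ L), by linarith, by linarith, ?_⟩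
  have hquot : p.eval B / B ^ L + σ = (p.coeff L + σ + lo / B ^ L) + B * hi := by
    rw [heval, Int.add_mul_ediv_left _ _ (pow_pos hB L).ne']; ring
  rw [hquot, Int.add_mul_emod_self_left, Int.emod_eq_of_lt (by linarith) (by linarith)]
  ring

/-- The generating polynomial of the counts `M 0, …, M L`. -/
def countPoly (L : ℕ) (M : ℕ → ℕ) : ℤ[X] := ∑ j ∈ Finset.range (L + 1), monomial j (M j : ℤ)

theorem coeff_countPoly (L : ℕ) (M : ℕ → ℕ) (i : ℕ) :
    (countPoly L M).coeff i = if i ≤ L then (M i : ℤ) else 0 := by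
  simp [countPoly, finsetSum_coeff, coeff_monomial]

theorem coeff_mul_countPoly (p : ℤ[X]) (L : ℕ) (M : ℕ → ℕ) :
    (p * countPoly L M).coeff L = ∑ j ∈ Finset.range (L + 1), p.coeff j * M (L - j) := by
  rw [coeff_mul, Finset.Nat.sum_antidiagonal_eq_sum_range_succ
    fun i j => p.coeff i * (countPoly L M).coeff j]
  exact Finset.sum_congr rfl fun j _ => by rw [coeff_countPoly, if_pos (Nat.sub_le L j)]

theorem abs_coeff_mul_countPoly_le (p : ℤ[X]) (L : ℕ) {M : ℕ → ℕ} {c : ℕ}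
    (hM : ∀ j ≤ L, M j ≤ c) (i : ℕ) : |((p * countPoly L M).coeff i : ℝ)| ≤ coeffNorm ℤ p * c := by
  have hcoeff (j : ℕ) : ‖(countPoly L M).coeff j‖ ≤ c := by
    rw [coeff_countPoly]
    split_ifs with h
    · rw [Int.norm_eq_abs]; exact_mod_cast hM j h
    · simp
  rw [coeff_mul, Finset.Nat.sum_antidiagonal_eq_sum_range_succ
    fun i j => p.coeff i * (countPoly L M).coeff j, ← Int.norm_eq_abs,
    coeffNorm_eq_sum (s := p.support ∪ Finset.range i.succ) Finset.subset_union_left,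
    Finset.sum_mul]
  refine (norm_sum_le _ _).trans <| (Finset.sum_le_sum fun j _ => ?_).trans <|
    Finset.sum_le_sum_of_subset_of_nonneg Finset.subset_union_right fun j _ _ => by positivity
  exact (norm_mul_le _ _).trans (by gcongr; exact hcoeff _)

/-! ### Transport from an approximate coupling -/

theorem W1_le_of_coupling {ι : Type*} {n : ℕ} (s : Finset ι) (y q : ι → ℝ) (x : Fin n → ℝ)
    (π : ι → Fin n → ℝ) (hπ : ∀ i ∈ s, ∀ l, 0 ≤ π i l)
    (hq : ∀ i ∈ s, ∑ l, π i l = q i) (hn : ∀ l, ∑ i ∈ s, π i l = 1 / n) :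
    W1 (∑ i ∈ s, ENNReal.ofReal (q i) • Measure.dirac (y i)) (spectralDistribution x) ≤
      ENNReal.ofReal (∑ i ∈ s, ∑ l, π i l * |y i - x l|) := by
  set P : Measure (ℝ × ℝ) :=
    ∑ i ∈ s, ∑ l, ENNReal.ofReal (π i l) • Measure.dirac (y i, x l) with hP
  have map_P : ∀ f : ℝ × ℝ → ℝ, Measurable f →
      P.map f = ∑ i ∈ s, ∑ l, ENNReal.ofReal (π i l) • Measure.dirac (f (y i, x l)) := by
    intro f hf
    simp only [hP, Measure.map_finset_sum hf.aemeasurable, Measure.map_smul,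
      Measure.map_dirac' hf]
  have map_fst : P.map Prod.fst = ∑ i ∈ s, ENNReal.ofReal (q i) • Measure.dirac (y i) := by
    rw [map_P _ measurable_fst]
    refine Finset.sum_congr rfl fun i hi => ?_
    simp only [← Finset.sum_smul]
    rw [← ENNReal.ofReal_sum_of_nonneg fun l _ => hπ i hi l, hq i hi]
  have map_snd : P.map Prod.snd = spectralDistribution x := by
    rw [map_P _ measurable_snd, spectralDistribution, Finset.sum_comm]
    refine Finset.sum_congr rfl fun l _ => ?_
    simp only [← Finset.sum_smul]
    rw [← ENNReal.ofReal_sum_of_nonneg fun i hi => hπ i hi l, hn l, one_div,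
      ENNReal.ofReal_inv_of_pos (by exact_mod_cast Fin.pos l), ENNReal.ofReal_natCast]
  refine (iInf₂_le P ⟨map_fst, map_snd⟩).trans_eq ?_
  rw [hP, lintegral_finsetSum_measure, ENNReal.ofReal_sum_of_nonneg fun i hi =>
    Finset.sum_nonneg fun l _ => mul_nonneg (hπ i hi l) (abs_nonneg _)]
  refine Finset.sum_congr rfl fun i hi => ?_
  rw [lintegral_finsetSum_measure,
    ENNReal.ofReal_sum_of_nonneg fun l _ => mul_nonneg (hπ i hi l) (abs_nonneg _)]
  refine Finset.sum_congr rfl fun l _ => ?_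
  rw [lintegral_smul_measure, lintegral_dirac, ENNReal.ofReal_mul (hπ i hi l), edist_dist,
    Real.dist_eq, smul_eq_mul]

/- The product of the marginal deficits, divided by the missing mass, completes `π` to a
coupling. -/
theorem W1_le_of_partial_coupling {ι : Type*} {n : ℕ} [NeZero n] (s : Finset ι) (y q : ι → ℝ)
    (x : Fin n → ℝ) (π : ι → Fin n → ℝ) {Δ : ℝ} (hπ : ∀ i ∈ s, ∀ l, 0 ≤ π i l)
    (hq : ∀ i ∈ s, ∑ l, π i l ≤ q i) (hn : ∀ l, ∑ i ∈ s, π i l ≤ 1 / n)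
    (hsum : ∑ i ∈ s, q i = 1) (hΔ : ∀ i ∈ s, ∀ l, |y i - x l| ≤ Δ) :
    W1 (∑ i ∈ s, ENNReal.ofReal (q i) • Measure.dirac (y i)) (spectralDistribution x) ≤
      ENNReal.ofReal (∑ i ∈ s, ∑ l, π i l * |y i - x l| +
        Δ * (1 - ∑ i ∈ s, ∑ l, π i l)) := by
  set δ := 1 - ∑ i ∈ s, ∑ l, π i l with hδ
  set β : ι → ℝ := fun i => q i - ∑ l, π i l with hβ
  set α : Fin n → ℝ := fun l => 1 / n - ∑ i ∈ s, π i l with hα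
  have β_nonneg : ∀ i ∈ s, 0 ≤ β i := fun i hi => sub_nonneg.2 (hq i hi)
  have α_nonneg : ∀ l, 0 ≤ α l := fun l => sub_nonneg.2 (hn l)
  have sum_β : ∑ i ∈ s, β i = δ := by rw [hβ, Finset.sum_sub_distrib, hsum]
  have sum_α : ∑ l, α l = δ := by
    rw [hα, Finset.sum_sub_distrib, Finset.sum_comm]
    simp [hδ, NeZero.ne n]
  have β_cancel : ∀ i ∈ s, β i * δ / δ = β i := fun i hi => mul_div_cancel_of_imp fun h =>
    (Finset.sum_eq_zero_iff_of_nonneg β_nonneg).1 (sum_β.trans h) i hi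
  have α_cancel : ∀ l, δ * α l / δ = α l := fun l => by
    rw [mul_comm]
    exact mul_div_cancel_of_imp fun h =>
      (Finset.sum_eq_zero_iff_of_nonneg fun l _ => α_nonneg l).1 (sum_α.trans h) l
        (Finset.mem_univ l)
  have residual_nonneg : ∀ i ∈ s, ∀ l, 0 ≤ β i * α l / δ := fun i hi l =>
    div_nonneg (mul_nonneg (β_nonneg i hi) (α_nonneg l)) (sum_β ▸ Finset.sum_nonneg β_nonneg)
  have residual_row : ∀ i ∈ s, ∑ l, β i * α l / δ = β i := fun i hi => by
    rw [← Finset.sum_div, ← Finset.mul_sum, sum_α, β_cancel i hi]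
  have residual_column : ∀ l, ∑ i ∈ s, β i * α l / δ = α l := fun l => by
    rw [← Finset.sum_div, ← Finset.sum_mul, sum_β, α_cancel l]
  refine (W1_le_of_coupling s y q x (fun i l => π i l + β i * α l / δ)
    (fun i hi l => add_nonneg (hπ i hi l) (residual_nonneg i hi l)) (fun i hi => ?_)
    (fun l => ?_)).trans (ENNReal.ofReal_le_ofReal ?_)
  · rw [Finset.sum_add_distrib, residual_row i hi, hβ, add_sub_cancel]
  · rw [Finset.sum_add_distrib, residual_column l, hα, add_sub_cancel]
  · simp only [add_mul, Finset.sum_add_distrib]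
    gcongr
    calc ∑ i ∈ s, ∑ l, β i * α l / δ * |y i - x l| ≤ ∑ i ∈ s, ∑ l, β i * α l / δ * Δ := by
          gcongr with i hi l
          · exact residual_nonneg i hi l
          · exact hΔ i hi l
      _ = Δ * δ := by
          simp only [← Finset.sum_mul]
          rw [Finset.sum_congr rfl residual_row, sum_β, mul_comm]

theorem sum_div_le_of_forall_le {n : ℕ} [NeZero n] {f : Fin n → ℝ} {c : ℝ} (hf : ∀ l, f l ≤ c) :
    (∑ l, f l) / n ≤ c := by
  rw [div_le_iff₀' (by exact_mod_cast Nat.pos_of_ne_zero (NeZero.ne n))]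
  simpa using Finset.sum_le_card_nsmul Finset.univ f c fun l _ => hf l

theorem le_sum_div_of_forall_le {n : ℕ} [NeZero n] {f : Fin n → ℝ} {c : ℝ} (hf : ∀ l, c ≤ f l) :
    c ≤ (∑ l, f l) / n := by
  rw [le_div_iff₀' (by exact_mod_cast Nat.pos_of_ne_zero (NeZero.ne n))]
  simpa using Finset.card_nsmul_le_sum Finset.univ f c fun l _ => hf l

theorem sum_sum_average_mul_le {ι : Type*} {n : ℕ} [NeZero n] {s : Finset ι}
    {a d : Fin n → ι → ℝ} {Y c : ℝ} (hc : 0 ≤ c) (hY : ∀ l, ∑ i ∈ s, a l i * d l i ≤ Y) :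
    ∑ i ∈ s, ∑ l, a l i / n / c * d l i ≤ Y / c :=
  calc ∑ i ∈ s, ∑ l, a l i / n / c * d l i
      = (∑ l, ∑ i ∈ s, a l i * d l i) / n / c := by
        rw [Finset.sum_comm]
        simp only [Finset.sum_div]
        exact Finset.sum_congr rfl fun l _ => Finset.sum_congr rfl fun i _ => by ring
    _ ≤ Y / c := by
        gcongr
        exact sum_div_le_of_forall_le hY

/- Divided by the largest possible total mass, the average of the kernels `a l` is a partial
coupling. -/
theorem W1_le_of_kernel {ι : Type*} {n : ℕ} [NeZero n] (s : Finset ι) (y w : ι → ℝ)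
    (x : Fin n → ℝ) (a : Fin n → ι → ℝ) {lo hi η Y Δ : ℝ}
    (ha : ∀ l, ∀ i ∈ s, 0 ≤ a l i) (hw : ∀ i ∈ s, (∑ l, a l i) / n ≤ w i)
    (hη : ∑ i ∈ s, (w i - (∑ l, a l i) / n) ≤ η)
    (hlo : 0 < lo) (hrow : ∀ l, lo ≤ ∑ i ∈ s, a l i ∧ ∑ i ∈ s, a l i ≤ hi)
    (hY : ∀ l, ∑ i ∈ s, a l i * |y i - x l| ≤ Y) (hΔ₀ : 0 ≤ Δ)
    (hΔ : ∀ i ∈ s, ∀ l, |y i - x l| ≤ Δ) :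
    W1 (∑ i ∈ s, ENNReal.ofReal (w i / ∑ j ∈ s, w j) • Measure.dirac (y i))
      (spectralDistribution x) ≤
        ENNReal.ofReal ((Y + Δ * (hi + η - lo)) / (hi + η)) := by
  have n_pos : (0 : ℝ) < n := by exact_mod_cast Nat.pos_of_ne_zero (NeZero.ne n)
  set mean := ∑ i ∈ s, (∑ l, a l i) / n with hmean
  have mean_eq : mean = (∑ l, ∑ i ∈ s, a l i) / n := by
    rw [hmean, Finset.sum_comm, Finset.sum_div]
  have mean_le : mean ≤ hi := mean_eq ▸ sum_div_le_of_forall_le fun l => (hrow l).2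
  have le_mean : lo ≤ mean := mean_eq ▸ le_sum_div_of_forall_le fun l => (hrow l).1
  set τ := ∑ j ∈ s, w j
  have mean_le_τ : mean ≤ τ := Finset.sum_le_sum hw
  have η_nonneg : 0 ≤ η := (Finset.sum_nonneg fun i hi => sub_nonneg.2 (hw i hi)).trans hη
  have τ_le : τ ≤ hi + η := by
    rw [Finset.sum_sub_distrib] at hη
    linarith
  have τ_pos : 0 < τ := by linarith
  have mass_pos : 0 < hi + η := by linarith
  have mass : ∑ i ∈ s, ∑ l, a l i / n / (hi + η) = mean / (hi + η) := by
    simp only [hmean, Finset.sum_div]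
  refine (W1_le_of_partial_coupling s y (fun i => w i / τ) x (fun i l => a l i / n / (hi + η))
    (fun i hi l => div_nonneg (div_nonneg (ha l i hi) n_pos.le) mass_pos.le) (fun i hi' => ?_)
    (fun l => ?_) (by rw [← Finset.sum_div, div_self τ_pos.ne']) hΔ).trans
    (ENNReal.ofReal_le_ofReal ?_)
  · have average_nonneg : 0 ≤ (∑ l, a l i) / n :=
      div_nonneg (Finset.sum_nonneg fun l _ => ha l i hi') n_pos.le
    rw [← Finset.sum_div, ← Finset.sum_div]
    exact div_le_div₀ (average_nonneg.trans (hw i hi')) (hw i hi') τ_pos τ_le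
  · simp only [← Finset.sum_div, div_right_comm _ (n : ℝ)]
    gcongr
    rw [div_le_one mass_pos]
    linarith [(hrow l).2]
  · calc _ ≤ Y / (hi + η) + Δ * (1 - lo / (hi + η)) := by
          rw [mass]
          gcongr
          exact sum_sum_average_mul_le mass_pos.le hY
      _ = (Y + Δ * (hi + η - lo)) / (hi + η) := by field_simp

/-! ### From moments to the spectral distribution -/

theorem exists_grid_point {G : ℕ} (hG : 0 < G) {t : ℝ} (ht : |t| ≤ 1) :
    ∃ x : ℤ, |x| ≤ G ∧ |t - x / G| ≤ 1 / G := by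
  have hG' : (0 : ℝ) < G := by exact_mod_cast hG
  obtain ⟨ht₀, ht₁⟩ := abs_le.mp ht
  refine ⟨⌊(G : ℝ) * t⌋, abs_le.mpr ⟨?_, ?_⟩, ?_⟩
  · rw [Int.le_floor]; push_cast; nlinarith
  · have : (⌊(G : ℝ) * t⌋ : ℝ) ≤ G := (Int.floor_le _).trans (by nlinarith)
    exact_mod_cast this
  · have fract : t - ⌊(G : ℝ) * t⌋ / G = Int.fract (G * t) / G := by rw [Int.fract]; field_simp
    rw [fract, abs_div, abs_of_pos hG', abs_of_nonneg (Int.fract_nonneg _)]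
    gcongr
    exact (Int.fract_lt_one _).le

theorem sum_coeff_mul_average_pow {n : ℕ} {p : ℤ[X]} {L : ℕ} (hp : p.natDegree ≤ L)
    (t : Fin n → ℝ) :
    ∑ j ∈ Finset.range (L + 1), (p.coeff j : ℝ) * ((∑ l, t l ^ j) / n) =
      (∑ l, aeval (t l) p) / n := by
  simp_rw [aeval_eq_sum_range' (Nat.lt_succ_of_le hp), zsmul_eq_mul]
  rw [Finset.sum_comm, Finset.sum_div]
  exact Finset.sum_congr rfl fun j _ => by rw [← Finset.mul_sum, mul_div_assoc]

theorem abs_sum_coeff_mul_sub_le {n : ℕ} [NeZero n] {p : ℤ[X]} {L : ℕ} (hp : p.natDegree ≤ L)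
    {t x : Fin n → ℝ} (ht : ∀ l, |t l| ≤ 1) (hx : ∀ l, |x l| ≤ 1) {ρ : ℝ}
    (hρ : ∀ l, |t l - x l| ≤ ρ) {N : ℕ → ℝ} {c δ : ℝ} (hc : 0 ≤ c)
    (hN : ∀ j ≤ L, |N j - c * ((∑ l, t l ^ j) / n)| ≤ δ) :
    |∑ j ∈ Finset.range (L + 1), p.coeff j * N j - c * ((∑ l, aeval (x l) p) / n)| ≤
      coeffNorm ℤ p * (δ + c * (L * ρ)) := by
  have moments : |∑ j ∈ Finset.range (L + 1), (p.coeff j : ℝ) *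
      (N j - c * ((∑ l, t l ^ j) / n))| ≤ coeffNorm ℤ p * δ := by
    rw [coeffNorm_eq_sum (supp_subset_range (Nat.lt_succ_of_le hp)), Finset.sum_mul]
    refine (Finset.abs_sum_le_sum_abs _ _).trans (Finset.sum_le_sum fun j hj => ?_)
    rw [abs_mul, ← Int.norm_eq_abs]
    exact mul_le_mul_of_nonneg_left (hN j (by grind)) (norm_nonneg _)
  have rounding : |(∑ l, aeval (t l) p) / n - (∑ l, aeval (x l) p) / n| ≤
      L * coeffNorm ℤ p * ρ := by
    rw [← sub_div, ← Finset.sum_sub_distrib, abs_div, Nat.abs_cast]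
    refine (div_le_div_of_nonneg_right (Finset.abs_sum_le_sum_abs _ _) n.cast_nonneg).trans
      (sum_div_le_of_forall_le fun l => ?_)
    exact (abs_aeval_sub_aeval_le p hp (ht l) (hx l)).trans
      (mul_le_mul_of_nonneg_left (hρ l) (mul_nonneg L.cast_nonneg (apply_nonneg _ _)))
  have split : ∑ j ∈ Finset.range (L + 1), p.coeff j * N j - c * ((∑ l, aeval (x l) p) / n) =
      ∑ j ∈ Finset.range (L + 1), (p.coeff j : ℝ) * (N j - c * ((∑ l, t l ^ j) / n)) +
        c * ((∑ l, aeval (t l) p) / n - (∑ l, aeval (x l) p) / n) := by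
    rw [← sum_coeff_mul_average_pow hp t]
    simp only [mul_sub, Finset.sum_sub_distrib, Finset.mul_sum, mul_left_comm c]
    abel
  rw [split]
  calc _ ≤ coeffNorm ℤ p * δ + c * (L * coeffNorm ℤ p * ρ) := by
        refine (abs_add_le _ _).trans (add_le_add moments ?_)
        rw [abs_mul, abs_of_nonneg hc]
        exact mul_le_mul_of_nonneg_left rounding hc
    _ = _ := by ring

/-- The number of grid cells per unit length, as a function of the degree parameter `m` of the
kernel. -/
def gridSize (m : ℕ) : ℕ := 65536 ^ m

/-- The scale of the weights. It is also added to all of them, which makes them positive. -/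
def weightOffset (m : ℕ) : ℤ := (gridSize m : ℤ) ^ 3 * (4 * (gridSize m : ℤ) ^ 2) ^ (4 * m)

/-- Integers `N j` that approximate `G³` times the `j`-th moments of a spectral distribution,
where `G = gridSize m`. -/
def ApproxMoments {n : ℕ} (m : ℕ) (t : Fin n → ℝ) (N : ℕ → ℕ) : Prop :=
  ∀ j ≤ 8 * m, |(N j : ℝ) - (gridSize m : ℝ) ^ 3 * ((∑ l, t l ^ j) / n)| ≤ (gridSize m : ℝ) ^ 2

/-- The combination of approximate moments that belongs to the kernel centred at `y`. -/
def momentSum (m : ℕ) (N : ℕ → ℕ) (y : ℤ) : ℤ :=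
  ∑ j ∈ Finset.range (8 * m + 1), (weightPoly m (gridSize m) y).coeff j * N j

theorem gridSize_pos (m : ℕ) : 0 < gridSize m := by
  unfold gridSize; positivity

theorem eight_mul_add_one_le_gridSize (m : ℕ) : 8 * m + 1 ≤ gridSize m :=
  calc 8 * m + 1 ≤ 9 ^ m := by
        have := one_add_mul_le_pow (a := (8 : ℤ)) (by norm_num) m
        norm_num at this
        zify
        linarith
    _ ≤ 65536 ^ m := Nat.pow_le_pow_left (by norm_num) m

theorem cast_weightOffset (m : ℕ) : (weightOffset m : ℝ) =
    (gridSize m : ℝ) ^ 3 * (4 * (gridSize m : ℝ) ^ 2) ^ (4 * m) := by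
  simp [weightOffset]

theorem weightOffset_pos (m : ℕ) : 0 < weightOffset m := by
  have := gridSize_pos m
  unfold weightOffset; positivity

theorem two_mul_coeffNorm_bound_le {m : ℕ} (hm : 1 ≤ m) :
    2 * ((21 * (gridSize m : ℝ) ^ 2) ^ (4 * m) * (1 + 8 * m)) ≤
      gridSize m * (4 * (gridSize m : ℝ) ^ 2) ^ (4 * m) := by
  have bernoulli : (1 + 8 * m : ℝ) ≤ 9 ^ m := by
    have := one_add_mul_le_pow (a := (8 : ℝ)) (by norm_num) m
    norm_num at this
    linarith
  have two_le : (2 : ℝ) ≤ 2 ^ m := le_self_pow₀ (by norm_num) (by omega)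
  rw [mul_pow, mul_pow]
  calc 2 * (21 ^ (4 * m) * ((gridSize m : ℝ) ^ 2) ^ (4 * m) * (1 + 8 * m))
      ≤ 2 ^ m * (21 ^ (4 * m) * ((gridSize m : ℝ) ^ 2) ^ (4 * m) * 9 ^ m) := by gcongr
    _ = (2 * 21 ^ 4 * 9 : ℝ) ^ m * ((gridSize m : ℝ) ^ 2) ^ (4 * m) := by
        rw [mul_pow, mul_pow, ← pow_mul (21 : ℝ)]; ring
    _ ≤ (65536 * 4 ^ 4) ^ m * ((gridSize m : ℝ) ^ 2) ^ (4 * m) := by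
        gcongr ?_ ^ _ * _
        norm_num
    _ = _ := by rw [gridSize, mul_pow, ← pow_mul]; push_cast; ring

theorem abs_momentSum_sub_le {n : ℕ} [NeZero n] {m : ℕ} (hm : 1 ≤ m) {t : Fin n → ℝ}
    (ht : ∀ l, |t l| ≤ 1) {x : Fin n → ℤ} (hx : ∀ l, |x l| ≤ gridSize m)
    (htx : ∀ l, |t l - x l / gridSize m| ≤ 1 / gridSize m) {N : ℕ → ℕ}
    (hN : ApproxMoments m t N) {y : ℤ} (hy : |y| ≤ 2 * gridSize m) :
    |(momentSum m N y : ℝ) -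
        weightOffset m * ((∑ l, gridKernel m (gridSize m) (x l - y)) / n)| ≤
      weightOffset m / 2 := by
  have hbound := two_mul_coeffNorm_bound_le hm
  have hG : (0 : ℝ) < gridSize m := by exact_mod_cast gridSize_pos m
  set G := gridSize m
  have kernel : ∀ l, aeval ((x l : ℝ) / G) (weightPoly m G y) =
      (4 * (G : ℝ) ^ 2) ^ (4 * m) * gridKernel m G (x l - y) := fun l => by
    rw [aeval_weightPoly, Int.cast_natCast, scaledKernel_eq m hG.ne', gridKernel,
      mul_div_cancel₀ _ hG.ne', Int.cast_sub]
  have norm_le : coeffNorm ℤ (weightPoly m G y) ≤ (21 * (G : ℝ) ^ 2) ^ (4 * m) := by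
    simpa using coeffNorm_weightPoly_le m (G := G) (y := y) (by simpa using hy)
  have approx := abs_sum_coeff_mul_sub_le (natDegree_weightPoly_le m G y) ht
    (x := fun l => (x l : ℝ) / G) (fun l => ?_) htx (c := (G : ℝ) ^ 3) (by positivity) hN
  · simp_rw [kernel, ← Finset.mul_sum, mul_div_assoc, ← mul_assoc] at approx
    rw [cast_weightOffset, momentSum]
    push_cast
    refine approx.trans ?_
    calc coeffNorm ℤ (weightPoly m G y) * ((G : ℝ) ^ 2 + G ^ 3 * (8 * m : ℕ) * (1 / G))
        = coeffNorm ℤ (weightPoly m G y) * (1 + 8 * m) * (G : ℝ) ^ 2 := by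
          push_cast; field_simp
      _ ≤ (21 * (G : ℝ) ^ 2) ^ (4 * m) * (1 + 8 * m) * (G : ℝ) ^ 2 := by gcongr
      _ ≤ (G * (4 * (G : ℝ) ^ 2) ^ (4 * m) / 2) * (G : ℝ) ^ 2 := by gcongr; linarith
      _ = _ := by ring
  · rw [abs_div, abs_of_pos hG, div_le_one hG]
    exact_mod_cast hx l

theorem average_gridKernel_nonneg {n : ℕ} (m : ℕ) (x : Fin n → ℤ) (y : ℤ) :
    0 ≤ (∑ l, gridKernel m (gridSize m) (x l - y)) / n :=
  div_nonneg (Finset.sum_nonneg fun _ _ => gridKernel_nonneg _ _ _) n.cast_nonneg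

theorem momentSum_add_weightOffset_pos {n : ℕ} [NeZero n] {m : ℕ} (hm : 1 ≤ m) {t : Fin n → ℝ}
    (ht : ∀ l, |t l| ≤ 1) {N : ℕ → ℕ} (hN : ApproxMoments m t N) {y : ℤ}
    (hy : |y| ≤ 2 * gridSize m) : 0 < momentSum m N y + weightOffset m := by
  choose x hx htx using fun l => exists_grid_point (gridSize_pos m) (ht l)
  have close := (abs_le.mp (abs_momentSum_sub_le hm ht hx htx hN hy)).1
  have offset_pos : (0 : ℝ) < weightOffset m := by exact_mod_cast weightOffset_pos m
  have := mul_nonneg offset_pos.le (average_gridKernel_nonneg m x y)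
  have : (0 : ℝ) < momentSum m N y + weightOffset m := by linarith
  exact_mod_cast this

/-- Integer weights of the grid points in `[-2, 2]`: the combinations of the approximate moments
`N`, rounded down by at most one. -/
def ApproxWeights (m : ℕ) (N : ℕ → ℕ) (W : ℤ → ℤ) : Prop :=
  ∀ y : ℤ, |y| ≤ 2 * gridSize m →
    ∃ e : ℤ, 0 ≤ e ∧ e ≤ 1 ∧ W y = momentSum m N y + weightOffset m - e

theorem ApproxWeights.abs_sub_le {n : ℕ} [NeZero n] {m : ℕ} (hm : 1 ≤ m) {t : Fin n → ℝ}
    (ht : ∀ l, |t l| ≤ 1) {x : Fin n → ℤ} (hx : ∀ l, |x l| ≤ gridSize m)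
    (htx : ∀ l, |t l - x l / gridSize m| ≤ 1 / gridSize m) {N : ℕ → ℕ}
    (hN : ApproxMoments m t N) {W : ℤ → ℤ} (hW : ApproxWeights m N W) {y : ℤ}
    (hy : |y| ≤ 2 * gridSize m) :
    |(W y : ℝ) - weightOffset m * ((∑ l, gridKernel m (gridSize m) (x l - y)) / n) -
      weightOffset m| ≤ weightOffset m := by
  obtain ⟨e, e_nonneg, e_le, W_eq⟩ := hW y hy
  have close := abs_le.mp (abs_momentSum_sub_le hm ht hx htx hN hy)
  have offset : (2 : ℝ) ≤ weightOffset m := by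
    have hG : (3 : ℝ) ≤ gridSize m := by
      exact_mod_cast (by omega : 3 ≤ 8 * m + 1).trans (eight_mul_add_one_le_gridSize m)
    have scale : (1 : ℝ) ≤ (4 * (gridSize m : ℝ) ^ 2) ^ (4 * m) := one_le_pow₀ (by nlinarith)
    have cube : (3 : ℝ) ^ 3 ≤ (gridSize m : ℝ) ^ 3 := by gcongr
    rw [cast_weightOffset]
    nlinarith
  have e_nonneg' : (0 : ℝ) ≤ e := by exact_mod_cast e_nonneg
  have e_le' : (e : ℝ) ≤ 1 := by exact_mod_cast e_le
  rw [W_eq, abs_le]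
  push_cast
  constructor <;> linarith

section

variable {m G : ℕ} {x : ℤ}

theorem gridMass_le_sum_translate (hx : |x| ≤ G) :
    gridMass m G G ≤ ∑ y ∈ window (2 * G), gridKernel m G (x - y) := by
  rw [two_mul]
  exact sum_window_le_translate (gridKernel_nonneg m G) hx

theorem sum_translate_le_gridMass (hx : |x| ≤ G) :
    ∑ y ∈ window (2 * G), gridKernel m G (x - y) ≤ gridMass m G (3 * G) := by
  rw [gridMass, show 3 * G = 2 * G + G by ring]
  exact sum_window_translate_le (gridKernel_nonneg m G) hx

theorem sum_translate_mul_abs_le (hG : 2 * m + 1 ≤ G) (hx : |x| ≤ G) {t : ℝ}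
    (ht : |t - x / G| ≤ 1 / G) :
    ∑ y ∈ window (2 * G), gridKernel m G (x - y) * |(y : ℝ) / G - t| ≤
      4 * (gridMass m G (3 * G) / (2 * m + 1) + 16 * G * (2 * m + 1) ^ 2) +
        gridMass m G (3 * G) * (1 / G) := by
  have hG' : (0 : ℝ) < G := by exact_mod_cast (by omega : 0 < G)
  have distance : ∀ y : ℤ,
      |(y : ℝ) / G - t| ≤ 4 * (|((x - y : ℤ) : ℝ)| / (4 * G)) + 1 / G := fun y => by
    have grid_distance : 4 * (|((x - y : ℤ) : ℝ)| / (4 * G)) = |(y : ℝ) / G - x / G| := by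
      rw [← sub_div, abs_div, abs_of_pos hG', abs_sub_comm]; push_cast; field_simp
    rw [grid_distance]
    exact (abs_sub_le _ _ _).trans (add_le_add_right (by rwa [abs_sub_comm]) _)
  have moment : ∑ y ∈ window (2 * G), gridKernel m G (x - y) * (|((x - y : ℤ) : ℝ)| / (4 * G)) ≤
      gridMass m G (3 * G) / (2 * m + 1) + 16 * G * (2 * m + 1) ^ 2 := by
    refine le_trans ?_ (sum_gridKernel_mul_abs_le hG)
    rw [show 3 * G = 2 * G + G by ring]
    exact sum_window_translate_le
      (f := fun d => gridKernel m G d * (|(d : ℝ)| / (4 * G)))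
      (fun d => mul_nonneg (gridKernel_nonneg m G d) (by positivity)) hx
  calc ∑ y ∈ window (2 * G), gridKernel m G (x - y) * |(y : ℝ) / G - t|
      ≤ ∑ y ∈ window (2 * G), (4 * (gridKernel m G (x - y) * (|((x - y : ℤ) : ℝ)| / (4 * G))) +
          gridKernel m G (x - y) * (1 / G)) := by
        refine Finset.sum_le_sum fun y _ => ?_
        have := mul_le_mul_of_nonneg_left (distance y) (gridKernel_nonneg m G (x - y))
        linarith
    _ = 4 * (∑ y ∈ window (2 * G), gridKernel m G (x - y) * (|((x - y : ℤ) : ℝ)| / (4 * G))) +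
          (∑ y ∈ window (2 * G), gridKernel m G (x - y)) * (1 / G) := by
        rw [Finset.sum_add_distrib, ← Finset.mul_sum, ← Finset.sum_mul]
    _ ≤ _ := by
        gcongr
        exact sum_translate_le_gridMass hx

end

theorem transport_cost_le {m G k : ℕ} (hk : 1 ≤ k) (hm : m = 256 * k) (hG : 2 * m + 1 ≤ G) :
    (4 * (gridMass m G (3 * G) / (2 * m + 1) + 16 * G * (2 * m + 1) ^ 2) +
        gridMass m G (3 * G) * (1 / G) +
        3 * (gridMass m G (3 * G) + 2 * (4 * G + 1) - gridMass m G G)) /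
      (gridMass m G (3 * G) + 2 * (4 * G + 1)) ≤ 1 / k := by
  have low := le_gridMass (m := m) (G := G) (by omega) (by omega)
  have tail := gridMass_three_mul_le (m := m) (G := G) (by omega)
  have mass_le : gridMass m G G ≤ gridMass m G (3 * G) :=
    Finset.sum_le_sum_of_subset_of_nonneg (window_mono (by omega))
      fun d _ _ => gridKernel_nonneg m G d
  have hk' : (1 : ℝ) ≤ k := by exact_mod_cast hk
  have hNG : 2 * (m : ℝ) + 1 ≤ G := by exact_mod_cast hG
  have hkN : 512 * (k : ℝ) ≤ 2 * m + 1 := by rw [hm]; push_cast; linarith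
  set hi := gridMass m G (3 * G)
  set lo := gridMass m G G
  set N : ℝ := 2 * m + 1
  have hN : 0 < N := by linarith
  have hG' : (0 : ℝ) < G := by linarith
  have mass_large : 65 * (G * N ^ 2) ≤ 260 * (hi / N) := by
    rw [← mul_div_assoc, le_div_iff₀ hN]; linarith
  have hi_nonneg : 0 ≤ hi := le_trans (by positivity) (low.trans mass_le)
  have cell : hi * (1 / G) ≤ hi / N := by
    rw [← div_eq_mul_one_div]; gcongr
  have remainder : 3102 * (G : ℝ) ≤ G * N ^ 2 := by
    rw [mul_comm]
    gcongr
    nlinarith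
  have numerator : 4 * (hi / N + 16 * G * N ^ 2) + hi * (1 / G) +
      3 * (hi + 2 * (4 * G + 1) - lo) ≤ 512 * (hi / N) := by
    have : 0 ≤ hi / N := by positivity
    linarith
  have denominator : 512 * (hi / N) ≤ hi / k := by
    rw [← mul_div_assoc, div_le_div_iff₀ hN (by linarith)]
    nlinarith
  rw [div_le_iff₀ (by positivity)]
  calc _ ≤ hi / k := numerator.trans denominator
    _ = 1 / k * hi := by ring
    _ ≤ _ := by gcongr; linarith

theorem ApproxWeights.W1_le {n : ℕ} [NeZero n] {k m : ℕ} (hk : 1 ≤ k) (hm : m = 256 * k)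
    {t : Fin n → ℝ} (ht : ∀ l, |t l| ≤ 1) {N : ℕ → ℕ} (hN : ApproxMoments m t N)
    {W : ℤ → ℤ} (hW : ApproxWeights m N W) :
    W1 (∑ y ∈ window (2 * gridSize m), ENNReal.ofReal ((W y : ℝ) /
        (∑ z ∈ window (2 * gridSize m), W z : ℤ)) • Measure.dirac ((y : ℝ) / gridSize m))
      (spectralDistribution t) ≤ ENNReal.ofReal (1 / k) := by
  have hmG : 2 * m + 1 ≤ gridSize m := by have := eight_mul_add_one_le_gridSize m; omega
  have hoffset : (0 : ℝ) < weightOffset m := by exact_mod_cast weightOffset_pos m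
  have hG : (0 : ℝ) < gridSize m := by exact_mod_cast gridSize_pos m
  choose x hx htx using fun l => exists_grid_point (gridSize_pos m) (ht l)
  have error := fun y (hy : y ∈ window (2 * gridSize m)) => abs_le.mp <|
    hW.abs_sub_le (by omega) ht hx htx hN (y := y) (by exact_mod_cast mem_window.1 hy)
  set G := gridSize m
  set σ := (weightOffset m : ℝ)
  have cost := W1_le_of_kernel (window (2 * G)) (fun y : ℤ => (y : ℝ) / G) (fun y => (W y : ℝ)) t
    (fun l y => σ * gridKernel m G (x l - y)) (lo := σ * gridMass m G G)
    (hi := σ * gridMass m G (3 * G)) (η := σ * (2 * (4 * G + 1)))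
    (Y := σ * (4 * (gridMass m G (3 * G) / (2 * m + 1) + 16 * G * (2 * m + 1) ^ 2) +
        gridMass m G (3 * G) * (1 / G))) (Δ := 3)
    (fun l y _ => mul_nonneg hoffset.le (gridKernel_nonneg _ _ _)) (fun y hy => ?_) ?_ ?_
    (fun l => ?_) (fun l => ?_) zero_le_three (fun y hy l => ?_)
  · rw [← mul_add, ← mul_sub, mul_left_comm, ← mul_add, mul_div_mul_left _ _ hoffset.ne'] at cost
    push_cast
    exact cost.trans (ENNReal.ofReal_le_ofReal (transport_cost_le hk hm hmG))
  · rw [← Finset.mul_sum, mul_div_assoc]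
    linarith [(error y hy).1]
  · calc _ ≤ ∑ y ∈ window (2 * G), 2 * σ := Finset.sum_le_sum fun y hy => by
          rw [← Finset.mul_sum, mul_div_assoc]
          linarith [(error y hy).2]
      _ = _ := by simp [card_window]; ring
  · exact mul_pos hoffset (lt_of_lt_of_le (by positivity)
      (le_gridMass (gridSize_pos m) (by omega)))
  · simp only [← Finset.mul_sum]
    exact ⟨mul_le_mul_of_nonneg_left (gridMass_le_sum_translate (hx l)) hoffset.le,
      mul_le_mul_of_nonneg_left (sum_translate_le_gridMass (hx l)) hoffset.le⟩
  · simp only [mul_assoc σ, ← Finset.mul_sum]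
    exact mul_le_mul_of_nonneg_left (sum_translate_mul_abs_le hmG (hx l) (htx l)) hoffset.le
  · have hy' : |(y : ℝ)| ≤ 2 * G := by exact_mod_cast mem_window.1 hy
    have : |(y : ℝ) / G| ≤ 2 := by rwa [abs_div, abs_of_pos hG, div_le_iff₀ hG]
    linarith [abs_sub ((y : ℝ) / G) (t l), ht l]

theorem ApproxWeights.sum_pos {n : ℕ} [NeZero n] {m : ℕ} (hm : 2 ≤ m) {t : Fin n → ℝ}
    (ht : ∀ l, |t l| ≤ 1) {N : ℕ → ℕ} (hN : ApproxMoments m t N) {W : ℤ → ℤ}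
    (hW : ApproxWeights m N W) : 0 < ∑ y ∈ window (2 * gridSize m), W y := by
  have hoffset : (0 : ℝ) < weightOffset m := by exact_mod_cast weightOffset_pos m
  have mass_pos : 0 < gridMass m (gridSize m) (gridSize m) :=
    lt_of_lt_of_le (by have := gridSize_pos m; positivity) (le_gridMass (gridSize_pos m) (by omega))
  choose x hx htx using fun l => exists_grid_point (gridSize_pos m) (ht l)
  have : (0 : ℝ) < ∑ y ∈ window (2 * gridSize m), (W y : ℝ) := by
    calc (0 : ℝ) < weightOffset m *
          ((∑ l, ∑ y ∈ window (2 * gridSize m), gridKernel m (gridSize m) (x l - y)) / n) :=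
          mul_pos hoffset (mass_pos.trans_le
            (le_sum_div_of_forall_le fun l => gridMass_le_sum_translate (hx l)))
      _ = ∑ y ∈ window (2 * gridSize m),
          weightOffset m * ((∑ l, gridKernel m (gridSize m) (x l - y)) / n) := by
          rw [Finset.sum_comm, Finset.sum_div, Finset.mul_sum]
      _ ≤ _ := Finset.sum_le_sum fun y hy => by
          linarith [(abs_le.mp (hW.abs_sub_le (by omega) ht hx htx hN (y := y)
            (by exact_mod_cast mem_window.1 hy))).1]
  exact_mod_cast this

/-- The base of the code for return counts. -/
def codeBase (m : ℕ) : ℤ := (gridSize m : ℤ) ^ (16 * m)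

/-- The weight of the grid point `y`, read off a code `H` of the return counts. -/
def weightValue (m : ℕ) (H y : ℤ) : ℤ :=
  (scaledKernel m (gridSize m : ℤ) y (codeBase m) * H / codeBase m ^ (8 * m) +
    weightOffset m) % codeBase m

theorem codeBase_pos (m : ℕ) : 0 < codeBase m := by
  unfold codeBase gridSize
  positivity

theorem weightValue_nonneg (m : ℕ) (H y : ℤ) : 0 ≤ weightValue m H y :=
  Int.emod_nonneg _ (codeBase_pos m).ne'

theorem weightValue_lt (m : ℕ) (H y : ℤ) : weightValue m H y < codeBase m :=
  Int.emod_lt_of_pos _ (codeBase_pos m)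

theorem two_mul_pow_lt_codeBase {m : ℕ} (hm : 1 ≤ m) :
    2 * (gridSize m : ℤ) ^ (8 * m + 6) < codeBase m := by
  have hG : (3 : ℤ) ≤ gridSize m := by
    exact_mod_cast (by omega : 3 ≤ 8 * m + 1).trans (eight_mul_add_one_le_gridSize m)
  calc 2 * (gridSize m : ℤ) ^ (8 * m + 6)
      < (gridSize m : ℤ) * (gridSize m : ℤ) ^ (8 * m + 6) := by gcongr; linarith
    _ = (gridSize m : ℤ) ^ (8 * m + 7) := by ring
    _ ≤ codeBase m := pow_le_pow_right₀ (by linarith) (by omega)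

theorem weightOffset_le (m : ℕ) : weightOffset m ≤ (gridSize m : ℤ) ^ (8 * m + 4) :=
  calc weightOffset m = (4 ^ 4) ^ m * (gridSize m : ℤ) ^ (8 * m + 3) := by
        rw [weightOffset, mul_pow, ← pow_mul, ← pow_mul]; ring
    _ ≤ 65536 ^ m * (gridSize m : ℤ) ^ (8 * m + 3) := by gcongr; norm_num
    _ = (gridSize m : ℤ) ^ (8 * m + 4) := by rw [gridSize]; push_cast; ring

theorem coeffNorm_weightPoly_le_pow (m : ℕ) {y : ℤ} (hy : |y| ≤ 2 * gridSize m) :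
    coeffNorm ℤ (weightPoly m (gridSize m) y) ≤ (gridSize m : ℝ) ^ (8 * m + 2) :=
  calc coeffNorm ℤ (weightPoly m (gridSize m) y) ≤ (21 * (gridSize m : ℝ) ^ 2) ^ (4 * m) := by
        simpa using coeffNorm_weightPoly_le m (G := gridSize m) (y := y) (by simpa using hy)
    _ = (21 ^ 4) ^ m * (gridSize m : ℝ) ^ (8 * m) := by
        rw [mul_pow, ← pow_mul, ← pow_mul]; ring
    _ ≤ (65536 ^ 2) ^ m * (gridSize m : ℝ) ^ (8 * m) := by gcongr; norm_num
    _ = (gridSize m : ℝ) ^ (8 * m + 2) := by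
        rw [pow_add, pow_right_comm, mul_comm, gridSize, Nat.cast_pow, Nat.cast_ofNat]

theorem ApproxMoments.le {n : ℕ} [NeZero n] {m : ℕ} (hm : 1 ≤ m) {t : Fin n → ℝ}
    (ht : ∀ l, |t l| ≤ 1) {N : ℕ → ℕ} (hN : ApproxMoments m t N) {j : ℕ} (hj : j ≤ 8 * m) :
    N j ≤ gridSize m ^ 4 := by
  have : (2 : ℝ) ≤ gridSize m := by
    exact_mod_cast (show 2 ≤ gridSize m by have := eight_mul_add_one_le_gridSize m; omega)
  have average_le : (∑ l, t l ^ j) / n ≤ 1 := by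
    rw [div_le_one (by exact_mod_cast NeZero.pos n)]
    calc ∑ l, t l ^ j ≤ ∑ _l : Fin n, (1 : ℝ) := Finset.sum_le_sum fun l _ =>
          (le_abs_self _).trans (by rw [abs_pow]; exact pow_le_one₀ (abs_nonneg _) (ht l))
      _ = n := by simp
  have : (N j : ℝ) ≤ (gridSize m : ℝ) ^ 4 :=
    calc (N j : ℝ) ≤ (gridSize m : ℝ) ^ 3 * 1 + (gridSize m : ℝ) ^ 2 := by
          linarith [(abs_le.mp (hN j hj)).2,
            mul_le_mul_of_nonneg_left average_le (by positivity : 0 ≤ (gridSize m : ℝ) ^ 3)]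
      _ = (gridSize m : ℝ) ^ 2 * (gridSize m + 1) := by ring
      _ ≤ (gridSize m : ℝ) ^ 2 * (gridSize m : ℝ) ^ 2 := by gcongr; nlinarith
      _ = (gridSize m : ℝ) ^ 4 := by ring
  exact_mod_cast this

theorem approxWeights_weightValue {n : ℕ} [NeZero n] {m : ℕ} (hm : 1 ≤ m) {t : Fin n → ℝ}
    (ht : ∀ l, |t l| ≤ 1) {M : ℕ → ℕ} (hN : ApproxMoments m t fun j => M (8 * m - j)) :
    ApproxWeights m (fun j => M (8 * m - j))
      (weightValue m ((countPoly (8 * m) M).eval (codeBase m))) := by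
  intro y hy
  set p := weightPoly m (gridSize m) y * countPoly (8 * m) M with hp
  have room := two_mul_pow_lt_codeBase hm
  have offset_le : weightOffset m ≤ (gridSize m : ℤ) ^ (8 * m + 6) :=
    (weightOffset_le m).trans
      (pow_le_pow_right₀ (by exact_mod_cast gridSize_pos m) (by omega))
  have counts_le : ∀ j ≤ 8 * m, M j ≤ gridSize m ^ 4 := fun j hj => by
    simpa [Nat.sub_sub_self hj] using hN.le hm ht (Nat.sub_le (8 * m) j)
  have coeff_le : ∀ i, |p.coeff i| ≤ (gridSize m : ℤ) ^ (8 * m + 6) := fun i => by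
    have : |(p.coeff i : ℝ)| ≤ (gridSize m : ℝ) ^ (8 * m + 6) :=
      calc |(p.coeff i : ℝ)| ≤ coeffNorm ℤ (weightPoly m (gridSize m) y) * (gridSize m ^ 4 : ℕ) :=
            abs_coeff_mul_countPoly_le _ _ counts_le i
        _ ≤ (gridSize m : ℝ) ^ (8 * m + 2) * (gridSize m ^ 4 : ℕ) := by
            gcongr
            exact coeffNorm_weightPoly_le_pow m hy
        _ = (gridSize m : ℝ) ^ (8 * m + 6) := by push_cast; ring
    exact_mod_cast this
  have top_coeff : p.coeff (8 * m) = momentSum m (fun j => M (8 * m - j)) y :=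
    coeff_mul_countPoly _ _ _
  have := momentSum_add_weightOffset_pos hm ht hN hy
  have := coeff_le 0
  have := weightOffset_pos m
  obtain ⟨e, e_nonneg, e_le, digit⟩ := exists_ediv_add_emod_eq p (8 * m) (codeBase_pos m)
    (σ := weightOffset m) (fun i => by linarith [coeff_le i]) (by rw [top_coeff]; linarith)
    (by linarith [(abs_le.mp (coeff_le (8 * m))).2])
  refine ⟨e, e_nonneg, e_le, ?_⟩
  rw [← top_coeff, ← digit, weightValue, hp, eval_mul, eval_weightPoly]

/-! ### Straight-line programs -/

/-- All integer cells have bit length at most `β`. -/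
def BitBounded (β : ℕ) (m : ℕ → ℤ) : Prop := ∀ i, bits (m i) ≤ β

/-- The cell number that a location refers to, as a function of the integer memory alone. -/
def resolve (m : ℕ → ℤ) : Loc → ℕ
  | .dir i => i
  | .ind i => (m i).toNat

/-- The effect of straight-line integer code on the integer memory. Instructions that are not
straight-line code are given the junk value `m`. -/
def memEval : Prog → (ℕ → ℤ) → ℕ → ℤ
  | .const d z, m => Function.update m (resolve m d) z
  | .copy d a, m => Function.update m (resolve m d) (m (resolve m a))
  | .arith o d a b, m =>
      Function.update m (resolve m d) (o.eval (m (resolve m a)) (m (resolve m b)))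
  | .seq p q, m => memEval q (memEval p m)
  | _, m => m

/-- Programs without loops, branches and access to vertices. -/
def IsStraight : Prog → Prop
  | .const _ _ => True
  | .copy _ _ => True
  | .arith _ _ _ _ => True
  | .seq p q => IsStraight p ∧ IsStraight q
  | _ => False

/-- A constant that governs both the running time of a straight-line program and the growth of
the numbers it computes; the recursion for `.seq` reflects that the second program starts from
numbers that the first one has enlarged. -/
def straightCost : Prog → ℕ
  | .const _ z => 3 + bits z
  | .seq p q => straightCost p + straightCost q * (1 + straightCost p) ^ 2
  | _ => 4

theorem straightCost_seq_bound (p q : Prog) (β : ℕ) :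
    straightCost p * (1 + β) ^ 2 + straightCost q * (1 + straightCost p * (1 + β)) ^ 2 ≤
      straightCost (.seq p q) * (1 + β) ^ 2 := by
  have growth : 1 + straightCost p * (1 + β) ≤ (1 + straightCost p) * (1 + β) := by nlinarith
  calc straightCost p * (1 + β) ^ 2 + straightCost q * (1 + straightCost p * (1 + β)) ^ 2
      ≤ straightCost p * (1 + β) ^ 2
        + straightCost q * ((1 + straightCost p) * (1 + β)) ^ 2 := by gcongr
    _ = straightCost (.seq p q) * (1 + β) ^ 2 := by rw [straightCost]; ring

theorem bits_le_iff {z : ℤ} {β : ℕ} : bits z ≤ β ↔ |z| < 2 ^ β := by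
  rw [bits, Nat.size_le, ← Int.natCast_natAbs]
  exact_mod_cast Iff.rfl

theorem bits_eval_le (o : Op) {x y : ℤ} {β : ℕ} (hx : bits x ≤ β) (hy : bits y ≤ β) :
    bits (o.eval x y) ≤ 2 * β + 1 := by
  rw [bits_le_iff] at *
  have one_le : (1 : ℤ) ≤ 2 ^ β := one_le_pow₀ (by norm_num)
  have bound_eq : (2 : ℤ) ^ (2 * β + 1) = 2 * (2 ^ β * 2 ^ β) := by
    rw [pow_succ, two_mul, pow_add]; ring
  rw [bound_eq]
  cases o with
  | add => exact (abs_add_le x y).trans_lt (by nlinarith)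
  | sub => exact (abs_sub x y).trans_lt (by nlinarith)
  | mul =>
    rw [Op.eval, abs_mul]
    nlinarith [abs_nonneg x, abs_nonneg y]
  | div =>
    have quotient_le : |x / y| ≤ |x| := by
      rw [← Int.natCast_natAbs, ← Int.natCast_natAbs]
      exact_mod_cast Int.natAbs_ediv_le_natAbs x y
    rw [Op.eval]
    nlinarith

namespace BitBounded

variable {β γ : ℕ} {m : ℕ → ℤ}

theorem mono (hm : BitBounded β m) (h : β ≤ γ) : BitBounded γ m :=
  fun i => (hm i).trans h

theorem update (hm : BitBounded β m) (d : ℕ) {z : ℤ} (hz : bits z ≤ β) :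
    BitBounded β (Function.update m d z) := by
  intro i
  rcases eq_or_ne i d with rfl | hi
  · simpa using hz
  · simpa [hi] using hm i

theorem memEval {p : Prog} (hp : IsStraight p) (hm : BitBounded β m) :
    BitBounded (straightCost p * (1 + β)) (memEval p m) := by
  induction p generalizing β m with
  | const d z =>
    simp only [SpectralSampling.memEval, straightCost]
    exact (hm.mono (by nlinarith)).update _ (by nlinarith)
  | copy d a =>
    simp only [SpectralSampling.memEval, straightCost]
    exact (hm.mono (by nlinarith)).update _ ((hm _).trans (by nlinarith))
  | arith o d a b =>
    simp only [SpectralSampling.memEval, straightCost]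
    exact (hm.mono (by nlinarith)).update _ ((bits_eval_le o (hm _) (hm _)).trans (by nlinarith))
  | seq p q ihp ihq =>
    refine (ihq hp.2 (ihp hp.1 hm)).mono ?_
    have growth : 1 + straightCost p * (1 + β) ≤ (1 + straightCost p) ^ 2 * (1 + β) := by
      nlinarith [Nat.zero_le (straightCost p * β)]
    calc straightCost q * (1 + straightCost p * (1 + β))
        ≤ straightCost q * ((1 + straightCost p) ^ 2 * (1 + β)) := by gcongr
      _ ≤ straightCost (.seq p q) * (1 + β) := by rw [straightCost]; nlinarith
  | _ => exact hp.elim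

end BitBounded

theorem addr_eq_resolve {n : ℕ} (s : State n) (d : Loc) : s.addr d = resolve s.mem d := by
  cases d <;> rfl

theorem addrCost_le {n : ℕ} {s : State n} {β : ℕ} (h : BitBounded β s.mem) (d : Loc) :
    s.addrCost d ≤ 1 + β := by
  cases d with
  | dir i => simp [State.addrCost]
  | ind i => simpa [State.addrCost] using h i

/-! ### Couplings of computations with random variables -/

/-- For all large amounts of fuel, the computation `e` does not run out of fuel, and its result
can be coupled with a random variable of distribution `D` such that `R` holds almost surely. The
coupling has finite support, so that finitely many lower bounds on the fuel suffice when
computations are composed. -/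
def Coupled {α σ : Type} (e : ℕ → PMF (Option σ)) (D : PMF α) (R : α → σ → Prop) : Prop :=
  ∃ J : PMF (α × σ), J.support.Finite ∧ J.map Prod.fst = D ∧
    (∀ᶠ fuel in atTop, e fuel = J.map fun x => some x.2) ∧ ∀ x ∈ J.support, R x.1 x.2

theorem bind_congr_support {α β : Type*} (p : PMF α) {f g : α → PMF β}
    (h : ∀ a ∈ p.support, f a = g a) : p.bind f = p.bind g := by
  ext b
  rw [PMF.bind_apply, PMF.bind_apply]
  refine tsum_congr fun a => ?_
  by_cases ha : a ∈ p.support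
  · rw [h a ha]
  · rw [(PMF.apply_eq_zero_iff p a).mpr ha, zero_mul, zero_mul]

namespace Coupled

variable {α β σ : Type} {D : PMF α} {R : α → σ → Prop}

theorem mono {e : ℕ → PMF (Option σ)} {R' : α → σ → Prop} (h : Coupled e D R)
    (hR : ∀ x s, R x s → R' x s) : Coupled e D R' := by
  obtain ⟨J, hfin, hD, he, hJ⟩ := h
  exact ⟨J, hfin, hD, he, fun x hx => hR _ _ (hJ x hx)⟩

theorem of_succ {e e' : ℕ → PMF (Option σ)} (h : Coupled e' D R)
    (he : ∀ fuel, e (fuel + 1) = e' fuel) : Coupled e D R := by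
  obtain ⟨J, hfin, hD, he', hJ⟩ := h
  refine ⟨J, hfin, hD, (tendsto_sub_atTop_nat 1 |>.eventually he').mp ?_, hJ⟩
  filter_upwards [eventually_ge_atTop 1] with fuel hfuel h
  rw [← h, ← he, Nat.sub_add_cancel hfuel]

theorem of_map (hD : D.support.Finite) {e : ℕ → PMF (Option σ)} (f : α → σ)
    (he : ∀ fuel, e (fuel + 1) = D.map fun x => some (f x)) (hR : ∀ x ∈ D.support, R x (f x)) :
    Coupled e D R := by
  refine of_succ (e' := fun _ => D.map fun x => some (f x))
    ⟨D.map fun x => (x, f x), ?_, ?_, .of_forall fun _ => ?_, ?_⟩ he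
  · rw [PMF.support_map]; exact hD.image _
  · rw [PMF.map_comp]; exact PMF.map_id _
  · rw [PMF.map_comp]; rfl
  · intro x hx
    obtain ⟨y, hy, rfl⟩ := (PMF.mem_support_map_iff _ _ _).mp hx
    exact hR y hy

theorem map {e : ℕ → PMF (Option σ)} {R' : β → σ → Prop} (h : Coupled e D R) (f : α → β)
    (hR : ∀ x s, R x s → R' (f x) s) : Coupled e (D.map f) R' := by
  obtain ⟨J, hfin, hD, he, hJ⟩ := h
  refine ⟨J.map (Prod.map f id), ?_, ?_, ?_, ?_⟩
  · rw [PMF.support_map]; exact hfin.image _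
  · rw [← hD, PMF.map_comp, PMF.map_comp]; rfl
  · simp only [PMF.map_comp]; exact he
  · intro x hx
    obtain ⟨y, hy, rfl⟩ := (PMF.mem_support_map_iff _ _ _).mp hx
    exact hR _ _ (hJ y hy)

theorem bind {e : ℕ → PMF (Option σ)} {e' : ℕ → σ → PMF (Option σ)} {E : α → PMF β}
    {R' : β → σ → Prop} (h : Coupled e D R)
    (h' : ∀ x s, R x s → Coupled (e' · s) (E x) R') :
    Coupled (fun fuel => (e fuel).bind fun r => r.elim (PMF.pure none) (e' fuel))
      (D.bind E) R' := by
  obtain ⟨J, hfin, hD, he, hJ⟩ := h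
  have hstep (x : α × σ) : ∃ J' : PMF (β × σ), x ∈ J.support →
      J'.support.Finite ∧ J'.map Prod.fst = E x.1 ∧
      (∀ᶠ fuel in atTop, e' fuel x.2 = J'.map fun y => some y.2) ∧
      ∀ y ∈ J'.support, R' y.1 y.2 := by
    by_cases hx : x ∈ J.support
    · exact (h' x.1 x.2 (hJ x hx)).imp fun _ hJ' _ => hJ'
    · obtain ⟨z, hz⟩ := J.support_nonempty
      exact (h' z.1 z.2 (hJ z hz)).imp fun _ _ hx' => absurd hx' hx
  choose K hK using hstep
  refine ⟨J.bind K, ?_, ?_, ?_, ?_⟩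
  · rw [PMF.support_bind]
    exact hfin.biUnion fun x hx => (hK x hx).1
  · rw [PMF.map_bind, ← hD, PMF.bind_map]
    exact bind_congr_support _ fun x hx => (hK x hx).2.1
  · filter_upwards [he, (hfin.eventually_all).mpr fun x hx => (hK x hx).2.2.1] with fuel he he'
    rw [he, PMF.map_bind, PMF.bind_map]
    exact bind_congr_support _ he'
  · intro y hy
    obtain ⟨x, hx, hy⟩ := (PMF.mem_support_bind_iff _ _ _).mp hy
    exact (hK x hx).2.2.2 y hy

end Coupled

/-! ### Simulation of programs -/

section

variable {n : ℕ} [NeZero n] (col : Fin n → PMF (Fin n))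

/-- Started with integer memory `m` and vertex memory `v`, the program `p` halts after at most
`T` steps and `T` oracle calls, and its final memories can be coupled with a random variable of
distribution `D` such that the relation `R` holds almost surely. -/
def Simulates {α : Type} (T : ℕ) (p : Prog) (m : ℕ → ℤ) (v : ℕ → Option (Fin n)) (D : PMF α)
    (R : α → (ℕ → ℤ) → (ℕ → Option (Fin n)) → Prop) : Prop :=
  ∀ s : State n, s.mem = m → s.vtx = v → Coupled (exec col · p s) D fun x s' =>
    R x s'.mem s'.vtx ∧ s'.time ≤ s.time + T ∧ s'.queries ≤ s.queries + T

/-- Started with integer memory `m`, the program `p` halts after at most `T` steps and `T` oracle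
calls with an integer memory that satisfies `Q`, and without changing the vertex memory. -/
def Computes (T : ℕ) (p : Prog) (m : ℕ → ℤ) (Q : (ℕ → ℤ) → Prop) : Prop :=
  ∀ v, Simulates col T p m v (PMF.pure ()) fun _ m' v' => Q m' ∧ v' = v

/-- `i` steps of the inhomogeneous Markov chain whose step with `j` steps to go afterwards is
governed by the kernel `K j`. -/
def iterate {α : Type} (K : ℕ → α → PMF α) : ℕ → α → PMF α
  | 0, x => PMF.pure x
  | i + 1, x => (K i x).bind (iterate K i)

variable {col}

namespace Simulates

variable {α β : Type} {T T' : ℕ} {p q : Prog} {m : ℕ → ℤ} {v : ℕ → Option (Fin n)} {D : PMF α}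
  {R : α → (ℕ → ℤ) → (ℕ → Option (Fin n)) → Prop}

theorem mono {R' : α → (ℕ → ℤ) → (ℕ → Option (Fin n)) → Prop}
    (h : Simulates col T p m v D R) (hT : T ≤ T') (hR : ∀ x m' v', R x m' v' → R' x m' v') :
    Simulates col T' p m v D R' := fun s hm hv =>
  (h s hm hv).mono fun _ _ ⟨hx, ht, hq⟩ =>
    ⟨hR _ _ _ hx, ht.trans (by gcongr), hq.trans (by gcongr)⟩

theorem map {R' : β → (ℕ → ℤ) → (ℕ → Option (Fin n)) → Prop} (h : Simulates col T p m v D R)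
    (f : α → β) (hR : ∀ x m' v', R x m' v' → R' (f x) m' v') :
    Simulates col T p m v (D.map f) R' := fun s hm hv =>
  (h s hm hv).map f fun _ _ h => ⟨hR _ _ _ h.1, h.2⟩

theorem seq {E : α → PMF β} {R' : β → (ℕ → ℤ) → (ℕ → Option (Fin n)) → Prop}
    (hp : Simulates col T p m v D R)
    (hq : ∀ x m' v', R x m' v' → Simulates col T' q m' v' (E x) R') :
    Simulates col (T + T') (.seq p q) m v (D.bind E) R' := by
  intro s hm hv
  refine ((hp s hm hv).bind (e' := fun fuel => exec col fuel q) fun x s' ⟨hx, ht, hs⟩ =>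
    (hq _ _ _ hx s' rfl rfl).mono fun y s'' ⟨hy, ht', hs'⟩ => ?_).of_succ fun fuel => rfl
  exact ⟨hy, add_assoc s.time T T' ▸ ht'.trans (Nat.add_le_add_right ht T'),
    add_assoc s.queries T T' ▸ hs'.trans (Nat.add_le_add_right hs T')⟩

theorem unif (d : ℕ) : Simulates col 2 (.unif (.dir d)) m v (PMF.uniformOfFintype (Fin n))
    fun j m' v' => m' = m ∧ v' = Function.update v d (some j) := by
  rintro s rfl rfl
  exact .of_map (Set.toFinite _) _ (fun _ => rfl) fun j _ => ⟨⟨rfl, rfl⟩, le_rfl, by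
    simp [State.query, State.charge, State.setVtx]⟩

theorem sample (d : ℕ) {w : ℕ} {b : Fin n} (hw : v w = some b) :
    Simulates col 3 (.sample (.dir d) (.dir w)) m v (col b)
      fun j m' v' => m' = m ∧ v' = Function.update v d (some j) := by
  rintro s rfl rfl
  refine .of_map (Set.toFinite _) (fun j => ((s.setVtx (.dir d) (some j)).charge 3).query)
    (fun _ => ?_) fun j _ => ⟨⟨rfl, rfl⟩, le_rfl, by simp [State.query, State.charge, State.setVtx]⟩
  have vertex : s.vert (.dir w) = some b := hw
  simp only [exec, vertex, PMF.map_comp]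
  rfl

theorem loop {K : ℕ → α → PMF α} {I : ℕ → α → (ℕ → ℤ) → (ℕ → Option (Fin n)) → Prop} {β a : ℕ}
    (hbits : ∀ i x m v, I i x m v → bits (m a) ≤ β)
    (hbody : ∀ i x m v, I (i + 1) x m v → 0 < m a ∧ Simulates col T p m v (K i x) (I i))
    (hend : ∀ x m v, I 0 x m v → m a ≤ 0) {N : ℕ} {x : α} (h : I N x m v) :
    Simulates col ((N + 1) * (T + 2 + β)) (.loop (.dir a) p) m v (iterate K N x) (I 0) := by
  induction N generalizing x m v with
  | zero =>
    rintro s rfl rfl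
    have hcost := hbits _ _ _ _ h
    refine .of_map (by simp [iterate]) (fun _ => s.charge (2 + bits (s.mem a))) (fun fuel => ?_) ?_
    · simp [exec, State.val, State.addr, State.addrCost, iterate, PMF.pure_map,
        not_lt.mpr (hend _ _ _ h)]
    · rintro y hy
      obtain rfl := (PMF.mem_support_pure_iff _ _).mp hy
      exact ⟨h, by simp only [State.charge]; nlinarith, Nat.le_add_right _ _⟩
  | succ i ih =>
    rintro s rfl rfl
    have hcost := hbits _ _ _ _ h
    obtain ⟨hpos, hstep⟩ := hbody _ _ _ _ h
    refine ((hstep (s.charge (2 + bits (s.mem a))) rfl rfl).bind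
      (e' := fun fuel => exec col fuel (.loop (.dir a) p)) fun y s' ⟨hy, ht, hs⟩ =>
      (ih hy s' rfl rfl).mono (R' := fun z s'' => I 0 z s''.mem s''.vtx ∧
        s''.time ≤ s.time + (i + 1 + 1) * (T + 2 + β) ∧
        s''.queries ≤ s.queries + (i + 1 + 1) * (T + 2 + β))
      fun z s'' ⟨hz, ht', hs'⟩ => ⟨hz, ?_, ?_⟩).of_succ fun fuel => ?_
    · simp only [State.charge] at ht
      linarith [ht']
    · simp only [State.charge] at hs
      linarith [hs']
    · simp [exec, State.val, State.addr, State.addrCost, hpos]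

end Simulates

namespace Computes

variable {T T' : ℕ} {p q : Prog} {m : ℕ → ℤ} {Q Q' : (ℕ → ℤ) → Prop}

theorem mono (h : Computes col T p m Q) (hT : T ≤ T') (hQ : ∀ m', Q m' → Q' m') :
    Computes col T' p m Q' := fun v =>
  (h v).mono hT fun _ _ _ h => ⟨hQ _ h.1, h.2⟩

theorem seq_simulates {α : Type} {v : ℕ → Option (Fin n)} {D : PMF α}
    {R : α → (ℕ → ℤ) → (ℕ → Option (Fin n)) → Prop} (hp : Computes col T p m Q)
    (hq : ∀ m', Q m' → Simulates col T' q m' v D R) :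
    Simulates col (T + T') (.seq p q) m v D R := by
  have h := (hp v).seq (T' := T') (q := q) (E := fun _ => D) (R' := R) fun _ m' _ h =>
    h.2 ▸ hq m' h.1
  rwa [PMF.pure_bind] at h

theorem seq (hp : Computes col T p m Q) (hq : ∀ m', Q m' → Computes col T' q m' Q') :
    Computes col (T + T') (.seq p q) m Q' := fun v =>
  hp.seq_simulates fun m' h => hq m' h v

theorem of_exec {f : State n → State n}
    (he : ∀ fuel s, exec col (fuel + 1) p s = PMF.pure (some (f s)))
    (hf : ∀ s, s.mem = m → Q (f s).mem ∧ (f s).vtx = s.vtx ∧ (f s).time ≤ s.time + T ∧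
      (f s).queries = s.queries) : Computes col T p m Q := by
  rintro v s rfl rfl
  refine .of_map (by simp) (fun _ => f s) (fun fuel => by rw [he, PMF.pure_map]) fun _ _ => ?_
  obtain ⟨hQ, hv, ht, hs⟩ := hf s rfl
  exact ⟨⟨hQ, hv⟩, ht, hs.trans_le (Nat.le_add_right _ _)⟩

theorem straight (hp : IsStraight p) {β : ℕ} (hm : BitBounded β m) :
    Computes col (straightCost p * (1 + β) ^ 2) p m (· = memEval p m) := by
  induction p generalizing β m with
  | const d z =>
    refine of_exec (fun _ _ => rfl) ?_
    rintro s rfl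
    refine ⟨by simp [State.charge, State.setMem, memEval, addr_eq_resolve], rfl, ?_, rfl⟩
    have := addrCost_le hm d
    simp only [State.charge, State.setMem, straightCost]
    nlinarith [Nat.zero_le (bits z * β), Nat.zero_le (bits z * β ^ 2)]
  | copy d a =>
    refine of_exec (fun _ _ => rfl) ?_
    rintro s rfl
    refine ⟨by simp [State.charge, State.setMem, memEval, addr_eq_resolve, State.val], rfl, ?_, rfl⟩
    have := addrCost_le hm d
    have := addrCost_le hm a
    have : bits (s.val a) ≤ β := hm _
    simp only [State.charge, State.setMem, straightCost]
    nlinarith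
  | arith o d a b =>
    refine of_exec (fun _ _ => rfl) ?_
    rintro s rfl
    refine ⟨by simp [State.charge, State.setMem, memEval, addr_eq_resolve, State.val], rfl, ?_, rfl⟩
    have := addrCost_le hm d
    have := addrCost_le hm a
    have := addrCost_le hm b
    have : (1 + bits (s.val a)) * (1 + bits (s.val b)) ≤ (1 + β) * (1 + β) := by
      gcongr <;> exact hm _
    simp only [State.charge, State.setMem, straightCost]
    nlinarith
  | seq p q ihp ihq =>
    refine ((ihp hp.1 hm).seq (T' := straightCost q * (1 + straightCost p * (1 + β)) ^ 2) ?_).mono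
      (straightCost_seq_bound p q β) fun _ h => h
    rintro _ rfl
    exact ihq hp.2 (hm.memEval hp.1)
  | _ => exact hp.elim

theorem loop {I : ℕ → (ℕ → ℤ) → Prop} {β a : ℕ} (hbits : ∀ i m, I i m → bits (m a) ≤ β)
    (hbody : ∀ i m, I (i + 1) m → 0 < m a ∧ Computes col T p m (I i))
    (hend : ∀ m, I 0 m → m a ≤ 0) {N : ℕ} (h : I N m) :
    Computes col ((N + 1) * (T + 2 + β)) (.loop (.dir a) p) m (I 0) := by
  intro v
  have iterate_pure : iterate (fun _ => PMF.pure) N () = PMF.pure () := by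
    clear h
    induction N with
    | zero => rfl
    | succ i ih => rw [iterate, PMF.pure_bind, ih]
  rw [← iterate_pure]
  exact Simulates.loop (I := fun i _ m' v' => I i m' ∧ v' = v) (fun i _ m' _ h => hbits i m' h.1)
    (fun i _ m' v' ⟨h, hv⟩ => ⟨(hbody i m' h).1, hv ▸ (hbody i m' h).2 v'⟩)
    (fun _ m' _ h => hend m' h.1) ⟨h, rfl⟩

end Computes

theorem Simulates.seq_computes {α : Type} {T T' : ℕ} {p q : Prog} {m : ℕ → ℤ}
    {v : ℕ → Option (Fin n)} {D : PMF α} {R R' : α → (ℕ → ℤ) → (ℕ → Option (Fin n)) → Prop}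
    (hp : Simulates col T p m v D R)
    (hq : ∀ x m' v', R x m' v' → Computes col T' q m' (R' x · v')) :
    Simulates col (T + T') (.seq p q) m v D R' := by
  have h := hp.seq (E := PMF.pure) fun x m' v' h => by
    simpa only [PMF.pure_map] using
      ((hq x m' v' h) v').map (R' := R') (fun _ => x) fun _ _ _ h => h.2 ▸ h.1
  rwa [PMF.bind_pure] at h

theorem Simulates.test (d w w' : ℕ) {m : ℕ → ℤ} {v : ℕ → Option (Fin n)} :
    Simulates col 4 (.test (.dir d) (.dir w) (.dir w')) m v (PMF.pure ()) fun _ m' v' =>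
      m' = Function.update m d (if v w = v w' then 1 else 0) ∧ v' = v := by
  rintro s rfl rfl
  refine .of_map (by simp)
    (fun _ => (s.setMem (.dir d) (if s.vtx w = s.vtx w' then 1 else 0)).charge 4)
    (fun _ => by rw [PMF.pure_map]; rfl) fun _ _ => ⟨⟨rfl, rfl⟩, le_rfl, Nat.le_add_right _ _⟩

end

/- The program works in even cells below `54`, from which the output must be laid out in
`location, weight` pairs starting at cell `2`. The odd cells below `54` stay `0`, so that the pairs
below `54` become atoms of weight `0`. -/
local notation "cOne" => 2
local notation "cDegree" => 4
local notation "cGrid" => 6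
local notation "cCounter" => 8
local notation "cWalks" => 10
local notation "cWalksLeft" => 12
local notation "cScale" => 14
local notation "cBase" => 16
local notation "cPower" => 18
local notation "cShift" => 20
local notation "cTop" => 22
local notation "cPosition" => 24
local notation "cCode" => 26
local notation "cTmp" => 28
local notation "cScaleSq" => 30
local notation "cStep" => 32
local notation "cCur" => 34
local notation "cPrev" => 36
local notation "cAtomsLeft" => 38
local notation "cCenter" => 40
local notation "cGridBase" => 42
local notation "cOffset" => 44
local notation "cAddress" => 46
local notation "cPoint" => 48
local notation "cWeight" => 50
local notation "cStart" => 52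

local notation:60 d:61 "≔" a:61 => Prog.copy (Loc.dir d) (Loc.dir a)
local notation:60 d:61 "≔const" z:61 => Prog.const (Loc.dir d) z
local notation:60 d:61 "≔" a:61 "⊞" b:61 => Prog.arith Op.add (Loc.dir d) (Loc.dir a) (Loc.dir b)
local notation:60 d:61 "≔" a:61 "⊟" b:61 => Prog.arith Op.sub (Loc.dir d) (Loc.dir a) (Loc.dir b)
local notation:60 d:61 "≔" a:61 "⊠" b:61 => Prog.arith Op.mul (Loc.dir d) (Loc.dir a) (Loc.dir b)
local notation:60 d:61 "≔" a:61 "⊘" b:61 => Prog.arith Op.div (Loc.dir d) (Loc.dir a) (Loc.dir b)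
local notation:50 p:51 ";;" q:50 => Prog.seq p q

/-! ### The sampling phase -/

/-- Record a visit of the walk to its starting point: the indicator of this event in `cTmp` is
added to `cCode` at the digit with place value `cPosition`, which moves on to the next digit. -/
def recordReturn : Prog :=
  cTmp ≔ cTmp ⊠ cPosition ;; cCode ≔ cCode ⊞ cTmp ;; cPosition ≔ cPosition ⊘ cBase

/-- One random walk that starts in vertex cell `0`, with its first step already in vertex
cell `1`. The place value in `cPosition` also serves as the step counter. -/
def walkLoop : Prog :=
  .loop (.dir cPosition) (.test (.dir cTmp) (.dir 0) (.dir 1) ;; recordReturn ;;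
    .sample (.dir 1) (.dir 1))

/-- `cWalksLeft` random walks, each from a uniformly random vertex. -/
def sampleLoop : Prog :=
  .loop (.dir cWalksLeft) (.unif (.dir 0) ;; .sample (.dir 1) (.dir 0) ;;
    cPosition ≔ cTop ;; walkLoop ;; cWalksLeft ≔ cWalksLeft ⊟ cOne)

section

variable {n : ℕ} (col : Fin n → PMF (Fin n))

/-- One step of a walk that started in `a` and is now in `x.1`, after which `l` more steps remain.
Here `x.2 l` counts the returns to the start with `l` steps to go. -/
def walkStep (a : Fin n) (l : ℕ) (x : Fin n × (ℕ → ℕ)) : PMF (Fin n × (ℕ → ℕ)) :=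
  (col x.1).map fun c => (c, if a = x.1 then Function.update x.2 l (x.2 l + 1) else x.2)

/-- The return counts after one more walk of length `L` from a uniformly random vertex. -/
def walk [NeZero n] (L : ℕ) (M : ℕ → ℕ) : PMF (ℕ → ℕ) :=
  (PMF.uniformOfFintype (Fin n)).bind fun a => (col a).bind fun b =>
    (iterate (walkStep col a) L (b, M)).map Prod.snd

/-- The return counts after `t` more walks. -/
def walks [NeZero n] (L t : ℕ) (M : ℕ → ℕ) : PMF (ℕ → ℕ) :=
  iterate (fun _ => walk col L) t M

/-- Return counts of walks of length `L`, as the digits of a number in base `B`. -/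
def encode (L : ℕ) (B : ℤ) (M : ℕ → ℕ) : ℤ := ∑ j ∈ Finset.range (L + 1), (M j : ℤ) * B ^ j

end

section

variable {L β : ℕ} {B W : ℤ} {m₀ : ℕ → ℤ}

theorem encode_nonneg (hB : 0 ≤ B) (M : ℕ → ℕ) : 0 ≤ encode L B M :=
  Finset.sum_nonneg fun j _ => by positivity

theorem encode_update {l : ℕ} (hl : l ≤ L) (M : ℕ → ℕ) :
    encode L B (Function.update M l (M l + 1)) = encode L B M + B ^ l := by
  have hmem : l ∈ Finset.range (L + 1) := Finset.mem_range.mpr (by omega)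
  have hrest : ∀ x ∈ (Finset.range (L + 1)).erase l,
      (Function.update M l (M l + 1) x : ℤ) * B ^ x = M x * B ^ x := fun x hx => by
    rw [Function.update_of_ne (Finset.ne_of_mem_erase hx)]
  rw [encode, encode, ← Finset.add_sum_erase _ _ hmem, ← Finset.add_sum_erase _ _ hmem,
    Finset.sum_congr rfl hrest, Function.update_self]
  push_cast
  ring

theorem bits_le_of_le {x : ℤ} (hx : 0 ≤ x) (hxW : x ≤ W) (hW : bits W ≤ β) : bits x ≤ β := by
  rw [bits_le_iff] at *
  rw [abs_of_nonneg hx]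
  exact (hxW.trans (le_abs_self W)).trans_lt hW

theorem pow_ediv_self (hB : 0 < B) (l : ℕ) : B ^ (l + 1) / B = B ^ l := by
  rw [pow_succ, Int.mul_ediv_cancel _ hB.ne']

/-- The memories during a walk from `a`, where `x` is the state of the simulated walk, `l` the
number of remaining steps, and `m₀` the integer memory before the walk. The field `room`
guarantees that the code does not outgrow `W`. -/
structure WalkInvariant {n : ℕ} (L β : ℕ) (B W : ℤ) (m₀ : ℕ → ℤ) (a : Fin n) (l : ℕ)
    (x : Fin n × (ℕ → ℕ)) (m : ℕ → ℤ) (v : ℕ → Option (Fin n)) : Prop where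
  length_le : l ≤ L
  frame : ∀ i, i ≠ cPosition → i ≠ cCode → i ≠ cTmp → m i = m₀ i
  position : m cPosition = B ^ l / B
  code : m cCode = encode L B x.2
  bounded : BitBounded β m
  room : encode L B x.2 + l * B ^ L ≤ W
  start : v 0 = some a
  current : v 1 = some x.1

theorem WalkInvariant.record {n : ℕ} {a : Fin n} {l : ℕ} {x : Fin n × (ℕ → ℕ)} {m : ℕ → ℤ}
    {v : ℕ → Option (Fin n)} (hB : 1 < B) (hbase : m₀ cBase = B) (hW : bits W ≤ β)
    (h : WalkInvariant L β B W m₀ a (l + 1) x m v) (c : Fin n) :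
    WalkInvariant L β B W m₀ a l
      (c, if a = x.1 then Function.update x.2 l (x.2 l + 1) else x.2)
      (memEval recordReturn (Function.update m cTmp (if a = x.1 then 1 else 0)))
      (Function.update v 1 (some c)) := by
  have hB0 : 0 < B := by linarith
  have hl := h.length_le
  have hpos : m cPosition = B ^ l := h.position.trans (pow_ediv_self hB0 l)
  have hbase' : m cBase = B := (h.frame _ (by decide) (by decide) (by decide)).trans hbase
  have pow_le : B ^ l ≤ B ^ L := pow_le_pow_right₀ hB.le (by omega)
  have code_nonneg := encode_nonneg (L := L) hB0.le x.2
  have top_nonneg : 0 ≤ (l : ℤ) * B ^ L := by positivity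
  have room := h.room
  push_cast at room
  set δ : ℤ := if a = x.1 then 1 else 0 with hδ
  have hcode : encode L B (if a = x.1 then Function.update x.2 l (x.2 l + 1) else x.2)
      = encode L B x.2 + δ * B ^ l := by
    split_ifs with hx <;> simp [hδ, hx, encode_update (show l ≤ L by omega)]
  have hδ0 : 0 ≤ δ ∧ δ ≤ 1 := by rw [hδ]; split_ifs <;> simp
  have δ_nonneg : 0 ≤ δ * B ^ l := mul_nonneg hδ0.1 (by positivity)
  have δ_le : δ * B ^ l ≤ B ^ L := by nlinarith [pow_pos hB0 l]
  have hmem : memEval recordReturn (Function.update m cTmp δ) =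
      Function.update (Function.update (Function.update m cTmp (δ * B ^ l)) cCode
        (encode L B x.2 + δ * B ^ l)) cPosition (B ^ l / B) := by
    simp [recordReturn, memEval, resolve, Op.eval, hpos, hbase', h.code]
  rw [hmem]
  refine ⟨by omega, fun i hi hi' hi'' => ?_, by simp, by simp [hcode], ?_, ?_, by simp [h.start],
    by simp⟩
  · rw [Function.update_of_ne hi, Function.update_of_ne hi', Function.update_of_ne hi'',
      h.frame i hi hi' hi'']
  · have quotient_le : B ^ l / B ≤ B ^ l := Int.ediv_le_self _ (by positivity)
    refine ((h.bounded.update _ (bits_le_of_le δ_nonneg ?_ hW)).update _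
      (bits_le_of_le (by positivity) ?_ hW)).update _
      (bits_le_of_le (Int.ediv_nonneg (by positivity) hB0.le) ?_ hW) <;> linarith
  · rw [hcode]; linarith

/-- The memories before a phase of `t` walks, with return counts `M` so far, where `m₀` is the
integer memory before the first walk. -/
structure SampleInvariant (L β : ℕ) (B W : ℤ) (m₀ : ℕ → ℤ) (t : ℕ) (M : ℕ → ℕ) (m : ℕ → ℤ) :
    Prop where
  frame : ∀ i, i ≠ cWalksLeft → i ≠ cPosition → i ≠ cCode → i ≠ cTmp → m i = m₀ i
  walksLeft : m cWalksLeft = t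
  code : m cCode = encode L B M
  bounded : BitBounded β m
  room : encode L B M + t * (L * B ^ L) ≤ W

theorem SampleInvariant.startWalk {n t : ℕ} {M : ℕ → ℕ} {m : ℕ → ℤ}
    (htop : m₀ cTop = B ^ L / B) (h : SampleInvariant L β B W m₀ (t + 1) M m) (a b : Fin n)
    {v : ℕ → Option (Fin n)} (ha : v 0 = some a) (hb : v 1 = some b) :
    WalkInvariant L β B (W - t * (L * B ^ L)) m a L (b, M) (memEval (cPosition ≔ cTop) m) v := by
  have htop' : m cTop = B ^ L / B :=
    (h.frame _ (by decide) (by decide) (by decide) (by decide)).trans htop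
  have hmem : memEval (cPosition ≔ cTop) m = Function.update m cPosition (B ^ L / B) := by
    simp [memEval, resolve, htop']
  have room := h.room
  push_cast at room
  rw [hmem]
  refine ⟨le_rfl, fun i hi _ _ => by rw [Function.update_of_ne hi], by simp, by simp [h.code],
    h.bounded.update _ (htop' ▸ h.bounded cTop), ?_, ha, hb⟩
  linarith

theorem SampleInvariant.endWalk {n t : ℕ} {M : ℕ → ℕ} {m m' : ℕ → ℤ} {a : Fin n}
    {x : Fin n × (ℕ → ℕ)} {v : ℕ → Option (Fin n)} (hone : m₀ cOne = 1)
    (h : SampleInvariant L β B W m₀ (t + 1) M m)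
    (h' : WalkInvariant L β B (W - t * (L * B ^ L)) m a 0 x m' v) :
    SampleInvariant L β B W m₀ t x.2 (memEval (cWalksLeft ≔ cWalksLeft ⊟ cOne) m') := by
  have hone' : m' cOne = 1 := by
    rw [h'.frame _ (by decide) (by decide) (by decide),
      h.frame _ (by decide) (by decide) (by decide) (by decide), hone]
  have hleft : m' cWalksLeft = t + 1 := by
    rw [h'.frame _ (by decide) (by decide) (by decide), h.walksLeft]; push_cast; rfl
  have hmem : memEval (cWalksLeft ≔ cWalksLeft ⊟ cOne) m' =
      Function.update m' cWalksLeft (t : ℤ) := by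
    simp [memEval, resolve, Op.eval, hone', hleft]
  rw [hmem]
  refine ⟨fun i hi hi' hi'' hi''' => ?_, by simp, by simp [h'.code],
    h'.bounded.update _ (bits_le_of_le (by positivity) ?_ (h'.bounded cWalksLeft)), ?_⟩
  · rw [Function.update_of_ne hi, h'.frame i hi' hi'' hi''', h.frame i hi hi' hi'' hi''']
  · rw [hleft]; linarith
  · have room := h'.room
    push_cast at room
    linarith

/-- Running time of `walkLoop`. -/
def walkLoopCost (L β : ℕ) : ℕ :=
  (L + 1) * (4 + (straightCost recordReturn * (1 + β) ^ 2 + 3) + 2 + β)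

variable {n : ℕ} [NeZero n] {col : Fin n → PMF (Fin n)}

theorem simulates_walkLoop {a : Fin n} {x : Fin n × (ℕ → ℕ)} {m : ℕ → ℤ}
    {v : ℕ → Option (Fin n)} (hB : 1 < B) (hbase : m₀ cBase = B) (hW : bits W ≤ β)
    (h : WalkInvariant L β B W m₀ a L x m v) :
    Simulates col (walkLoopCost L β) walkLoop m v (iterate (walkStep col a) L x)
      (WalkInvariant L β B W m₀ a 0) := by
  refine Simulates.loop (fun i x m v h => h.bounded _) (fun l x m v h => ⟨?_, ?_⟩)
    (fun x m v h => ?_) h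
  · rw [h.position, pow_ediv_self (by linarith)]
    positivity
  · have test := Simulates.test (col := col) cTmp 0 1 (m := m) (v := v)
    rw [h.start, h.current] at test
    simp only [Option.some.injEq] at test
    have indicator_bits : bits (if a = x.1 then 1 else 0) ≤ β := by
      have one_le_pow : 1 ≤ B ^ L := one_le_pow₀ hB.le
      have code_nonneg := encode_nonneg (L := L) (B := B) (by linarith) x.2
      have room := h.room
      push_cast at room
      refine bits_le_of_le (by split_ifs <;> simp) ?_ hW
      split_ifs <;> nlinarith
    rw [walkStep, ← PMF.pure_bind () fun _ => PMF.map _ _]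
    refine test.seq fun _ m' v' ⟨hm', hv'⟩ => ?_
    subst hm' hv'
    refine (Computes.straight (by simp [recordReturn, IsStraight])
      (h.bounded.update cTmp indicator_bits)).seq_simulates fun m' hm' => ?_
    subst hm'
    exact (Simulates.sample (col := col) 1 h.current).map _ fun c m' v' ⟨hm', hv'⟩ =>
      hm' ▸ hv' ▸ h.record hB hbase hW c
  · rw [h.position, pow_zero, Int.ediv_eq_zero_of_lt zero_le_one hB]

/-- Running time of `sampleLoop`. -/
def sampleLoopCost (L t β : ℕ) : ℕ :=
  (t + 1) * (2 + (3 + (4 * (1 + β) ^ 2 + (walkLoopCost L β + 4 * (1 + β) ^ 2))) + 2 + β)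

theorem simulates_sampleLoop {t : ℕ} {M : ℕ → ℕ} {m : ℕ → ℤ} {v : ℕ → Option (Fin n)}
    (hB : 1 < B) (hbase : m₀ cBase = B) (hone : m₀ cOne = 1) (htop : m₀ cTop = B ^ L / B)
    (hW : bits W ≤ β) (h : SampleInvariant L β B W m₀ t M m) :
    Simulates col (sampleLoopCost L t β) sampleLoop m v (walks col L t M)
      (fun M' m' _ => SampleInvariant L β B W m₀ 0 M' m') := by
  refine Simulates.loop (I := fun t M m _ => SampleInvariant L β B W m₀ t M m)
    (fun t M m _ h => h.bounded _) (fun t M m v h => ⟨by rw [h.walksLeft]; positivity, ?_⟩)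
    (fun M m _ h => by simp [h.walksLeft]) h
  refine (Simulates.unif 0).seq fun a m₁ v₁ ⟨hm₁, hv₁⟩ => ?_
  have ha : v₁ 0 = some a := by simp [hv₁]
  refine (Simulates.sample 1 ha).seq fun b m₂ v₂ ⟨hm₂, hv₂⟩ => ?_
  obtain rfl : m₂ = m := hm₂.trans hm₁
  have hroom : bits (W - t * (L * B ^ L)) ≤ β := by
    have code_nonneg := encode_nonneg (L := L) (B := B) (by linarith) M
    have walk_nonneg : 0 ≤ (L : ℤ) * B ^ L := by positivity
    have room := h.room
    push_cast at room
    exact bits_le_of_le (by linarith) (by nlinarith) hW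
  refine (Computes.straight (p := cPosition ≔ cTop) trivial h.bounded).seq_simulates ?_
  rintro _ rfl
  refine Simulates.map (R := fun x m' _ => SampleInvariant L β B W m₀ t x.2 m') ?_ Prod.snd
    fun _ _ _ h => h
  refine (simulates_walkLoop hB ((h.frame _ (by decide) (by decide) (by decide)
    (by decide)).trans hbase) hroom (h.startWalk htop a b ?_ ?_)).seq_computes
    fun x m' v' h' => (Computes.straight (p := cWalksLeft ≔ cWalksLeft ⊟ cOne) trivial
      h'.bounded).mono le_rfl ?_
  · simp [hv₂, ha]
  · simp [hv₂]
  · rintro _ rfl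
    exact h.endWalk hone h'

end

/-! ### Return counts of random walks -/

/-- Expectation of a non-negative function. -/
def expectation {α : Type*} (p : PMF α) (f : α → ℝ≥0∞) : ℝ≥0∞ := ∑' x, p x * f x

section

variable {α β : Type*}

theorem expectation_pure (a : α) (f : α → ℝ≥0∞) : expectation (PMF.pure a) f = f a := by
  rw [expectation, tsum_eq_single a fun b hb => by rw [PMF.pure_apply_of_ne a b hb, zero_mul]]
  simp

theorem expectation_bind (p : PMF α) (q : α → PMF β) (f : β → ℝ≥0∞) :
    expectation (p.bind q) f = expectation p fun a => expectation (q a) f := by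
  simp_rw [expectation, PMF.bind_apply, ← ENNReal.tsum_mul_right, ← ENNReal.tsum_mul_left]
  rw [ENNReal.tsum_comm]
  simp_rw [mul_assoc]

theorem expectation_map (p : PMF α) (g : α → β) (f : β → ℝ≥0∞) :
    expectation (p.map g) f = expectation p (f ∘ g) := by
  simp [PMF.map, expectation_bind, expectation_pure, Function.comp_def]

theorem toOuterMeasure_le_expectation (p : PMF α) {s : Set α} {f : α → ℝ≥0∞}
    (hf : ∀ x ∈ s, 1 ≤ f x) : p.toOuterMeasure s ≤ expectation p f := by
  rw [PMF.toOuterMeasure_apply]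
  exact ENNReal.tsum_le_tsum fun x =>
    Set.indicator_le (fun x hx => le_mul_of_one_le_right' (hf x hx)) x

end

theorem map_iterate {α β : Type} {K : ℕ → α → PMF α} {K' : ℕ → β → PMF β} {f : α → β}
    (h : ∀ i x, (K i x).map f = K' i (f x)) (i : ℕ) (x : α) :
    (iterate K i x).map f = iterate K' i (f x) := by
  induction i generalizing x with
  | zero => rw [iterate, iterate, PMF.pure_map]
  | succ i ih =>
    rw [iterate, iterate, PMF.map_bind, ← h, PMF.bind_map]
    simp only [ih, Function.comp_def]

/-- One step of the random walk on `ℕ` whose increments are `0` and `1`, and are `1` with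
probability `p true`. -/
def bernoulliStep (p : PMF Bool) (x : ℕ) : PMF ℕ := p.map fun b => x + b.toNat

theorem expectation_bernoulliStep (p : PMF Bool) {q : ℝ} (hq : p true = ENNReal.ofReal q)
    (hq₀ : 0 ≤ q) (x : ℕ) {f : ℕ → ℝ} (hf : ∀ x, 0 ≤ f x) :
    expectation (bernoulliStep p x) (fun y => ENNReal.ofReal (f y)) =
      ENNReal.ofReal (q * f (x + 1) + (1 - q) * f x) := by
  have hsum : p true + p false = 1 := by rw [← PMF.tsum_coe p, tsum_bool, add_comm]
  have hq₁ : q ≤ 1 := by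
    rw [← ENNReal.ofReal_le_one, ← hq]
    exact PMF.coe_le_one p true
  have hfalse : p false = ENNReal.ofReal (1 - q) := by
    rw [ENNReal.ofReal_sub _ hq₀, ENNReal.ofReal_one, ← hsum, hq,
      ENNReal.add_sub_cancel_left ENNReal.ofReal_ne_top]
  have hq' : 0 ≤ 1 - q := by linarith
  rw [bernoulliStep, expectation_map, expectation, tsum_bool, hfalse, hq, add_comm,
    ENNReal.ofReal_add (mul_nonneg hq₀ (hf _)) (mul_nonneg hq' (hf _)), ENNReal.ofReal_mul hq₀,
    ENNReal.ofReal_mul hq']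
  rfl

theorem expectation_iterate_bernoulliStep (p : PMF Bool) {q : ℝ}
    (hq : p true = ENNReal.ofReal q) (hq₀ : 0 ≤ q) (c : ℝ) (t x : ℕ) :
    expectation (iterate (fun _ => bernoulliStep p) t x)
        (fun y => ENNReal.ofReal ((y - c) ^ 2)) =
      ENNReal.ofReal ((x + t * q - c) ^ 2 + t * (q * (1 - q))) := by
  have hq₁ : q ≤ 1 := by
    rw [← ENNReal.ofReal_le_one, ← hq]
    exact PMF.coe_le_one p true
  have : 0 ≤ q * (1 - q) := mul_nonneg hq₀ (by linarith)
  induction t generalizing x with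
  | zero => simp [iterate, expectation_pure]
  | succ t ih =>
    simp only [iterate, expectation_bind, ih]
    rw [expectation_bernoulliStep p hq hq₀ x
      (f := fun y => (y + t * q - c) ^ 2 + t * (q * (1 - q))) fun y => by positivity]
    push_cast
    ring_nf

/-- Chebyshev's inequality for a binomial distribution. -/
theorem toOuterMeasure_iterate_bernoulliStep_le (p : PMF Bool) {q : ℝ}
    (hq : p true = ENNReal.ofReal q) (hq₀ : 0 ≤ q) (t x : ℕ) {s : ℝ} (hs : 0 < s) :
    (iterate (fun _ => bernoulliStep p) t x).toOuterMeasure {y | s < |(y : ℝ) - (x + t * q)|} ≤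
      ENNReal.ofReal (t / (4 * s ^ 2)) := by
  have one_le : ∀ y ∈ {y : ℕ | s < |(y : ℝ) - (x + t * q)|},
      1 ≤ ENNReal.ofReal ((s ^ 2)⁻¹) * ENNReal.ofReal ((y - (x + t * q)) ^ 2) := fun y hy => by
    rw [← ENNReal.ofReal_mul (by positivity), ENNReal.one_le_ofReal, ← div_eq_inv_mul,
      one_le_div (by positivity), sq_le_sq, abs_of_pos hs]
    exact hy.le
  refine (toOuterMeasure_le_expectation _ one_le).trans ?_
  have : q * (1 - q) ≤ 1 / 4 := by nlinarith [sq_nonneg (q - 1 / 2)]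
  calc expectation (iterate (fun _ => bernoulliStep p) t x)
        (fun y => ENNReal.ofReal ((s ^ 2)⁻¹) * ENNReal.ofReal ((y - (x + t * q)) ^ 2))
      = ENNReal.ofReal ((s ^ 2)⁻¹) * ENNReal.ofReal (t * (q * (1 - q))) := by
        simp_rw [expectation, mul_left_comm _ (ENNReal.ofReal (s ^ 2)⁻¹), ENNReal.tsum_mul_left]
        rw [← expectation, expectation_iterate_bernoulliStep p hq hq₀, sub_self]
        simp
    _ ≤ ENNReal.ofReal ((s ^ 2)⁻¹) * ENNReal.ofReal (t * (1 / 4)) := by gcongr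
    _ = ENNReal.ofReal (t / (4 * s ^ 2)) := by
        rw [← ENNReal.ofReal_mul (by positivity)]
        congr 1
        field_simp

section

variable {n : ℕ} (col : Fin n → PMF (Fin n))

theorem map_iterate_walkStep_of_le (a : Fin n) {l j : ℕ} (hl : l ≤ j) (b : Fin n) (M : ℕ → ℕ) :
    (iterate (walkStep col a) l (b, M)).map (fun x => x.2 j) = PMF.pure (M j) := by
  induction l generalizing b M with
  | zero => rw [iterate, PMF.pure_map]
  | succ l ih =>
    have unchanged : (if a = b then Function.update M l (M l + 1) else M) j = M j := by
      split_ifs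
      · exact Function.update_of_ne (by omega) _ _
      · rfl
    simp only [iterate, walkStep, PMF.bind_map, PMF.map_bind, Function.comp_def]
    simp only [ih (Nat.le_of_succ_le hl), unchanged, PMF.bind_const]

theorem map_iterate_walkStep (a : Fin n) (j r : ℕ) (b : Fin n) (M : ℕ → ℕ) :
    (iterate (walkStep col a) (j + 1 + r) (b, M)).map (fun x => x.2 j) =
      (iterate (fun _ => col) r b).map fun c => M j + (decide (a = c)).toNat := by
  induction r generalizing b M with
  | zero =>
    simp only [iterate, walkStep, PMF.bind_map, PMF.map_bind, Function.comp_def,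
      map_iterate_walkStep_of_le col a le_rfl, PMF.bind_const, PMF.pure_map]
    split_ifs with h <;> simp [h]
  | succ r ih =>
    have unchanged : (if a = b then Function.update M (j + 1 + r) (M (j + 1 + r) + 1) else M) j =
        M j := by
      split_ifs
      · exact Function.update_of_ne (by omega) _ _
      · rfl
    rw [← add_assoc]
    simp only [iterate, walkStep, PMF.bind_map, PMF.map_bind, Function.comp_def]
    simp only [ih, unchanged]

variable [NeZero n]

/-- The distribution of the truth value of the statement that a walk of length `r` from a uniformly
random vertex ends where it started. -/
def returnLaw (r : ℕ) : PMF Bool :=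
  (PMF.uniformOfFintype (Fin n)).bind fun a => (iterate (fun _ => col) r a).map fun c =>
    decide (a = c)

theorem map_walk_of_lt {L j : ℕ} (hj : j < L) (M : ℕ → ℕ) :
    (walk col L M).map (· j) = bernoulliStep (returnLaw col (L - j)) (M j) := by
  obtain ⟨r, rfl⟩ := Nat.exists_eq_add_of_lt hj
  rw [show j + r + 1 - j = r + 1 by omega, show j + r + 1 = j + 1 + r by ring]
  simp only [walk, bernoulliStep, returnLaw, iterate, PMF.map_bind, PMF.map_comp,
    Function.comp_def, map_iterate_walkStep]

theorem map_walk_self (L : ℕ) (M : ℕ → ℕ) :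
    (walk col L M).map (· L) = bernoulliStep (PMF.pure false) (M L) := by
  simp only [walk, bernoulliStep, PMF.map_bind, PMF.map_comp, Function.comp_def,
    map_iterate_walkStep_of_le col _ le_rfl, PMF.bind_const, PMF.pure_map, Bool.toNat_false,
    add_zero]

end

section

variable {n : ℕ} {A : Matrix (Fin n) (Fin n) ℝ}

theorem iterate_column_apply (hA : A ∈ Matrix.colStochastic ℝ (Fin n)) (r : ℕ) (b c : Fin n) :
    iterate (fun _ => column A hA) r b c = ENNReal.ofReal ((A ^ r) c b) := by
  have entry_nonneg (r : ℕ) (i j : Fin n) : 0 ≤ (A ^ r) i j :=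
    Matrix.nonneg_of_mem_colStochastic (pow_mem hA r)
  induction r generalizing b with
  | zero => simp [iterate, PMF.pure_apply, Matrix.one_apply, apply_ite ENNReal.ofReal]
  | succ r ih =>
    have nonneg (d : Fin n) : 0 ≤ (A ^ r) c d * A d b :=
      mul_nonneg (entry_nonneg r c d) (by simpa using entry_nonneg 1 d b)
    rw [iterate, PMF.bind_apply, tsum_fintype, pow_succ, Matrix.mul_apply,
      ENNReal.ofReal_sum_of_nonneg fun d _ => nonneg d]
    refine Finset.sum_congr rfl fun d _ => ?_
    rw [ih, ENNReal.ofReal_mul (entry_nonneg r c d), mul_comm]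
    rfl

theorem trace_pow_nonneg (hA : A ∈ Matrix.colStochastic ℝ (Fin n)) (r : ℕ) :
    0 ≤ (A ^ r).trace / n :=
  div_nonneg (Finset.sum_nonneg fun _ _ => Matrix.nonneg_of_mem_colStochastic (pow_mem hA r))
    n.cast_nonneg

theorem trace_pow_of_eq_conj {Q : Matrix (Fin n) (Fin n) ℝ} {t : Fin n → ℝ} (hQ : IsUnit Q)
    (h : A = Q * Matrix.diagonal t * Q⁻¹) (j : ℕ) : (A ^ j).trace = ∑ l, t l ^ j := by
  obtain ⟨U, rfl⟩ := hQ
  rw [h, ← Matrix.coe_units_inv, Units.conj_pow, Matrix.trace_mul_comm, ← Matrix.mul_assoc,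
    Units.inv_mul, Matrix.one_mul, Matrix.diagonal_pow, Matrix.trace_diagonal]
  rfl

variable [NeZero n]

theorem returnLaw_column_true (hA : A ∈ Matrix.colStochastic ℝ (Fin n)) (r : ℕ) :
    returnLaw (column A hA) r true = ENNReal.ofReal ((A ^ r).trace / n) := by
  have returns (a : Fin n) :
      ((iterate (fun _ => column A hA) r a).map fun c => decide (a = c)) true =
        ENNReal.ofReal ((A ^ r) a a) := by
    rw [PMF.map_apply]
    exact (tsum_eq_single a fun c hc => by simp [hc.symm]).trans (by simp [iterate_column_apply])
  have hn : (0 : ℝ) < n := by exact_mod_cast NeZero.pos n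
  simp only [returnLaw, PMF.bind_apply, returns, tsum_fintype, PMF.uniformOfFintype_apply,
    Fintype.card_fin]
  rw [← Finset.mul_sum, ← ENNReal.ofReal_sum_of_nonneg fun a _ =>
    Matrix.nonneg_of_mem_colStochastic (pow_mem hA r), ENNReal.ofReal_div_of_pos hn,
    ENNReal.ofReal_natCast, ENNReal.div_eq_inv_mul]
  rfl

/-- The frequency of returns after `j` steps concentrates around the normalized trace of `A ^ j`.
For `j = 0` it is the initial value `t` of the count that makes the statement true. -/
theorem toOuterMeasure_walks_le (hA : A ∈ Matrix.colStochastic ℝ (Fin n)) {L j : ℕ} (hj : j ≤ L)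
    (t : ℕ) {s : ℝ} (hs : 0 < s) :
    (walks (column A hA) L t (Pi.single L t)).toOuterMeasure
        {M | s < |(M (L - j) : ℝ) - t * ((A ^ j).trace / n)|} ≤
      ENNReal.ofReal (t / (4 * s ^ 2)) := by
  have marginal (p : PMF Bool)
      (h : ∀ M, (walk (column A hA) L M).map (· (L - j)) = bernoulliStep p (M (L - j))) {q : ℝ}
      (hq : p true = ENNReal.ofReal q) (hq₀ : 0 ≤ q)
      (center : t * ((A ^ j).trace / n) = (Pi.single L t : ℕ → ℕ) (L - j) + t * q) :
      (walks (column A hA) L t (Pi.single L t)).toOuterMeasure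
        {M | s < |(M (L - j) : ℝ) - t * ((A ^ j).trace / n)|} ≤
        ENNReal.ofReal (t / (4 * s ^ 2)) := by
    have := toOuterMeasure_iterate_bernoulliStep_le p hq hq₀ t ((Pi.single L t : ℕ → ℕ) (L - j)) hs
    rwa [← map_iterate (f := fun M : ℕ → ℕ => M (L - j)) fun _ => h, ← center,
      PMF.toOuterMeasure_map_apply] at this
  rcases Nat.eq_zero_or_pos j with rfl | hj₀
  · have hn : (n : ℝ) ≠ 0 := NeZero.ne _
    refine marginal (PMF.pure false) (map_walk_self _ _) (q := 0) (by simp) le_rfl ?_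
    simp [hn]
  · refine marginal (returnLaw (column A hA) j) (fun M => ?_) (returnLaw_column_true hA j)
      (trace_pow_nonneg hA j) ?_
    · rw [map_walk_of_lt _ (by omega), Nat.sub_sub_self hj]
    · rw [Pi.single_eq_of_ne (by omega), Nat.cast_zero, zero_add]

theorem toOuterMeasure_not_approxMoments_le (hA : A ∈ Matrix.colStochastic ℝ (Fin n))
    {Q : Matrix (Fin n) (Fin n) ℝ} {t : Fin n → ℝ} (hQ : IsUnit Q)
    (h : A = Q * Matrix.diagonal t * Q⁻¹) (m : ℕ) :
    (walks (column A hA) (8 * m) (gridSize m ^ 3)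
      (Pi.single (8 * m) (gridSize m ^ 3))).toOuterMeasure
        {M | ¬ ApproxMoments m t fun j => M (8 * m - j)} ≤ 1 / 3 := by
  set D := walks (column A hA) (8 * m) (gridSize m ^ 3) (Pi.single (8 * m) (gridSize m ^ 3))
  have G_pos : (0 : ℝ) < gridSize m := by exact_mod_cast gridSize_pos m
  let deviates (j : ℕ) : Set (ℕ → ℕ) := {M | (gridSize m : ℝ) ^ 2 <
    |(M (8 * m - j) : ℝ) - (gridSize m ^ 3 : ℕ) * ((A ^ j).trace / n)|}
  have union : {M : ℕ → ℕ | ¬ ApproxMoments m t fun j => M (8 * m - j)} ⊆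
      ⋃ j ∈ Finset.range (8 * m + 1), deviates j := fun M hM => by
    simpa [ApproxMoments, deviates, trace_pow_of_eq_conj hQ h, Nat.lt_succ_iff] using hM
  calc D.toOuterMeasure {M | ¬ ApproxMoments m t fun j => M (8 * m - j)}
      ≤ D.toOuterMeasure (⋃ j ∈ Finset.range (8 * m + 1), deviates j) := measure_mono union
    _ ≤ ∑ j ∈ Finset.range (8 * m + 1), D.toOuterMeasure (deviates j) :=
        measure_biUnion_finset_le _ _
    _ ≤ ∑ _j ∈ Finset.range (8 * m + 1), ENNReal.ofReal (1 / (4 * gridSize m)) := by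
        refine Finset.sum_le_sum fun j hj => (toOuterMeasure_walks_le hA
          (Nat.lt_succ_iff.mp (Finset.mem_range.mp hj)) _ (by positivity)).trans_eq ?_
        congr 1
        push_cast
        field_simp
    _ = ENNReal.ofReal ((8 * m + 1 : ℕ) * (1 / (4 * gridSize m))) := by
        rw [Finset.sum_const, Finset.card_range, nsmul_eq_mul, ENNReal.ofReal_mul (by positivity),
          ENNReal.ofReal_natCast]
    _ ≤ ENNReal.ofReal (1 / 3) := by
        refine ENNReal.ofReal_le_ofReal ?_
        rw [mul_one_div, div_le_div_iff₀ (by positivity) (by norm_num)]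
        have : ((8 * m + 1 : ℕ) : ℝ) ≤ gridSize m := by
          exact_mod_cast eight_mul_add_one_le_gridSize m
        linarith
    _ = 1 / 3 := by rw [ENNReal.ofReal_div_of_pos (by norm_num)]; simp

end

/-! ### The set-up phase -/

/-- Assign to cell `d` the power of cell `b` with exponent in `cDegree`. -/
def power (d b : ℕ) : Prog :=
  (d ≔const 1 ;; cCounter ≔ cDegree) ;;
    .loop (.dir cCounter) (d ≔ d ⊠ b ;; cCounter ≔ cCounter ⊟ cOne)

/-- The effect of `power` on the memory. -/
def powerEval (d b m : ℕ) (μ : ℕ → ℤ) : ℕ → ℤ :=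
  Function.update (Function.update μ d (μ b ^ m)) cCounter 0

/-- Store the degree parameter `m`, which is `256` times the input, and the base `2 ^ 16` of
`gridSize m`. -/
def setDegree : Prog :=
  cOne ≔const 1 ;; cDegree ≔const 256 ;; cDegree ≔ cDegree ⊠ 0 ;; cPower ≔const 65536

/-- From the grid size `G`, compute the number `G ^ 3` of walks, the scale `4 * G ^ 2` of the kernel
and its square, and the base `G ^ 16` of the `m`-th power in `codeBase m`. -/
def setScales : Prog :=
  cWalks ≔ cGrid ⊠ cGrid ;; cScale ≔const 4 ;; cScale ≔ cScale ⊠ cWalks ;;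
  cWalks ≔ cWalks ⊠ cGrid ;; cScaleSq ≔ cScale ⊠ cScale ;; cPower ≔ cGrid ⊠ cGrid ;;
  cPower ≔ cPower ⊠ cPower ;; cPower ≔ cPower ⊠ cPower ;; cPower ≔ cPower ⊠ cPower

/-- Compute the base `B ^ 8` of the shift `B ^ (8 * m)`, where `B` is `codeBase m`. -/
def setShiftBase : Prog :=
  cPower ≔ cBase ⊠ cBase ;; cPower ≔ cPower ⊠ cPower ;; cPower ≔ cPower ⊠ cPower

/-- Compute the base of the `m`-th power in `weightOffset m`. -/
def setOffsetBase : Prog := cPower ≔ cScaleSq ⊠ cScaleSq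

/-- Initialize the loop counters, the code of the return counts and the constants of the output
phase. -/
def setCounters : Prog :=
  cOffset ≔ cOffset ⊠ cWalks ;; cTop ≔ cShift ⊘ cBase ;; cCode ≔ cWalks ⊠ cShift ;;
  cWalksLeft ≔ cWalks ;; cGridBase ≔ cGrid ⊠ cBase ;; cCenter ≔ cGrid ⊞ cGrid ;;
  cCenter ≔ cCenter ⊞ cOne ;; cAtomsLeft ≔ cCenter ⊞ cGrid ;; cAtomsLeft ≔ cAtomsLeft ⊞ cGrid ;;
  cStart ≔const 52

/-- The set-up phase, which computes all parameters from the input in cell `0`. -/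
def setup : Prog :=
  (setDegree ;; power cGrid cPower) ;; (setScales ;; power cBase cPower) ;;
  (setShiftBase ;; power cShift cPower) ;; (setOffsetBase ;; power cOffset cPower) ;; setCounters

theorem bits_pow_le {z : ℤ} {β i m : ℕ} (hz : bits z ≤ β) (hi : i ≤ m) :
    bits (z ^ i) ≤ (m + 1) * (1 + β) := by
  rw [bits_le_iff] at *
  rw [abs_pow]
  calc |z| ^ i ≤ (2 ^ β) ^ i := by gcongr
    _ = 2 ^ (β * i) := (pow_mul _ _ _).symm
    _ < 2 ^ ((m + 1) * (1 + β)) := pow_lt_pow_right₀ (by norm_num) (by nlinarith)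

theorem bits_natCast_le_of_le {i m β : ℕ} (h : bits (m : ℤ) ≤ β) (hi : i ≤ m) :
    bits (i : ℤ) ≤ β :=
  (Nat.size_le_size hi).trans h

/-- Functions of the degree parameter that grow at most exponentially. -/
def ExpBounded (T : ℕ → ℕ) : Prop := ∃ a, ∀ m, 1 ≤ m → T m ≤ 2 ^ (a * m)

namespace ExpBounded

variable {S T : ℕ → ℕ}

theorem const (c : ℕ) : ExpBounded fun _ => c :=
  ⟨c, fun _ hm => Nat.lt_two_pow_self.le.trans <|
    Nat.pow_le_pow_right two_pos (Nat.le_mul_of_pos_right c hm)⟩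

theorem id : ExpBounded fun m => m :=
  ⟨1, fun _ _ => by simpa using Nat.lt_two_pow_self.le⟩

theorem mul (hS : ExpBounded S) (hT : ExpBounded T) : ExpBounded fun m => S m * T m := by
  obtain ⟨a, ha⟩ := hS
  obtain ⟨b, hb⟩ := hT
  exact ⟨a + b, fun m hm => by rw [add_mul, pow_add]; exact Nat.mul_le_mul (ha m hm) (hb m hm)⟩

theorem add (hS : ExpBounded S) (hT : ExpBounded T) : ExpBounded fun m => S m + T m := by
  obtain ⟨a, ha⟩ := hS
  obtain ⟨b, hb⟩ := hT
  refine ⟨1 + a + b, fun m hm => ?_⟩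
  have two_le : 2 ≤ 2 ^ m := Nat.le_self_pow (by omega) 2
  have one_le_left : 1 ≤ 2 ^ (a * m) := Nat.one_le_two_pow
  have one_le_right : 1 ≤ 2 ^ (b * m) := Nat.one_le_two_pow
  calc S m + T m ≤ 2 ^ (a * m) + 2 ^ (b * m) := add_le_add (ha m hm) (hb m hm)
    _ ≤ 2 * (2 ^ (a * m) * 2 ^ (b * m)) := by nlinarith
    _ ≤ 2 ^ m * (2 ^ (a * m) * 2 ^ (b * m)) := by gcongr
    _ = 2 ^ ((1 + a + b) * m) := by rw [add_mul, add_mul, pow_add, pow_add, one_mul, mul_assoc]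

theorem pow (hT : ExpBounded T) (i : ℕ) : ExpBounded fun m => T m ^ i := by
  induction i with
  | zero => simpa only [pow_zero] using const 1
  | succ i ih => simpa only [pow_succ] using ih.mul hT

end ExpBounded

theorem expBounded_gridSize : ExpBounded gridSize :=
  ⟨16, fun m _ => by rw [gridSize, pow_mul]; norm_num⟩

/-- Running time of `power`. -/
def powerCost (m β : ℕ) : ℕ :=
  straightCost (0 ≔const 1 ;; cCounter ≔ cDegree) * (1 + β) ^ 2 +
    (m + 1) * (straightCost (0 ≔ 0 ⊠ 1 ;; cCounter ≔ cCounter ⊟ cOne) *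
      (1 + (m + 1) * (1 + β)) ^ 2 + 2 + (m + 1) * (1 + β))

/-- Bound for the bit lengths after straight-line code `p` with `c = straightCost p` and a
subsequent call of `power`. -/
def straightPowerBits (c m β : ℕ) : ℕ := (m + 1) * (1 + c * (1 + β))

/-- Running time of straight-line code `p` with `c = straightCost p` and a subsequent call of
`power`. -/
def straightPowerCost (c m β : ℕ) : ℕ := c * (1 + β) ^ 2 + powerCost m (c * (1 + β))

section

variable {n : ℕ} [NeZero n] {col : Fin n → PMF (Fin n)} {m d b β : ℕ} {μ : ℕ → ℤ}

theorem BitBounded.powerEval (hμ : BitBounded β μ) :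
    BitBounded ((m + 1) * (1 + β)) (powerEval d b m μ) :=
  ((hμ.mono (by nlinarith)).update _ (bits_pow_le (hμ b) le_rfl)).update _ (Nat.zero_le _)

theorem computes_power (hd : d ∉ [cOne, cDegree, cCounter]) (hb : b ∉ [d, cCounter])
    (hone : μ cOne = 1) (hm : μ cDegree = m) (hμ : BitBounded β μ) :
    Computes col (powerCost m β) (power d b) μ (· = powerEval d b m μ) := by
  simp only [List.mem_cons, List.not_mem_nil, or_false, not_or] at hd hb
  let state (i : ℕ) : ℕ → ℤ := Function.update (Function.update μ d (μ b ^ (m - i))) cCounter i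
  have state_bits {i : ℕ} (hi : i ≤ m) : BitBounded ((m + 1) * (1 + β)) (state i) :=
    ((hμ.mono (by nlinarith)).update _ (bits_pow_le (hμ b) (by omega))).update _
      ((bits_natCast_le_of_le (hm ▸ hμ cDegree) hi).trans (by nlinarith))
  have enter : memEval (d ≔const 1 ;; cCounter ≔ cDegree) μ = state m := by
    funext j
    simp [state, memEval, resolve, hm, Function.update_of_ne (Ne.symm hd.2.1)]
  have step {i : ℕ} (hi : i + 1 ≤ m) :
      memEval (d ≔ d ⊠ b ;; cCounter ≔ cCounter ⊟ cOne) (state (i + 1)) = state i := by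
    have hexp : m - i = m - (i + 1) + 1 := by omega
    funext j
    rcases eq_or_ne j cCounter with rfl | hj
    · simp [state, memEval, resolve, Op.eval, hone, Ne.symm hd.1, Ne.symm hd.2.2]
    rcases eq_or_ne j d with rfl | hjd
    · simp [state, memEval, resolve, Op.eval, hj, hb.1, hb.2, hexp, pow_succ]
    · simp [state, memEval, resolve, hj, hjd]
  refine (Computes.straight (p := d ≔const 1 ;; cCounter ≔ cDegree) ⟨trivial, trivial⟩ hμ).seq ?_
  rintro _ rfl
  refine (Computes.loop (I := fun i μ' => i ≤ m ∧ μ' = state i)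
    (β := (m + 1) * (1 + β)) ?_ ?_ ?_ (N := m) ⟨le_rfl, enter⟩).mono le_rfl ?_
  · rintro i _ ⟨hi, rfl⟩
    exact state_bits hi _
  · rintro i _ ⟨hi, rfl⟩
    refine ⟨by simp only [state, Function.update_self]; positivity,
      (Computes.straight (p := d ≔ d ⊠ b ;; cCounter ≔ cCounter ⊟ cOne) ⟨trivial, trivial⟩
        (state_bits hi)).mono le_rfl ?_⟩
    rintro _ rfl
    exact ⟨by omega, step hi⟩
  · rintro _ ⟨-, rfl⟩
    simp [state]
  · rintro _ ⟨-, rfl⟩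
    simp [state, powerEval]

theorem computes_straight_power {p : Prog} (hμ : BitBounded β μ) (hp : IsStraight p)
    (hd : d ∉ [cOne, cDegree, cCounter]) (hb : b ∉ [d, cCounter]) (hone : memEval p μ cOne = 1)
    (hm : memEval p μ cDegree = m) :
    Computes col (straightPowerCost (straightCost p) m β) (p ;; power d b) μ fun μ' =>
      μ' = powerEval d b m (memEval p μ) ∧
        BitBounded (straightPowerBits (straightCost p) m β) μ' := by
  refine (Computes.straight hp hμ).seq ?_
  rintro _ rfl
  refine (computes_power hd hb hone hm (hμ.memEval hp)).mono le_rfl ?_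
  rintro _ rfl
  exact ⟨rfl, (hμ.memEval hp).powerEval⟩

/-- The grid and the numbers that depend on it are in their cells, and the odd cells below the first
atom are empty. -/
structure GridReady (m : ℕ) (μ : ℕ → ℤ) : Prop where
  one : μ cOne = 1
  degree : μ cDegree = m
  grid : μ cGrid = gridSize m
  walks : μ cWalks = (gridSize m : ℤ) ^ 3
  scale : μ cScale = 4 * (gridSize m : ℤ) ^ 2
  scaleSq : μ cScaleSq = (4 * (gridSize m : ℤ) ^ 2) ^ 2
  base : μ cBase = codeBase m
  odd : ∀ i < 54, i % 2 = 1 → μ i = 0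

/-- All parameters of the later phases are in their cells. -/
structure ParamsReady (m : ℕ) (μ : ℕ → ℤ) : Prop extends GridReady m μ where
  shift : μ cShift = codeBase m ^ (8 * m)
  top : μ cTop = codeBase m ^ (8 * m) / codeBase m
  center : μ cCenter = 2 * gridSize m + 1
  gridBase : μ cGridBase = gridSize m * codeBase m
  offset : μ cOffset = weightOffset m
  start : μ cStart = 52

/-- The memory after the set-up phase. -/
structure SetupDone (m β : ℕ) (μ : ℕ → ℤ) : Prop extends ParamsReady m μ where
  walksLeft : μ cWalksLeft = ((gridSize m ^ 3 : ℕ) : ℤ)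
  code : μ cCode = (gridSize m : ℤ) ^ 3 * codeBase m ^ (8 * m)
  atomsLeft : μ cAtomsLeft = ((4 * gridSize m + 1 : ℕ) : ℤ)
  bounded : BitBounded β μ

theorem ExpBounded.straightPowerBits {β : ℕ → ℕ} (hβ : ExpBounded β) (c : ℕ) :
    ExpBounded fun m => straightPowerBits c m (β m) :=
  (id.add (const 1)).mul ((const 1).add ((const c).mul ((const 1).add hβ)))

theorem ExpBounded.powerCost {β : ℕ → ℕ} (hβ : ExpBounded β) :
    ExpBounded fun m => powerCost m (β m) := by
  have bits_bound : ExpBounded fun m => (m + 1) * (1 + β m) :=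
    (id.add (const 1)).mul ((const 1).add hβ)
  exact ((const _).mul (((const 1).add hβ).pow 2)).add ((id.add (const 1)).mul
    ((((const _).mul (((const 1).add bits_bound).pow 2)).add (const 2)).add bits_bound))

theorem ExpBounded.straightPowerCost {β : ℕ → ℕ} (hβ : ExpBounded β) (c : ℕ) :
    ExpBounded fun m => straightPowerCost c m (β m) :=
  ((const c).mul (((const 1).add hβ).pow 2)).add ((const c).mul ((const 1).add hβ)).powerCost

/-- Straight-line code that writes only to cells in `S`, and addresses them directly. -/
def WritesOnly (S : Set ℕ) : Prog → Prop
  | .const (.dir d) _ => d ∈ S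
  | .copy (.dir d) _ => d ∈ S
  | .arith _ (.dir d) _ _ => d ∈ S
  | .seq p q => WritesOnly S p ∧ WritesOnly S q
  | _ => False

theorem WritesOnly.memEval_eq {S : Set ℕ} {p : Prog} (hp : WritesOnly S p) {i : ℕ} (hi : i ∉ S)
    (μ : ℕ → ℤ) : memEval p μ i = μ i := by
  have update_eq {μ : ℕ → ℤ} {d : ℕ} {z : ℤ} (hd : d ∈ S) : Function.update μ d z i = μ i :=
    Function.update_of_ne (ne_of_mem_of_not_mem hd hi).symm _ _
  induction p generalizing μ with
  | const d z => cases d with | dir d => exact update_eq hp | ind d => exact hp.elim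
  | copy d a => cases d with | dir d => exact update_eq hp | ind d => exact hp.elim
  | arith o d a b => cases d with | dir d => exact update_eq hp | ind d => exact hp.elim
  | seq p q ihp ihq => exact (ihq hp.2 _).trans (ihp hp.1 μ)
  | _ => exact hp.elim

theorem powerEval_odd {i : ℕ} (hd : d % 2 = 0) (hi : i % 2 = 1) : powerEval d b m μ i = μ i := by
  rw [powerEval, Function.update_of_ne (by omega), Function.update_of_ne (by omega)]

theorem gridReady_powerEval (hone : μ cOne = 1) (hdegree : μ cDegree = m)
    (hgrid : μ cGrid = gridSize m) (hodd : ∀ i < 54, i % 2 = 1 → μ i = 0) :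
    GridReady m (powerEval cBase cPower m (memEval setScales μ)) where
  one := hone
  degree := hdegree
  grid := hgrid
  walks := by change μ cGrid * μ cGrid * μ cGrid = _; rw [hgrid]; ring
  scale := by change 4 * (μ cGrid * μ cGrid) = _; rw [hgrid]; ring
  scaleSq := by
    change 4 * (μ cGrid * μ cGrid) * (4 * (μ cGrid * μ cGrid)) = _
    rw [hgrid]
    ring
  base := by
    change (let z := μ cGrid * μ cGrid; z * z * (z * z) * (z * z * (z * z))) ^ m = _
    rw [hgrid, codeBase]
    ring
  odd i hlt hi := by
    have writes_even : WritesOnly {i | i % 2 = 0} setScales := by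
      simp [setScales, WritesOnly]
    rw [powerEval_odd rfl hi, writes_even.memEval_eq (by simp [hi]), hodd i hlt hi]

theorem GridReady.shift_eq (hμ : GridReady m μ) :
    (let z := μ cBase * μ cBase; z * z * (z * z)) ^ m = codeBase m ^ (8 * m) := by
  rw [hμ.base, pow_mul]
  ring

theorem memEval_finishSetup_odd {i : ℕ} (hi : i % 2 = 1) :
    memEval setCounters (powerEval cOffset cPower m <| memEval setOffsetBase <|
      powerEval cShift cPower m <| memEval setShiftBase μ) i = μ i := by
  have writes_even : WritesOnly {i | i % 2 = 0} setCounters ∧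
      WritesOnly {i | i % 2 = 0} setOffsetBase ∧ WritesOnly {i | i % 2 = 0} setShiftBase := by
    simp [setCounters, setOffsetBase, setShiftBase, WritesOnly]
  rw [writes_even.1.memEval_eq (by simp [hi]), powerEval_odd rfl hi,
    writes_even.2.1.memEval_eq (by simp [hi]), powerEval_odd rfl hi,
    writes_even.2.2.memEval_eq (by simp [hi])]

theorem setupDone_memEval (hμ : GridReady m μ)
    (h : BitBounded β (memEval setCounters <| powerEval cOffset cPower m <|
      memEval setOffsetBase <| powerEval cShift cPower m <| memEval setShiftBase μ)) :
    SetupDone m β (memEval setCounters <| powerEval cOffset cPower m <|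
      memEval setOffsetBase <| powerEval cShift cPower m <| memEval setShiftBase μ) where
  one := hμ.one
  degree := hμ.degree
  grid := hμ.grid
  walks := hμ.walks
  scale := hμ.scale
  scaleSq := hμ.scaleSq
  base := hμ.base
  odd i hlt hi := (memEval_finishSetup_odd hi).trans (hμ.odd i hlt hi)
  walksLeft := hμ.walks.trans (by push_cast; rfl)
  shift := hμ.shift_eq
  top := by
    change _ / μ cBase = _
    rw [hμ.base]
    exact congrArg (· / codeBase m) hμ.shift_eq
  code := by
    change μ cWalks * _ = _
    rw [hμ.walks]
    exact congrArg ((gridSize m : ℤ) ^ 3 * ·) hμ.shift_eq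
  atomsLeft := by
    change μ cGrid + μ cGrid + μ cOne + μ cGrid + μ cGrid = _
    rw [hμ.grid, hμ.one]
    push_cast
    ring
  center := by
    change μ cGrid + μ cGrid + μ cOne = _
    rw [hμ.grid, hμ.one]
    ring
  gridBase := by change μ cGrid * μ cBase = _; rw [hμ.grid, hμ.base]
  offset := by
    change (μ cScaleSq * μ cScaleSq) ^ m * μ cWalks = _
    rw [hμ.scaleSq, hμ.walks, weightOffset, pow_mul]
    ring
  start := rfl
  bounded := h

theorem computes_setDegree (k : ℕ) :
    Computes col (straightPowerCost (straightCost setDegree) (256 * k) (256 * k))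
      (setDegree ;; power cGrid cPower) (Function.update (fun _ => 0) 0 (k : ℤ)) fun μ =>
        BitBounded (straightPowerBits (straightCost setDegree) (256 * k) (256 * k)) μ ∧
          μ cOne = 1 ∧ μ cDegree = (256 * k : ℕ) ∧ μ cGrid = gridSize (256 * k) ∧
            ∀ i < 54, i % 2 = 1 → μ i = 0 := by
  have input_bounded : BitBounded (256 * k) (Function.update (fun _ => 0) 0 (k : ℤ)) :=
    BitBounded.update (fun _ => Nat.zero_le _) _ ((Nat.size_le.mpr Nat.lt_two_pow_self).trans
      (Nat.le_mul_of_pos_left k (by norm_num)))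
  have degree : (256 : ℤ) * k = (256 * k : ℕ) := by push_cast; rfl
  refine (computes_straight_power (p := setDegree) input_bounded (by simp [setDegree, IsStraight])
    (by simp) (by simp) rfl degree).mono le_rfl ?_
  rintro _ ⟨rfl, bounded⟩
  refine ⟨bounded, rfl, degree, ?_, fun i _ hi => ?_⟩
  · change (65536 : ℤ) ^ (256 * k) = _
    rw [gridSize]
    push_cast
    rfl
  · have writes_even : WritesOnly {i | i % 2 = 0} setDegree := by simp [setDegree, WritesOnly]
    rw [powerEval_odd rfl hi, writes_even.memEval_eq (by simp [hi]),
      Function.update_of_ne (by omega)]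

/-- Bound for the bit lengths after the last stages of the set-up phase. -/
def finishSetupBits (m β : ℕ) : ℕ :=
  straightCost setCounters * (1 + straightPowerBits (straightCost setOffsetBase) m
    (straightPowerBits (straightCost setShiftBase) m β))

/-- Running time of the last stages of the set-up phase. -/
def finishSetupCost (m β : ℕ) : ℕ :=
  straightPowerCost (straightCost setShiftBase) m β +
    (straightPowerCost (straightCost setOffsetBase) m
      (straightPowerBits (straightCost setShiftBase) m β) +
    straightCost setCounters * (1 + straightPowerBits (straightCost setOffsetBase) m
      (straightPowerBits (straightCost setShiftBase) m β)) ^ 2)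

theorem computes_finishSetup (hμ : GridReady m μ) (hβ : BitBounded β μ) :
    Computes col (finishSetupCost m β)
      ((setShiftBase ;; power cShift cPower) ;; (setOffsetBase ;; power cOffset cPower) ;;
        setCounters) μ (SetupDone m (finishSetupBits m β)) := by
  refine (computes_straight_power (p := setShiftBase) hβ (by simp [setShiftBase, IsStraight])
    (by simp) (by simp) hμ.one hμ.degree).seq ?_
  rintro _ ⟨rfl, hβ'⟩
  refine (computes_straight_power (p := setOffsetBase) hβ' (by simp [setOffsetBase, IsStraight])
    (by simp) (by simp) hμ.one hμ.degree).seq ?_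
  rintro _ ⟨rfl, hβ''⟩
  have straight : IsStraight setCounters := by simp [setCounters, IsStraight]
  refine (Computes.straight straight hβ'').mono le_rfl ?_
  rintro _ rfl
  exact setupDone_memEval hμ (hβ''.memEval straight)

theorem exists_computes_setup : ∃ T β : ℕ → ℕ, ExpBounded T ∧ ExpBounded β ∧
    ∀ (n : ℕ) [NeZero n] (col : Fin n → PMF (Fin n)) (k : ℕ),
      Computes col (T (256 * k)) setup (Function.update (fun _ => 0) 0 (k : ℤ))
        (SetupDone (256 * k) (β (256 * k))) := by
  let β₁ m := straightPowerBits (straightCost setDegree) m m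
  let β₂ m := straightPowerBits (straightCost setScales) m (β₁ m)
  have h₁ : ExpBounded β₁ := ExpBounded.id.straightPowerBits _
  have h₂ : ExpBounded β₂ := h₁.straightPowerBits _
  have h₃ : ExpBounded fun m => straightPowerBits (straightCost setShiftBase) m (β₂ m) :=
    h₂.straightPowerBits _
  have h₄ := h₃.straightPowerBits (straightCost setOffsetBase)
  have finish_cost : ExpBounded fun m => finishSetupCost m (β₂ m) :=
    (h₂.straightPowerCost _).add <| (h₃.straightPowerCost _).add <|
      (ExpBounded.const _).mul (((ExpBounded.const 1).add h₄).pow 2)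
  refine ⟨_, fun m => finishSetupBits m (β₂ m),
    (ExpBounded.id.straightPowerCost (straightCost setDegree)).add <|
      (h₁.straightPowerCost (straightCost setScales)).add finish_cost,
    (ExpBounded.const _).mul ((ExpBounded.const 1).add h₄), fun n _ col k => ?_⟩
  refine (computes_setDegree k).seq ?_
  rintro μ ⟨hβ, hone, hdegree, hgrid, hodd⟩
  refine (computes_straight_power (p := setScales) hβ (by simp [setScales, IsStraight])
    (by simp) (by simp) hone hdegree).seq ?_
  rintro _ ⟨rfl, hβ'⟩
  exact computes_finishSetup (gridReady_powerEval hone hdegree hgrid hodd) hβ'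

end

/-! ### The output phase -/

/-- Compute the point `y = c - (2 * G + 1)` of the atom with number `c`, prepare the kernel
recursion there. -/
def center : Prog :=
  cPoint ≔ cAtomsLeft ⊟ cCenter ;; cStep ≔ cGridBase ⊟ cPoint ;; cStep ≔ cStep ⊠ cStep ;;
  cTmp ≔ cScale ⊞ cScale ;; cStep ≔ cTmp ⊟ cStep ;; cTmp ≔const 0 ;; cPrev ≔ cTmp ⊟ cScale ;;
  cTmp ≔const 1 ;; cCur ≔ cTmp ;; cCounter ≔ cDegree

/-- One step of the recursion for `dirichletSeq`. -/
def kernelStep : Prog :=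
  cTmp ≔ cStep ⊠ cCur ;; cTmp ≔ cTmp ⊟ cPrev ;; cPrev ≔ cScaleSq ⊠ cCur ;; cCur ≔ cTmp ;;
  cCounter ≔ cCounter ⊟ cOne

/-- Multiply the fourth power of the kernel value by the code and shift; the weight is the last
digit of the result in the basis `B`. -/
def digits : Prog :=
  cWeight ≔ cCur ⊠ cCur ;; cWeight ≔ cWeight ⊠ cWeight ;; cWeight ≔ cWeight ⊠ cCode ;;
  cWeight ≔ cWeight ⊘ cShift ;; cWeight ≔ cWeight ⊞ cOffset

/-- Keep the last digit only. -/
def lastDigit : Prog :=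
  cTmp ≔ cWeight ⊘ cBase ;; cTmp ≔ cTmp ⊠ cBase ;; cWeight ≔ cWeight ⊟ cTmp

/-- Compute the address `2 * c + 52` of the atom with number `c`, and decrease `c`. -/
def address : Prog :=
  cAddress ≔ cAtomsLeft ⊞ cAtomsLeft ;; cAddress ≔ cAddress ⊞ cStart ;;
  cAtomsLeft ≔ cAtomsLeft ⊟ cOne

/-- Write the point and the weight of the atom to the output. -/
def store : Prog :=
  .copy (.ind cAddress) (.dir cPoint) ;; cAddress ≔ cAddress ⊞ cOne ;;
  .copy (.ind cAddress) (.dir cWeight)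

/-- Empty the cells that hold large intermediate results. -/
def clear : Prog :=
  cCounter ≔const 0 ;; cTmp ≔const 0 ;; cStep ≔const 0 ;; cCur ≔const 0 ;; cPrev ≔const 0 ;;
  cAddress ≔const 0 ;; cPoint ≔const 0 ;; cWeight ≔const 0

/-- Extract the weight of an atom from the kernel value at `B`, and output the atom. -/
def writeAtom : Prog := (digits ;; lastDigit) ;; address ;; store ;; clear

/-- Compute and output one atom. -/
def atomStep : Prog :=
  (center ;; .loop (.dir cCounter) kernelStep) ;; writeAtom

/-- The cells that `clear` empties. -/
def clearedCells : List ℕ :=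
  [cCounter, cTmp, cStep, cCur, cPrev, cAddress, cPoint, cWeight]

/-- The cells below the first atom that are modified after the set-up phase. -/
def scratchCells : List ℕ :=
  cWalksLeft :: cPosition :: cCode :: cAtomsLeft :: clearedCells

theorem ParamsReady.congr {m : ℕ} {μ μ' : ℕ → ℤ} (h : ParamsReady m μ)
    (hμ : ∀ i < 54, i ∉ scratchCells → μ' i = μ i) : ParamsReady m μ' where
  one := (hμ _ (by norm_num) (by decide)).trans h.one
  degree := (hμ _ (by norm_num) (by decide)).trans h.degree
  grid := (hμ _ (by norm_num) (by decide)).trans h.grid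
  walks := (hμ _ (by norm_num) (by decide)).trans h.walks
  scale := (hμ _ (by norm_num) (by decide)).trans h.scale
  scaleSq := (hμ _ (by norm_num) (by decide)).trans h.scaleSq
  base := (hμ _ (by norm_num) (by decide)).trans h.base
  odd i hi hodd := by
    have scratch_even : ∀ j ∈ scratchCells, j % 2 = 0 := by decide
    exact (hμ i hi fun hmem => by have := scratch_even i hmem; omega).trans (h.odd i hi hodd)
  shift := (hμ _ (by norm_num) (by decide)).trans h.shift
  top := (hμ _ (by norm_num) (by decide)).trans h.top
  center := (hμ _ (by norm_num) (by decide)).trans h.center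
  gridBase := (hμ _ (by norm_num) (by decide)).trans h.gridBase
  offset := (hμ _ (by norm_num) (by decide)).trans h.offset
  start := (hμ _ (by norm_num) (by decide)).trans h.start

/-- Bound for the bit lengths in the kernel recursion. -/
def kernelBits (m β : ℕ) : ℕ := (m + 1) * (β + 1)

/-- Running time of the kernel recursion. -/
def kernelCost (m β : ℕ) : ℕ :=
  (m + 1) * (straightCost kernelStep * (1 + kernelBits m β) ^ 2 + 2 + kernelBits m β)

theorem abs_dirichletSeq_le {V E : ℤ} {β : ℕ} (hV : bits V ≤ β) (hE : bits E ≤ β) (j : ℕ) :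
    |dirichletSeq V E j| ≤ 2 ^ ((β + 1) * j) := by
  rw [bits_le_iff] at hV hE
  have growth := dirichletSeq_le_pow (normRingSeminorm ℤ) (norm_one (α := ℤ)).le
    (V := V) (E := E) (r := 2 ^ (β + 1)) (by
      change ‖V‖ + ‖E‖ ≤ _
      rw [Int.norm_eq_abs, Int.norm_eq_abs, pow_succ]
      exact_mod_cast (by linarith : |V| + |E| ≤ 2 ^ β * 2)) j
  rw [pow_mul]
  change ‖dirichletSeq V E j‖ ≤ _ at growth
  rw [Int.norm_eq_abs] at growth
  exact_mod_cast growth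

section

variable {n : ℕ} [NeZero n] {col : Fin n → PMF (Fin n)} {m β : ℕ} {μ : ℕ → ℤ}

/-- The value that the recursion for `dirichletSeq V E` subtracts in the step after `j`. -/
def dirichletPrev (V E : ℤ) (j : ℕ) : ℤ := V * dirichletSeq V E j - dirichletSeq V E (j + 1)

theorem dirichletPrev_zero (V E : ℤ) : dirichletPrev V E 0 = -E := by
  simp only [dirichletPrev, dirichletSeq]; ring

theorem dirichletPrev_succ (V E : ℤ) (j : ℕ) :
    dirichletPrev V E (j + 1) = E ^ 2 * dirichletSeq V E j := by
  simp only [dirichletPrev, dirichletSeq]; ring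

/-- The memory of the kernel recursion after `m - i` steps. -/
def kernelState (m : ℕ) (μ : ℕ → ℤ) (i : ℕ) : ℕ → ℤ :=
  Function.update (Function.update (Function.update (Function.update μ
    cTmp (dirichletSeq (μ cStep) (μ cScale) (m - i)))
    cCur (dirichletSeq (μ cStep) (μ cScale) (m - i)))
    cPrev (dirichletPrev (μ cStep) (μ cScale) (m - i))) cCounter i

theorem bits_dirichletSeq_le {V E : ℤ} (hV : bits V ≤ β) (hE : bits E ≤ β) {j : ℕ} (hj : j ≤ m) :
    bits (dirichletSeq V E j) ≤ kernelBits m β :=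
  bits_le_iff.mpr <| (abs_dirichletSeq_le hV hE j).trans_lt <|
    pow_lt_pow_right₀ one_lt_two (by unfold kernelBits; nlinarith)

theorem bits_dirichletPrev_le {V E : ℤ} (hV : bits V ≤ β) (hE : bits E ≤ β)
    (hE₂ : bits (E ^ 2) ≤ β) {j : ℕ} (hj : j ≤ m) :
    bits (dirichletPrev V E j) ≤ kernelBits m β := by
  rcases j with _ | j
  · rw [dirichletPrev_zero, bits, Int.natAbs_neg]
    exact hE.trans (by unfold kernelBits; nlinarith)
  · rw [dirichletPrev_succ, bits_le_iff, abs_mul]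
    calc |E ^ 2| * |dirichletSeq V E j| ≤ |E ^ 2| * 2 ^ ((β + 1) * j) := by
          gcongr; exact abs_dirichletSeq_le hV hE j
      _ < 2 ^ β * 2 ^ ((β + 1) * j) := by gcongr; exact bits_le_iff.mp hE₂
      _ = 2 ^ (β + (β + 1) * j) := (pow_add _ _ _).symm
      _ ≤ 2 ^ kernelBits m β := pow_le_pow_right₀ one_le_two (by unfold kernelBits; nlinarith)

theorem BitBounded.kernelState (hμ : BitBounded β μ) (hsq : μ cScaleSq = μ cScale ^ 2)
    (hm : bits (m : ℤ) ≤ β) {i : ℕ} (hi : i ≤ m) :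
    BitBounded (kernelBits m β) (kernelState m μ i) := by
  have le_kernelBits : β ≤ kernelBits m β := by unfold kernelBits; nlinarith
  have value_bits := bits_dirichletSeq_le (hμ cStep) (hμ cScale) (Nat.sub_le m i)
  have prev_bits := bits_dirichletPrev_le (hμ cStep) (hμ cScale) (hsq ▸ hμ cScaleSq)
    (Nat.sub_le m i)
  exact ((((hμ.mono le_kernelBits).update _ value_bits).update _ value_bits).update _
    prev_bits).update _ ((bits_natCast_le_of_le hm hi).trans le_kernelBits)

theorem memEval_kernelStep (hone : μ cOne = 1) (hsq : μ cScaleSq = μ cScale ^ 2) {i : ℕ}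
    (hi : i + 1 ≤ m) : memEval kernelStep (kernelState m μ (i + 1)) = kernelState m μ i := by
  set state := kernelState m μ (i + 1) with hstate
  have writes : WritesOnly {cTmp, cPrev, cCur, cCounter} kernelStep := by
    simp [kernelStep, WritesOnly]
  have hcur : state cCur = dirichletSeq (μ cStep) (μ cScale) (m - (i + 1)) := rfl
  have hprev : state cPrev = dirichletPrev (μ cStep) (μ cScale) (m - (i + 1)) := rfl
  have next : μ cStep * state cCur - state cPrev = dirichletSeq (μ cStep) (μ cScale) (m - i) := by
    rw [hcur, hprev, dirichletPrev, show m - i = m - (i + 1) + 1 by omega]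
    ring
  have prev : μ cScaleSq * state cCur = dirichletPrev (μ cStep) (μ cScale) (m - i) := by
    rw [hcur, hsq, ← dirichletPrev_succ, show m - i = m - (i + 1) + 1 by omega]
  have count : state cCounter - μ cOne = i := by
    change ((i + 1 : ℕ) : ℤ) - μ cOne = i
    rw [hone]; push_cast; ring
  funext j
  by_cases hj : j ∈ ({cTmp, cPrev, cCur, cCounter} : Set ℕ)
  · simp only [Set.mem_insert_iff, Set.mem_singleton_iff] at hj
    rcases hj with rfl | rfl | rfl | rfl
    exacts [next, prev, next, count]
  · rw [writes.memEval_eq hj]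
    simp only [Set.mem_insert_iff, Set.mem_singleton_iff, not_or] at hj
    simp [hstate, kernelState, hj]

theorem computes_kernelLoop (hone : μ cOne = 1) (hsq : μ cScaleSq = μ cScale ^ 2)
    (htmp : μ cTmp = 1) (hcur : μ cCur = 1) (hprev : μ cPrev = -μ cScale)
    (hcounter : μ cCounter = m) (hμ : BitBounded β μ) :
    Computes col (kernelCost m β) (.loop (.dir cCounter) kernelStep) μ fun μ' =>
      μ' cCur = dirichletSeq (μ cStep) (μ cScale) m ∧
        (∀ i ∉ [cTmp, cCur, cPrev, cCounter], μ' i = μ i) ∧ BitBounded (kernelBits m β) μ' := by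
  have state_bits {i : ℕ} (hi : i ≤ m) : BitBounded (kernelBits m β) (kernelState m μ i) :=
    hμ.kernelState hsq (hcounter ▸ hμ cCounter) hi
  have enter : μ = kernelState m μ m := by
    have keep {i : ℕ} {z : ℤ} (h : μ i = z) : Function.update μ i z = μ := by
      rw [← h, Function.update_eq_self]
    rw [kernelState, Nat.sub_self, dirichletPrev_zero, dirichletSeq, keep htmp, keep hcur,
      keep hprev, keep hcounter]
  have straight : IsStraight kernelStep := by simp [kernelStep, IsStraight]
  refine (Computes.loop (I := fun i μ' => i ≤ m ∧ μ' = kernelState m μ i)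
    (β := kernelBits m β) ?_ ?_ ?_ (N := m) ⟨le_rfl, enter⟩).mono le_rfl ?_
  · rintro i _ ⟨hi, rfl⟩
    exact state_bits hi _
  · rintro i _ ⟨hi, rfl⟩
    refine ⟨by simp only [kernelState, Function.update_self]; positivity,
      (Computes.straight straight (state_bits hi)).mono le_rfl ?_⟩
    rintro _ rfl
    exact ⟨by omega, memEval_kernelStep hone hsq hi⟩
  · rintro _ ⟨-, rfl⟩
    simp [kernelState]
  · rintro _ ⟨-, rfl⟩
    refine ⟨by simp [kernelState], fun i hi => ?_, state_bits (Nat.zero_le m)⟩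
    simp only [List.mem_cons, List.not_mem_nil, or_false, not_or] at hi
    simp [kernelState, hi]

/-- Running time of the computation of the kernel at one grid point. -/
def kernelPhaseCost (m β : ℕ) : ℕ :=
  straightCost center * (1 + β) ^ 2 + kernelCost m (straightCost center * (1 + β))

/-- Bound for the bit lengths during the computation of the kernel at one grid point. -/
def kernelPhaseBits (m β : ℕ) : ℕ := kernelBits m (straightCost center * (1 + β))

theorem computes_kernelPhase (hμ : ParamsReady m μ) (hβ : BitBounded β μ) :
    Computes col (kernelPhaseCost m β) (center ;; .loop (.dir cCounter) kernelStep) μ fun μ' =>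
      μ' cPoint = μ cAtomsLeft - (2 * gridSize m + 1) ∧
      μ' cCur ^ 4 = scaledKernel m (gridSize m : ℤ) (μ cAtomsLeft - (2 * gridSize m + 1))
        (codeBase m) ∧
      (∀ i ∉ clearedCells, μ' i = μ i) ∧ BitBounded (kernelPhaseBits m β) μ' := by
  have straight : IsStraight center := by simp [center, IsStraight]
  have writes : WritesOnly {i | i ∈ clearedCells} center := by
    simp [center, WritesOnly, clearedCells]
  refine (Computes.straight straight hβ).seq ?_
  rintro _ rfl
  have point : memEval center μ cPoint = μ cAtomsLeft - (2 * gridSize m + 1) :=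
    congrArg (μ cAtomsLeft - ·) hμ.center
  have step : memEval center μ cStep = 2 * (4 * (gridSize m : ℤ) ^ 2) -
      (gridSize m * codeBase m - (μ cAtomsLeft - (2 * gridSize m + 1))) ^ 2 := by
    change μ cScale + μ cScale - (μ cGridBase - (μ cAtomsLeft - μ cCenter)) *
      (μ cGridBase - (μ cAtomsLeft - μ cCenter)) = _
    rw [hμ.scale, hμ.gridBase, hμ.center]
    ring
  refine (computes_kernelLoop (μ := memEval center μ) hμ.one
    (hμ.scaleSq.trans (congrArg (· ^ 2) hμ.scale.symm)) rfl rfl (zero_sub _) hμ.degree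
    (hβ.memEval straight)).mono le_rfl ?_
  rintro μ' ⟨hcur, frame, bounded⟩
  refine ⟨(frame _ (by decide)).trans point, ?_, fun i hi => ?_, bounded⟩
  · rw [hcur, step, scaledKernel]
    exact congrArg (dirichletSeq _ · m ^ 4) hμ.scale
  · have unused : i ∉ [cTmp, cCur, cPrev, cCounter] := fun h => hi <| by
      revert h; simp only [clearedCells, List.mem_cons]; tauto
    rw [frame i unused, writes.memEval_eq hi]

theorem memEval_digits (hμ : ParamsReady m μ)
    (hcur : μ cCur ^ 4 = scaledKernel m (gridSize m : ℤ) (μ cPoint) (codeBase m)) :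
    memEval (digits ;; lastDigit) μ cWeight = weightValue m (μ cCode) (μ cPoint) := by
  have all : memEval digits μ cWeight = scaledKernel m (gridSize m : ℤ) (μ cPoint) (codeBase m) *
      μ cCode / codeBase m ^ (8 * m) + weightOffset m := by
    change μ cCur * μ cCur * (μ cCur * μ cCur) * μ cCode / μ cShift + μ cOffset = _
    rw [← hcur, hμ.shift, hμ.offset]
    ring_nf
  have base : memEval digits μ cBase = codeBase m := hμ.base
  change memEval lastDigit (memEval digits μ) cWeight = _
  generalize memEval digits μ = μ' at all base
  change μ' cWeight - μ' cWeight / μ' cBase * μ' cBase = _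
  rw [all, base, mul_comm (_ / codeBase m), ← Int.emod_def, weightValue]

theorem memEval_store {a : ℕ} (ha : 54 ≤ a) (hone : μ cOne = 1) (haddress : μ cAddress = a) :
    memEval store μ = Function.update (Function.update (Function.update μ a (μ cPoint))
      cAddress (a + 1)) (a + 1) (μ cWeight) := by
  have first : (μ cAddress).toNat = a := by rw [haddress, Int.toNat_natCast]
  have second : ((a : ℤ) + 1).toNat = a + 1 := Int.toNat_natCast (a + 1)
  have below {i : ℕ} {z : ℤ} (hi : i < 54) : Function.update μ a z i = μ i :=
    Function.update_of_ne (by omega) _ _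
  change Function.update (Function.update (Function.update μ (μ cAddress).toNat (μ cPoint))
    cAddress (Function.update μ (μ cAddress).toNat (μ cPoint) cAddress +
      Function.update μ (μ cAddress).toNat (μ cPoint) cOne))
    (Function.update μ (μ cAddress).toNat (μ cPoint) cAddress +
      Function.update μ (μ cAddress).toNat (μ cPoint) cOne).toNat
    (Function.update μ (μ cAddress).toNat (μ cPoint) cWeight) = _
  rw [first, below (by norm_num), below (by norm_num), below (by norm_num), haddress, hone, second]

theorem memEval_address {c : ℕ} (hone : μ cOne = 1) (hstart : μ cStart = 52)
    (hc : μ cAtomsLeft = (c + 1 : ℕ)) : memEval address μ cAddress = (2 * (c + 1) + 52 : ℕ) ∧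
      memEval address μ cAtomsLeft = c := by
  change μ cAtomsLeft + μ cAtomsLeft + μ cStart = _ ∧ μ cAtomsLeft - μ cOne = _
  rw [hc, hone, hstart]
  push_cast
  exact ⟨by ring, by ring⟩

theorem notMem_clearedCells {i : ℕ} (hi : 54 ≤ i) : i ∉ cAtomsLeft :: clearedCells := fun h => by
  have lt_of_mem : ∀ j ∈ cAtomsLeft :: clearedCells, j < 54 := by decide
  exact (lt_of_mem i h).not_ge hi

/-- The memory `μ'` results from `μ` by writing the atom with number `c + 1`. -/
structure AtomWritten (m c : ℕ) (μ μ' : ℕ → ℤ) : Prop where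
  frame : ∀ i ∉ cAtomsLeft :: clearedCells, i ≠ 2 * (c + 1) + 52 → i ≠ 2 * (c + 1) + 53 →
    μ' i = μ i
  cleared : ∀ i ∈ clearedCells, μ' i = 0
  atomsLeft : μ' cAtomsLeft = c
  point : μ' (2 * (c + 1) + 52) = (c + 1 : ℕ) - (2 * gridSize m + 1)
  weight : μ' (2 * (c + 1) + 53) =
    weightValue m (μ cCode) ((c + 1 : ℕ) - (2 * gridSize m + 1))

theorem atomWritten_memEval {c : ℕ} (hμ : ParamsReady m μ) (hc : μ cAtomsLeft = (c + 1 : ℕ))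
    (hpoint : μ cPoint = (c + 1 : ℕ) - (2 * gridSize m + 1))
    (hcur : μ cCur ^ 4 = scaledKernel m (gridSize m : ℤ) (μ cPoint) (codeBase m)) :
    AtomWritten m c μ (memEval writeAtom μ) := by
  have writes_digits : WritesOnly {cWeight, cTmp} (digits ;; lastDigit) := by
    simp [digits, lastDigit, WritesOnly]
  have writes_address : WritesOnly {cAddress, cAtomsLeft} address := by
    simp [address, WritesOnly]
  have writes_clear : WritesOnly {i | i ∈ clearedCells} clear := by
    simp [clear, WritesOnly, clearedCells]
  have weight := memEval_digits hμ hcur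
  have frame {i : ℕ} (hi : i ∉ ({cWeight, cTmp} : Set ℕ)) := writes_digits.memEval_eq hi μ
  change AtomWritten m c μ (memEval clear (memEval store (memEval address (memEval _ μ))))
  generalize memEval (digits ;; lastDigit) μ = μ₁ at weight frame
  have one : μ₁ cOne = 1 := (frame (by simp)).trans hμ.one
  obtain ⟨location, atomsLeft⟩ :=
    memEval_address one ((frame (by simp)).trans hμ.start) ((frame (by simp)).trans hc)
  have point : memEval address μ₁ cPoint = μ cPoint :=
    (writes_address.memEval_eq (by simp) _).trans (frame (by simp))
  rw [memEval_store (by omega) ((writes_address.memEval_eq (by simp) _).trans one) location,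
    point, writes_address.memEval_eq (show cWeight ∉ _ by simp), weight]
  refine ⟨fun i hi h₁ h₂ => ?_, ?_, ?_, ?_, ?_⟩
  · rw [writes_clear.memEval_eq fun h => hi (List.mem_cons_of_mem _ h), Function.update_of_ne h₂,
      Function.update_of_ne (ne_of_mem_of_not_mem (by decide) hi).symm, Function.update_of_ne h₁]
    simp only [clearedCells, List.mem_cons, not_or] at hi
    rw [writes_address.memEval_eq (by simp [hi]), frame (by simp [hi])]
  · simp [clear, clearedCells, memEval, resolve]
  · rw [writes_clear.memEval_eq (by decide), Function.update_of_ne (by omega),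
      Function.update_of_ne (by norm_num), Function.update_of_ne (by omega), atomsLeft]
  · rw [writes_clear.memEval_eq fun h => notMem_clearedCells (by omega) (List.mem_cons_of_mem _ h),
      Function.update_of_ne (by omega), Function.update_of_ne (by omega), Function.update_self,
      hpoint]
  · rw [writes_clear.memEval_eq fun h => notMem_clearedCells (by omega) (List.mem_cons_of_mem _ h),
      Function.update_self, hpoint]

/-- The memory during the output phase, when the atoms with numbers above `c` have been
written. -/
structure AtomInvariant (m β : ℕ) (H : ℤ) (c : ℕ) (μ : ℕ → ℤ) : Prop extends ParamsReady m μ where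
  code : μ cCode = H
  atomsLeft : μ cAtomsLeft = c
  point : ∀ c', c < c' → c' ≤ 4 * gridSize m + 1 → μ (2 * c' + 52) = c' - (2 * gridSize m + 1)
  weight : ∀ c', c < c' → c' ≤ 4 * gridSize m + 1 →
    μ (2 * c' + 53) = weightValue m H (c' - (2 * gridSize m + 1))
  bounded : BitBounded β μ

theorem AtomInvariant.next {H : ℤ} {c : ℕ} {μ' : ℕ → ℤ} (h : AtomInvariant m β H (c + 1) μ)
    (hc : c + 1 ≤ 4 * gridSize m + 1) (hμ' : AtomWritten m c μ μ') :
    AtomInvariant m β H c μ' := by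
  have params : ParamsReady m μ' := h.toParamsReady.congr fun i hi hmem =>
    hμ'.frame i (fun hm => hmem (by revert hm; simp only [scratchCells, List.mem_cons]; tauto))
      (by omega) (by omega)
  have old {c' i : ℕ} (hc' : c + 1 < c') (hi : i < 2) :
      μ' (2 * c' + 52 + i) = μ (2 * c' + 52 + i) :=
    hμ'.frame _ (notMem_clearedCells (by omega)) (by omega) (by omega)
  refine ⟨params, (hμ'.frame _ (by decide) (by omega) (by omega)).trans h.code, hμ'.atomsLeft,
    fun c' hlt hle => ?_, fun c' hlt hle => ?_, fun i => ?_⟩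
  · rcases (Nat.succ_le_of_lt hlt).eq_or_lt with rfl | hlt
    · exact hμ'.point
    · exact (old hlt (by norm_num : 0 < 2)).trans (h.point c' hlt hle)
  · rcases (Nat.succ_le_of_lt hlt).eq_or_lt with rfl | hlt
    · rw [hμ'.weight, h.code]
    · exact (old hlt (by norm_num : 1 < 2)).trans (h.weight c' hlt hle)
  · by_cases hi₁ : i = 2 * (c + 1) + 52
    · rw [hi₁, hμ'.point, bits_le_iff]
      refine lt_of_le_of_lt ?_ (bits_le_iff.mp (h.center ▸ h.bounded cCenter))
      rw [abs_le, abs_of_nonneg (by positivity)]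
      push_cast
      omega
    by_cases hi₂ : i = 2 * (c + 1) + 53
    · rw [hi₂, hμ'.weight]
      exact bits_le_of_le (weightValue_nonneg _ _ _) (weightValue_lt _ _ _).le
        (h.base ▸ h.bounded cBase)
    by_cases hi₃ : i ∈ cAtomsLeft :: clearedCells
    · rcases List.mem_cons.mp hi₃ with rfl | hi
      · rw [hμ'.atomsLeft]
        exact bits_natCast_le_of_le (h.atomsLeft ▸ h.bounded cAtomsLeft) (Nat.le_succ c)
      · rw [hμ'.cleared i hi]
        exact Nat.zero_le β
    · rw [hμ'.frame i hi₃ hi₁ hi₂]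
      exact h.bounded i

/-- Running time of the computation of one atom. -/
def atomCost (m β : ℕ) : ℕ :=
  kernelPhaseCost m β + straightCost writeAtom * (1 + kernelPhaseBits m β) ^ 2

theorem computes_atomStep {H : ℤ} {c : ℕ} (h : AtomInvariant m β H (c + 1) μ)
    (hc : c + 1 ≤ 4 * gridSize m + 1) :
    Computes col (atomCost m β) atomStep μ (AtomInvariant m β H c) := by
  have straight : IsStraight writeAtom := by
    simp [writeAtom, digits, lastDigit, address, store, clear, IsStraight]
  refine (computes_kernelPhase h.toParamsReady h.bounded).seq ?_
  rintro μ₁ ⟨point, cur, frame, bounded⟩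
  have params : ParamsReady m μ₁ := h.toParamsReady.congr fun i _ hi =>
    frame i fun hm => hi (by revert hm; simp only [scratchCells, List.mem_cons]; tauto)
  rw [h.atomsLeft] at point cur
  refine (Computes.straight straight bounded).mono le_rfl ?_
  rintro _ rfl
  have written := atomWritten_memEval params ((frame _ (by decide)).trans h.atomsLeft) point
    (point ▸ cur)
  refine h.next hc ⟨fun i hi h₁ h₂ => (written.frame i hi h₁ h₂).trans
    (frame i fun hm => hi (List.mem_cons_of_mem _ hm)), written.cleared, written.atomsLeft,
    written.point, ?_⟩
  rw [written.weight, frame _ (by decide)]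

/-- Write the common denominator `G` and the number `4 * G + 27` of atoms. -/
def writeHeader : Prog :=
  0 ≔ cGrid ;; cTmp ≔const 26 ;; 1 ≔ cCenter ⊞ cGrid ;; 1 ≔ 1 ⊞ cGrid ;; 1 ≔ 1 ⊞ cTmp

/-- The output phase, which runs through the grid points from right to left. -/
def outputPhase : Prog := .loop (.dir cAtomsLeft) atomStep ;; writeHeader

/-- The output cells hold atoms of weight `W y` at `y / G` for `|y| ≤ 2 * G`. They are preceded
by 26 atoms of weight zero, because the first cells are the registers of the program. -/
structure Encodes (G : ℕ) (W : ℤ → ℤ) (μ : ℕ → ℤ) : Prop where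
  denominator : μ 0 = G
  count : μ 1 = 4 * G + 27
  padding : ∀ i < 26, μ (3 + 2 * i) = 0
  point : ∀ i < 4 * G + 1, μ (2 + 2 * (26 + i)) = i - 2 * G
  weight : ∀ i < 4 * G + 1, μ (3 + 2 * (26 + i)) = W (i - 2 * G)

theorem AtomInvariant.encodes {H : ℤ} (h : AtomInvariant m β H 0 μ) :
    Encodes (gridSize m) (weightValue m H) (memEval writeHeader μ) := by
  have frame {i : ℕ} (hi : i ∉ ({0, 1, cTmp} : Set ℕ)) : memEval writeHeader μ i = μ i :=
    WritesOnly.memEval_eq (by simp [writeHeader, WritesOnly]) hi μ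
  refine ⟨h.grid, ?_, fun i hi => ?_, fun i hi => ?_, fun i hi => ?_⟩
  · change μ cCenter + μ cGrid + μ cGrid + 26 = _
    rw [h.center, h.grid]
    ring
  · rw [frame (by simp only [Set.mem_insert_iff, Set.mem_singleton_iff]; omega)]
    exact h.odd _ (by omega) (by omega)
  · rw [frame (by simp only [Set.mem_insert_iff, Set.mem_singleton_iff]; omega),
      show 2 + 2 * (26 + i) = 2 * (i + 1) + 52 by ring, h.point _ (by omega) (by omega)]
    push_cast
    ring
  · rw [frame (by simp only [Set.mem_insert_iff, Set.mem_singleton_iff]; omega),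
      show 3 + 2 * (26 + i) = 2 * (i + 1) + 53 by ring, h.weight _ (by omega) (by omega)]
    congr 1
    push_cast
    ring

/-- Running time of the output phase. -/
def outputCost (m β : ℕ) : ℕ :=
  (4 * gridSize m + 1 + 1) * (atomCost m β + 2 + β) + straightCost writeHeader * (1 + β) ^ 2

theorem ExpBounded.kernelBits {β : ℕ → ℕ} (hβ : ExpBounded β) :
    ExpBounded fun m => kernelBits m (β m) :=
  (id.add (const 1)).mul (hβ.add (const 1))

theorem ExpBounded.kernelPhaseBits {β : ℕ → ℕ} (hβ : ExpBounded β) :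
    ExpBounded fun m => kernelPhaseBits m (β m) :=
  ((const _).mul ((const 1).add hβ)).kernelBits

theorem ExpBounded.kernelPhaseCost {β : ℕ → ℕ} (hβ : ExpBounded β) :
    ExpBounded fun m => kernelPhaseCost m (β m) :=
  have bits := hβ.kernelPhaseBits
  ((const _).mul (((const 1).add hβ).pow 2)).add ((id.add (const 1)).mul
    ((((const _).mul (((const 1).add bits).pow 2)).add (const 2)).add bits))

theorem ExpBounded.outputCost {β : ℕ → ℕ} (hβ : ExpBounded β) :
    ExpBounded fun m => outputCost m (β m) :=
  have atom := hβ.kernelPhaseCost.add ((const _).mul (((const 1).add hβ.kernelPhaseBits).pow 2))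
  ((((((const 4).mul expBounded_gridSize).add (const 1)).add (const 1)).mul
    ((atom.add (const 2)).add hβ))).add ((const _).mul (((const 1).add hβ).pow 2))

theorem computes_outputPhase {H : ℤ} (h : AtomInvariant m β H (4 * gridSize m + 1) μ) :
    Computes col (outputCost m β) outputPhase μ (Encodes (gridSize m) (weightValue m H)) := by
  have loop : Computes col _ (.loop (.dir cAtomsLeft) atomStep) μ _ :=
    .loop (I := fun c μ' => c ≤ 4 * gridSize m + 1 ∧ AtomInvariant m β H c μ')
      (fun _ _ hc => hc.2.bounded _)
      (fun c μ' hc => ⟨by rw [hc.2.atomsLeft]; positivity,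
        (computes_atomStep hc.2 hc.1).mono le_rfl fun _ hnext => ⟨by omega, hnext⟩⟩)
      (fun _ hc => hc.2.atomsLeft.le) ⟨le_rfl, h⟩
  refine loop.seq fun μ' hμ' => (Computes.straight ?_ hμ'.2.bounded).mono le_rfl ?_
  · simp [writeHeader, IsStraight]
  · rintro _ rfl
    exact hμ'.2.encodes

end

section

variable {n G : ℕ} {W : ℤ → ℤ} {s : State n}

theorem sum_range_eq_sum_window {M : Type*} [AddCommMonoid M] (R : ℕ) (f : ℤ → M) :
    ∑ i ∈ Finset.range (2 * R + 1), f (i - R) = ∑ y ∈ window R, f y := by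
  refine Finset.sum_bij (fun i _ => (i : ℤ) - R) (fun i hi => ?_) (fun i _ j _ h => by omega)
    (fun y hy => ?_) fun _ _ => rfl
  · rw [Finset.mem_range] at hi
    rw [mem_window, abs_le]
    omega
  · rw [mem_window, abs_le] at hy
    exact ⟨(y + R).toNat, by rw [Finset.mem_range]; omega, by omega⟩

theorem Encodes.sum_atoms (h : Encodes G W s.mem) {M : Type*} [AddCommMonoid M] (f : ℝ → ℤ → M)
    (hf : ∀ x, f x 0 = 0) :
    ∑ i ∈ Finset.range s.atoms, f (s.location i) (s.weight i) =
      ∑ y ∈ window (2 * G), f (y / G) (W y) := by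
  have atoms : s.atoms = 26 + (2 * (2 * G) + 1) := by rw [State.atoms, h.count]; omega
  rw [atoms, Finset.sum_range_add, ← sum_range_eq_sum_window,
    Finset.sum_eq_zero fun i hi => ?_, zero_add]
  · refine Finset.sum_congr rfl fun i hi => ?_
    rw [Finset.mem_range] at hi
    rw [State.location, State.weight, h.point i (by omega), h.weight i (by omega), h.denominator]
    push_cast
    rfl
  · rw [State.weight, h.padding i (Finset.mem_range.mp hi), hf]

theorem Encodes.totalWeight_eq (h : Encodes G W s.mem) :
    s.totalWeight = ∑ y ∈ window (2 * G), W y :=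
  h.sum_atoms (fun _ w => w) fun _ => rfl

theorem Encodes.output_eq (h : Encodes G W s.mem) :
    s.output = ∑ y ∈ window (2 * G), ENNReal.ofReal ((W y : ℝ) /
      (∑ z ∈ window (2 * G), W z : ℤ)) • Measure.dirac ((y : ℝ) / G) := by
  rw [State.output, h.totalWeight_eq]
  exact h.sum_atoms (fun x w => ENNReal.ofReal ((w : ℝ) / (∑ z ∈ window (2 * G), W z : ℤ)) •
    Measure.dirac x) (by simp)

theorem Encodes.wellFormed (h : Encodes G W s.mem) (hG : 0 < G) (hW : ∀ y, 0 ≤ W y)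
    (htotal : 0 < ∑ y ∈ window (2 * G), W y) : s.WellFormed := by
  refine ⟨by rw [h.denominator]; exact_mod_cast hG, fun i hi => ?_, by rwa [h.totalWeight_eq]⟩
  rw [State.atoms, h.count] at hi
  rcases lt_or_ge i 26 with hi' | hi'
  · exact (h.padding i hi').ge
  · obtain ⟨j, rfl⟩ := Nat.exists_eq_add_of_le hi'
    rw [State.weight, h.weight j (by omega)]
    exact hW _

end

/-! ### The whole program -/

/-- The algorithm of the theorem: estimate the moments of the spectral distribution by the return
frequencies of random walks, and output the smoothed moment expansion. -/
def spectralProgram : Prog := setup ;; sampleLoop ;; outputPhase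

theorem eval_countPoly (L : ℕ) (B : ℤ) (M : ℕ → ℕ) : (countPoly L M).eval B = encode L B M := by
  simp [countPoly, encode, Polynomial.eval_finsetSum]

theorem encode_single (L : ℕ) (B : ℤ) (t : ℕ) : encode L B (Pi.single L t) = t * B ^ L := by
  rw [encode, Finset.sum_eq_single_of_mem L (by simp) fun j _ hj => by simp [hj], Pi.single_eq_same]

/-- The initial value of the return counts. Every walk returns to its start after `0` steps, which
is accounted for in advance. -/
def initialCounts (m : ℕ) : ℕ → ℕ := Pi.single (8 * m) (gridSize m ^ 3)

/-- A bound for the encoded return counts. -/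
def codeBound (m : ℕ) : ℤ := (gridSize m : ℤ) ^ 3 * codeBase m ^ (8 * m) * (1 + 8 * m)

section

variable {m β : ℕ} {μ μ' : ℕ → ℤ}

theorem SetupDone.bits_codeBound_le (h : SetupDone m β μ) : bits (codeBound m) ≤ β + 8 * m := by
  have code_lt := bits_le_iff.mp (h.bounded cCode)
  have length_le : (1 + 8 * m : ℤ) ≤ 2 ^ (8 * m) := by
    exact_mod_cast (Nat.add_comm 1 (8 * m)).le.trans (Nat.lt_two_pow_self (n := 8 * m))
  rw [bits_le_iff, codeBound, ← h.code, abs_mul, abs_of_pos (by positivity : (0 : ℤ) < 1 + 8 * m),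
    pow_add]
  exact mul_lt_mul code_lt length_le (by positivity) (by positivity)

theorem SetupDone.sampleInvariant (h : SetupDone m β μ) :
    SampleInvariant (8 * m) (β + 8 * m) (codeBase m) (codeBound m) μ (gridSize m ^ 3)
      (initialCounts m) μ where
  frame _ _ _ _ _ := rfl
  walksLeft := h.walksLeft
  code := by rw [h.code, initialCounts, encode_single]; push_cast; rfl
  bounded := h.bounded.mono (Nat.le_add_right _ _)
  room := by rw [initialCounts, encode_single, codeBound]; push_cast; linarith

theorem SetupDone.atomInvariant (h : SetupDone m β μ) {γ : ℕ} {M : ℕ → ℕ}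
    (h' : SampleInvariant (8 * m) γ (codeBase m) (codeBound m) μ 0 M μ') :
    AtomInvariant m γ ((countPoly (8 * m) M).eval (codeBase m)) (4 * gridSize m + 1) μ' where
  toParamsReady := h.toParamsReady.congr fun i _ hi => by
    simp only [scratchCells, clearedCells, List.mem_cons, not_or] at hi
    exact h'.frame i (by tauto) (by tauto) (by tauto) (by tauto)
  code := h'.code.trans (eval_countPoly _ _ _).symm
  atomsLeft := (h'.frame _ (by decide) (by decide) (by decide) (by decide)).trans h.atomsLeft
  point _ hlt hle := absurd hle hlt.not_ge
  weight _ hlt hle := absurd hle hlt.not_ge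
  bounded := h'.bounded

end

theorem one_lt_codeBase {m : ℕ} (hm : 1 ≤ m) : 1 < codeBase m := by
  have pow_pos : 0 < (gridSize m : ℤ) ^ (8 * m + 6) :=
    pow_pos (by exact_mod_cast gridSize_pos m) _
  linarith [two_mul_pow_lt_codeBase hm]

theorem ExpBounded.sampleLoopCost {β : ℕ → ℕ} (hβ : ExpBounded β) :
    ExpBounded fun m => sampleLoopCost (8 * m) (gridSize m ^ 3) (β m) := by
  have square : ExpBounded fun m => 4 * (1 + β m) ^ 2 := (const 4).mul (((const 1).add hβ).pow 2)
  have walk : ExpBounded fun m => walkLoopCost (8 * m) (β m) :=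
    (((const 8).mul id).add (const 1)).mul <| ((((const 4).add
      (((const _).mul (((const 1).add hβ).pow 2)).add (const 3)))).add (const 2)).add hβ
  exact ((expBounded_gridSize.pow 3).add (const 1)).mul <|
    (((const 2).add ((const 3).add (square.add (walk.add square)))).add (const 2)).add hβ

theorem exists_simulates_spectralProgram : ∃ T, ExpBounded T ∧
    ∀ (n : ℕ) [NeZero n] (col : Fin n → PMF (Fin n)) (k : ℕ), 1 ≤ k →
      Simulates col (T (256 * k)) spectralProgram (Function.update (fun _ => 0) 0 (k : ℤ))
        (fun _ => none)
        (walks col (8 * (256 * k)) (gridSize (256 * k) ^ 3) (initialCounts (256 * k)))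
        fun M μ _ => Encodes (gridSize (256 * k))
          (weightValue (256 * k) ((countPoly (8 * (256 * k)) M).eval (codeBase (256 * k)))) μ := by
  obtain ⟨T, β, hT, hβ, computes_setup⟩ := exists_computes_setup
  have hγ : ExpBounded fun m => β m + 8 * m := hβ.add ((ExpBounded.const 8).mul .id)
  refine ⟨_, hT.add (hγ.sampleLoopCost.add hγ.outputCost), fun n _ col k hk => ?_⟩
  refine (computes_setup n col k).seq_simulates fun μ hμ => Simulates.seq_computes
    (simulates_sampleLoop (one_lt_codeBase (by omega)) hμ.base hμ.one hμ.top
      hμ.bits_codeBound_le hμ.sampleInvariant)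
    fun M μ' _ hM => computes_outputPhase (hμ.atomInvariant hM)

/-! ### Running time and success probability -/

theorem ExpBounded.exists_le_exp {T : ℕ → ℕ} (hT : ExpBounded T) {c : ℕ} (hc : 0 < c) :
    ∃ C : ℝ, 0 < C ∧ ∀ ε : ℝ, 0 < ε → (T (c * ⌈1 / ε⌉₊) : ℝ) ≤ C * Real.exp (C / ε) := by
  obtain ⟨a, ha⟩ := hT
  set r : ℝ := a * c * Real.log 2 with hr
  have : 0 ≤ r := by positivity
  have r_le : r ≤ Real.exp r := (le_add_of_nonneg_right zero_le_one).trans (Real.add_one_le_exp r)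
  refine ⟨Real.exp r, Real.exp_pos r, fun ε hε => ?_⟩
  set k := ⌈1 / ε⌉₊
  have k_pos : 0 < k := Nat.ceil_pos.mpr (by positivity)
  have k_le : (k : ℝ) ≤ 1 / ε + 1 := (Nat.ceil_lt_add_one (by positivity)).le
  calc (T (c * k) : ℝ) ≤ 2 ^ (a * (c * k)) := by exact_mod_cast ha _ (Nat.mul_pos hc k_pos)
    _ = Real.exp (r * k) := by
      rw [← Real.exp_log (by norm_num : (0 : ℝ) < 2), ← Real.exp_nat_mul, hr]
      push_cast
      ring_nf
    _ ≤ Real.exp (r * (1 / ε + 1)) := by gcongr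
    _ = Real.exp r * Real.exp (r / ε) := by rw [← Real.exp_add]; ring_nf
    _ ≤ Real.exp r * Real.exp (Real.exp r / ε) := by gcongr

theorem Coupled.exists_fuel {α σ : Type} {e : ℕ → PMF (Option σ)} {D : PMF α}
    {R : α → σ → Prop} (h : Coupled e D R) :
    ∃ fuel, (∀ r ∈ (e fuel).support, ∃ s, r = some s ∧ ∃ x, R x s) ∧
      ∀ t : Set α, D.toOuterMeasure t ≤
        (e fuel).toOuterMeasure {r | ∃ s, r = some s ∧ ∃ x ∈ t, R x s} := by
  obtain ⟨J, -, hD, he, hJ⟩ := h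
  obtain ⟨fuel, hfuel⟩ := he.exists
  refine ⟨fuel, fun r hr => ?_, fun t => ?_⟩
  · rw [hfuel, PMF.mem_support_map_iff] at hr
    obtain ⟨x, hx, rfl⟩ := hr
    exact ⟨x.2, rfl, x.1, hJ x hx⟩
  · rw [hfuel, ← hD, PMF.toOuterMeasure_map_apply, PMF.toOuterMeasure_map_apply]
    exact PMF.toOuterMeasure_mono _ fun x ⟨hx, hsupp⟩ => ⟨x.2, rfl, x.1, hx, hJ x hsupp⟩

theorem two_thirds_le_toOuterMeasure {α : Type*} (p : PMF α) (s : Set α)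
    (h : p.toOuterMeasure sᶜ ≤ 1 / 3) : 2 / 3 ≤ p.toOuterMeasure s := by
  have one_le : 1 ≤ p.toOuterMeasure s + p.toOuterMeasure sᶜ := by
    calc 1 = p.toOuterMeasure Set.univ :=
          ((p.toOuterMeasure_apply_eq_one_iff _).mpr (Set.subset_univ _)).symm
      _ ≤ _ := by rw [← Set.union_compl_self s]; exact measure_union_le _ _
  have sum_eq : (2 / 3 : ℝ≥0∞) + 1 / 3 = 1 := by
    rw [ENNReal.div_add_div_same, two_add_one_eq_three]
    exact ENNReal.div_self (by norm_num) (by norm_num)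
  have finite : (1 / 3 : ℝ≥0∞) ≠ ⊤ := ENNReal.div_ne_top (by norm_num) (by norm_num)
  rw [← ENNReal.add_le_add_iff_right finite, sum_eq]
  exact one_le.trans (by gcongr)

/-! ### Accuracy of the output -/

theorem Encodes.wellFormed_and_W1_le {n k : ℕ} [NeZero n] {t : Fin n → ℝ} {M : ℕ → ℕ}
    {s : State n} (hk : 1 ≤ k) (ht : ∀ i, |t i| ≤ 1)
    (hM : ApproxMoments (256 * k) t fun j => M (8 * (256 * k) - j))
    (h : Encodes (gridSize (256 * k))
      (weightValue (256 * k) ((countPoly (8 * (256 * k)) M).eval (codeBase (256 * k)))) s.mem) :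
    s.WellFormed ∧ W1 s.output (spectralDistribution t) ≤ ENNReal.ofReal (1 / k) := by
  have weights := approxWeights_weightValue (by omega) ht hM
  rw [h.output_eq]
  exact ⟨h.wellFormed (gridSize_pos _) (weightValue_nonneg _ _)
    (ApproxWeights.sum_pos (by omega) ht hM weights), ApproxWeights.W1_le hk rfl ht hM weights⟩

end

end SpectralSampling

theorem theorem3 :
    ∃ (P : SpectralSampling.Prog) (C : ℝ), 0 < C ∧
      ∀ (n : ℕ) [NeZero n] (A Q : Matrix (Fin n) (Fin n) ℝ) (lam : Fin n → ℝ)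
        (hA : A ∈ Matrix.colStochastic ℝ (Fin n)),
        IsUnit Q →
        A = Q * Matrix.diagonal lam * Q⁻¹ →
        (∀ i, lam i ∈ Set.Icc (-1 : ℝ) 1) →
        ∀ ε : ℝ, 0 < ε →
          ∃ fuel : ℕ,
            (∀ r ∈ (SpectralSampling.exec (SpectralSampling.column A hA) fuel P
                (SpectralSampling.State.init n ⌈1 / ε⌉₊)).support,
              ∃ s : SpectralSampling.State n, r = some s ∧
                (s.time : ℝ) ≤ C * Real.exp (C / ε) ∧
                (s.queries : ℝ) ≤ C * Real.exp (C / ε)) ∧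
            (2 / 3 : ENNReal) ≤
              (SpectralSampling.exec (SpectralSampling.column A hA) fuel P
                (SpectralSampling.State.init n ⌈1 / ε⌉₊)).toOuterMeasure
                {r | ∃ s : SpectralSampling.State n, r = some s ∧ s.WellFormed ∧
                  SpectralSampling.W1 s.output (SpectralSampling.spectralDistribution lam)
                    ≤ ENNReal.ofReal ε} := by
  obtain ⟨T, hT, simulates⟩ := SpectralSampling.exists_simulates_spectralProgram
  obtain ⟨C, C_pos, T_le⟩ := hT.exists_le_exp (c := 256) (by norm_num)
  refine ⟨SpectralSampling.spectralProgram, C, C_pos, fun n _ A Q lam hA hQ hAQ hlam ε hε => ?_⟩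
  have k_pos : 1 ≤ ⌈1 / ε⌉₊ := Nat.ceil_pos.mpr (by positivity)
  have inv_le : 1 / (⌈1 / ε⌉₊ : ℝ) ≤ ε :=
    (one_div_le hε (by exact_mod_cast k_pos)).mp (Nat.le_ceil _)
  obtain ⟨fuel, halts, coupled⟩ :=
    (simulates n (SpectralSampling.column A hA) _ k_pos (.init n _) rfl rfl).exists_fuel
  refine ⟨fuel, fun r hr => ?_, ?_⟩
  · obtain ⟨s, rfl, _, _, time_le, queries_le⟩ := halts r hr
    rw [SpectralSampling.State.init, zero_add] at time_le queries_le
    exact ⟨s, rfl, (Nat.cast_le.mpr time_le).trans (T_le ε hε),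
      (Nat.cast_le.mpr queries_le).trans (T_le ε hε)⟩
  · refine (SpectralSampling.two_thirds_le_toOuterMeasure _ _
      (SpectralSampling.toOuterMeasure_not_approxMoments_le hA hQ hAQ _)).trans
      ((coupled _).trans (PMF.toOuterMeasure_mono _ ?_))
    rintro _ ⟨⟨s, rfl, M, hM, encodes, -⟩, -⟩
    obtain ⟨wellFormed, W1_le⟩ :=
      encodes.wellFormed_and_W1_le k_pos (fun i => abs_le.mpr (hlam i)) hM
    exact ⟨s, rfl, wellFormed, W1_le.trans (ENNReal.ofReal_le_ofReal inv_le)⟩
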